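/- All graphs are finite, simple, connected and nonempty; $n$ and $m$ are the numbers of vertices and edges, $e(w)=\max_x \mathrm{dist}(w,x)$ is the eccentricity of $w$, and the diameter is the maximum distance between two vertices. A graph is chordal if it has no induced cycle of length at least $4$. It has a dominating shortest path if, for some shortest path $P$ between two vertices, every vertex is on $P$ or has a neighbour on $P$; it has a dominating edge if, for some edge $ab$, every vertex is $a$ or $b$ or is adjacent to $a$ or $b$. A split graph is a graph whose vertex set can be partitioned into a clique and a stable set. LexBFS visits the vertices one by one; the $i$-th visited vertex gets the number $n+1-i$, and, after an arbitrary start vertex, the next visited vertex is any unvisited vertex for which the decreasing list of the numbers of its visited neighbours is lexicographically largest. $3$-sweep LexBFS consists of three consecutive executions of LexBFS, the first from an arbitrary vertex, the second and the third from the vertex visited last by the preceding execution. Algorithms are programs of a unit-cost random access machine (constants, addition, subtraction, indirect load and store, conditional jump) whose words have $O(\log(n+m))$ bits on a graph with $n$ vertices and $m$ edges, given by the list of its edges, and $O(n)$ bits on a CNF formula with $n$ variables. The Strong Exponential-Time Hypothesis (SETH) says that for every $\varepsilon>0$ there is a $k$ such that no such deterministic algorithm decides $k$-SAT (satisfiability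 of CNF formulas without repeated clauses, with at most $k$ literals per clause) on $n$ variables in time $O((2-\varepsilon)^n)$. Theorem. (1) Let $G$ be a chordal graph with a dominating shortest path, let $w$ be the vertex output by $3$-sweep LexBFS (regardless of how ties are broken, and whether the output is taken to be the vertex from which the third execution starts or the vertex that the third execution visits last), and let $d=e(w)$. If $d\ge 3$, then $d$ is the diameter of $G$. (2) There is an algorithm that, given a chordal graph with a dominating shortest path, decides in time $O(n+m)$ whether its diameter is at least $4$. (3) If SETH holds, then for no $\varepsilon>0$ is there an algorithm that, given a split graph with a dominating edge whose diameter is $2$ or $3$, decides in time $O((n+m)^{2-\varepsilon})$ which of the two it is. -/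

import Mathlib

/-! ### Graph classes -/

namespace Dicho

/-- A graph is chordal if it has no induced cycle of length at least four. -/
def IsChordal {V : Type*} (G : SimpleGraph V) : Prop :=
  ∀ k : ℕ, 4 ≤ k → IsEmpty (SimpleGraph.cycleGraph k ↪g G)

/-- Some shortest path `p` dominates: every vertex is on `p` or has a neighbour on `p`.
(A walk whose length is the distance of its ends is automatically a path.) -/
def HasDominatingShortestPath {V : Type*} (G : SimpleGraph V) : Prop :=
  ∃ (x y : V) (p : G.Walk x y), p.length = G.dist x y ∧
    ∀ z : V, ∃ q ∈ p.support, z = q ∨ G.Adj z q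

/-- The vertex set can be partitioned into a clique `K` and a stable set. -/
def IsSplit {V : Type*} (G : SimpleGraph V) : Prop :=
  ∃ K : Set V, G.IsClique K ∧ G.IsIndepSet Kᶜ

/-- Some edge `ab` dominates: every vertex is `a` or `b`, or is adjacent to one of them. -/
def HasDominatingEdge {V : Type*} (G : SimpleGraph V) : Prop :=
  ∃ a b : V, G.Adj a b ∧ ∀ z : V, z = a ∨ z = b ∨ G.Adj z a ∨ G.Adj z b

/-! ### Lexicographic breadth-first search -/

/-- Let `σ 0, σ 1, …, σ n` be the order in which the vertices are visited; the vertex `σ j`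
receives the number `n + 1 - j`. The label of `x` just before the `i`-th visit is the list, in
order of visit (so in decreasing order), of the numbers of the neighbours of `x` that have been
visited so far. -/
noncomputable def lexLabel {V : Type*} (G : SimpleGraph V) {n : ℕ} (σ : Fin (n + 1) → V)
    (i : Fin (n + 1)) (x : V) : List ℕ :=
  open Classical in
  ((List.finRange (n + 1)).filter (fun j => j < i ∧ G.Adj (σ j) x)).map (fun j => n + 1 - j.val)

/-- `σ` is the visiting order of an execution of LexBFS with start vertex `σ 0`: each visited
vertex has a lexicographically largest label among the vertices not visited yet. Ties are broken
arbitrarily. (For `i = 0` all labels are empty, so that the start vertex is arbitrary.) -/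
def IsLexBFS {V : Type*} (G : SimpleGraph V) {n : ℕ} (σ : Fin (n + 1) ≃ V) : Prop :=
  ∀ i j : Fin (n + 1), i ≤ j → lexLabel G σ i (σ j) ≤ lexLabel G σ i (σ i)

/-- Three consecutive executions of LexBFS, the second and the third one starting at the vertex
visited last by the preceding one. -/
structure IsThreeSweep {V : Type*} (G : SimpleGraph V) {n : ℕ}
    (σ₁ σ₂ σ₃ : Fin (n + 1) ≃ V) : Prop where
  first : IsLexBFS G σ₁
  second : IsLexBFS G σ₂
  third : IsLexBFS G σ₃
  start_second : σ₂ 0 = σ₁ (Fin.last n)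
  start_third : σ₃ 0 = σ₂ (Fin.last n)

/-! ### Random access machines

The machine is a unit-cost random access machine on words of logarithmic length (a word RAM), with
the instruction set of Cook and Reckhow: constants, addition, subtraction, indirect loads and
stores, and conditional jumps. Further word operations (multiplication, bit operations) can be
simulated with a slowdown polynomial in the word length, which changes none of the lower bounds
below, and are not needed for linear-time algorithms. -/

/-- Instructions. Arguments called `d`, `a`, `b` are indices of registers. -/
inductive Instr where
  /-- `r_d := v` -/
  | const (d v : ℕ)
  /-- `r_d := r_a + r_b` -/
  | add (d a b : ℕ)
  /-- `r_d := max (r_a - r_b) 0` -/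
  | sub (d a b : ℕ)
  /-- `r_d := mem[r_a]` -/
  | load (d a : ℕ)
  /-- `mem[r_d] := r_a` -/
  | store (d a : ℕ)
  /-- if `r_a = 0`, jump to instruction number `l` -/
  | jz (a l : ℕ)

/-- A program; it halts when the program counter leaves the list. -/
abbrev Program := List Instr

structure State where
  pc : ℕ
  reg : ℕ → ℕ
  mem : ℕ → ℕ

/-- Execute one instruction. -/
def Instr.exec (s : State) : Instr → State
  | .const d v => ⟨s.pc + 1, Function.update s.reg d v, s.mem⟩
  | .add d a b => ⟨s.pc + 1, Function.update s.reg d (s.reg a + s.reg b), s.mem⟩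
  | .sub d a b => ⟨s.pc + 1, Function.update s.reg d (s.reg a - s.reg b), s.mem⟩
  | .load d a => ⟨s.pc + 1, Function.update s.reg d (s.mem (s.reg a)), s.mem⟩
  | .store d a => ⟨s.pc + 1, s.reg, Function.update s.mem (s.reg d) (s.reg a)⟩
  | .jz a l => ⟨if s.reg a = 0 then l else s.pc + 1, s.reg, s.mem⟩

/-- One step of the machine; a halted machine stays where it is. -/
def step (P : Program) (s : State) : State :=
  match P[s.pc]? with
  | none => s
  | some i => i.exec s

/-- The input word `x_i` is in memory cell `i`; everything else is `0`. -/
def initState (x : List ℕ) : State := ⟨0, fun _ => 0, fun i => x.getD i 0⟩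

/-- The state after `t` steps on the input `x`. -/
def run (P : Program) (x : List ℕ) (t : ℕ) : State := (step P)^[t] (initState x)

/-- On the input `x`, the program `P` halts after at most `T` steps, all words that occur are less
than `2 ^ w`, and the answer (the final content of register `0`, where a nonzero value means "yes")
is correct for the question `b`. -/
def DecidesWithin (P : Program) (x : List ℕ) (w : ℕ) (T : ℝ) (b : Prop) : Prop :=
  ∃ t : ℕ, (t : ℝ) ≤ T ∧ P.length ≤ (run P x t).pc ∧ ((run P x t).reg 0 ≠ 0 ↔ b) ∧
    ∀ s ≤ t, ∀ i : ℕ, (run P x s).reg i < 2 ^ w ∧ (run P x s).mem i < 2 ^ w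

/-! ### Graphs as inputs -/

/-- A simple graph with vertices `0, …, order - 1`, given by a list of its edges, each edge being
listed exactly once, in an arbitrary order and orientation. -/
structure GraphInput where
  order : ℕ
  edges : List (Fin order × Fin order)
  loopless : ∀ e ∈ edges, e.1 ≠ e.2
  nodup : (edges.map fun e => s(e.1, e.2)).Nodup

/-- The graph that is described by the input. -/
def GraphInput.graph (I : GraphInput) : SimpleGraph (Fin I.order) where
  Adj u v := (u, v) ∈ I.edges ∨ (v, u) ∈ I.edges
  symm := ⟨fun _ _ h => h.symm⟩
  loopless := ⟨fun u h => I.loopless (u, u) (h.elim id id) rfl⟩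

/-- The input is the sequence of words `n, m, u₁, v₁, …, u_m, v_m`. -/
def GraphInput.code (I : GraphInput) : List ℕ :=
  I.order :: I.edges.length :: I.edges.flatMap fun e => [e.1.val, e.2.val]

/-- `n + m` -/
def GraphInput.size (I : GraphInput) : ℕ := I.order + I.edges.length

/-- Words have `O(log (n + m))` bits. -/
def GraphInput.wordLength (c : ℕ) (I : GraphInput) : ℕ := c * (Nat.log 2 I.size + 1)

/-- Some algorithm decides the question `yes` in time `O(n + m)`, on all inputs that satisfy the
promise. -/
def LinearTimeDecidable (promise yes : GraphInput → Prop) : Prop :=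
  ∃ (P : Program) (c : ℕ) (C : ℝ), ∀ I : GraphInput, promise I →
    DecidesWithin P I.code (I.wordLength c) (C * I.size) (yes I)

/-- Some algorithm decides the question `yes` in time `O(N ^ (2 - ε))` for some `ε > 0`, where
`N = n + m`, on all inputs that satisfy the promise. -/
def TrulySubquadraticDecidable (promise yes : GraphInput → Prop) : Prop :=
  ∃ (P : Program) (c : ℕ) (C ε : ℝ), 0 < ε ∧ ∀ I : GraphInput, promise I →
    DecidesWithin P I.code (I.wordLength c) (C * (I.size : ℝ) ^ (2 - ε)) (yes I)

/-! ### The Strong Exponential-Time Hypothesis -/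

/-- A `k`-CNF formula: a list, without repetition, of clauses with at most `k` literals. The
literal `(v, true)` is the variable `v`, and `(v, false)` is its negation. -/
structure KCNF (k : ℕ) where
  vars : ℕ
  clauses : List (List (Fin vars × Bool))
  width : ∀ cl ∈ clauses, cl.length ≤ k
  nodup : clauses.Nodup

def KCNF.Satisfiable {k : ℕ} (φ : KCNF k) : Prop :=
  ∃ τ : Fin φ.vars → Bool, ∀ cl ∈ φ.clauses, ∃ l ∈ cl, τ l.1 = l.2

/-- The input is the number of variables, the number of clauses, and then, for each clause, its
length followed by its literals, where `v` is written as `2 v + 1` and its negation as `2 v`. -/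
def KCNF.code {k : ℕ} (φ : KCNF k) : List ℕ :=
  φ.vars :: φ.clauses.length ::
    φ.clauses.flatMap fun cl => cl.length :: cl.map fun l => 2 * l.1.val + l.2.toNat

/-- The Strong Exponential-Time Hypothesis: for every `ε > 0` (it makes no difference to ask this
only for `ε < 1`) there is a `k` such that no algorithm decides `k`-SAT on `n` variables in time
`O((2 - ε) ^ n)`, with words of `O(n)` bits. -/
def SETH : Prop :=
  ∀ ε : ℝ, 0 < ε → ε < 1 → ∃ k : ℕ, ¬ ∃ (P : Program) (c : ℕ) (C : ℝ), ∀ φ : KCNF k,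
    DecidesWithin P φ.code (c * (φ.vars + 1)) (C * (2 - ε) ^ φ.vars) φ.Satisfiable

end Dicho

/-! Parts (1) and (2) rest on one fact about a LexBFS order of a connected chordal graph: for every
odd `r`, the vertices that are visited no later than `u` and lie within distance `r` of `u` are
pairwise within distance `r` (`IsLexOrder.dist_le_of_earlier`). For `r = 1` this is the classical
perfect elimination order (`IsLexOrder.adj_of_earlier`). The induction from `r` to `r + 2` replaces
`u` by the first visited vertex of its closed neighbourhood, and `x` by a vertex next to it that is
visited early enough (`IsLexOrder.exists_near`). For the last vertex `u` of the order nothing is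
excluded, so an odd upper bound on the eccentricity of `u` bounds the diameter.

For an even bound `2 k`, suppose that `x` and `y` are at distance more than `2 k`. The fact for `2 k
- 1` puts both at distance exactly `2 k` from the last vertex `u` of the second run, and likewise
from its start `v`, which is the last vertex of the first run; moreover `u` and `v` are at distance
at least `2 k`. A dominating shortest path has length at most `2 k + 1` and has no room for four
vertices so far apart if `k ≥ 2` (`sweep_two_dist_le`). The third run adds nothing but the freedom
of what to output.

For (2), the case `r = 3` shows that the diameter is at least four exactly if the last vertex of a
single LexBFS has eccentricity at least four. LexBFS runs in linear time by partition refinement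
(`Refining.step`, `lexBFS_wp`), and three rounds of relaxing all edges find the ball of radius
three. Programs are written in a small structured language with exact step counts, a verified
compiler (`leads_cmd`) and a calculus of preconditions.

For (3), the variables of a formula are split into two halves. The graph has a vertex for each
assignment of a half and a clique consisting of the clauses and two further vertices, one joined to
all assignments of the first half, the other to those of the second. An assignment is joined to the
clauses that it leaves unsatisfied, so two assignments of different halves have a common neighbour
exactly if together they violate a clause; the diameter is `3` exactly if the formula is satisfiable
(`KCNF.reductionGraph_diam_eq_three_iff`). For fixed width the graph has `2 ^ (n / 2)` times a
polynomial many vertices and edges, so a truly subquadratic algorithm would contradict SETH. The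
reduction is itself a program, and the hypothetical algorithm is simulated on the array that it
writes (`decidesWithin_followedBy`). -/

namespace Dicho

/-! ### Paths in chordal graphs -/

section Chordal

variable {V : Type*} {G : SimpleGraph V}

/-- `w 0, …, w k` is a walk from `x` to `y` whose interior vertices lie in `S`. -/
structure IsPathThrough (G : SimpleGraph V) (S : Set V) (x y : V) (k : ℕ) (w : ℕ → V) : Prop where
  start : w 0 = x
  finish : w k = y
  adj : ∀ i < k, G.Adj (w i) (w (i + 1))
  inner : ∀ i, 0 < i → i < k → w i ∈ S

/-- Cutting out the part of the walk strictly between the positions `i` and `i + c + 1`. -/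
theorem IsPathThrough.shortcut {S : Set V} {x y : V} {k : ℕ} {w : ℕ → V}
    (h : IsPathThrough G S x y k w) {i c : ℕ} (hk : i + c + 1 ≤ k)
    (hadj : G.Adj (w i) (w (i + c + 1))) :
    IsPathThrough G S x y (k - c) fun t => if t ≤ i then w t else w (t + c) := by
  refine ⟨by simp [h.start], ?_, fun t ht => ?_, fun t ht ht' => ?_⟩
  · rw [if_neg (by omega), show k - c + c = k by omega, h.finish]
  · rcases lt_trichotomy t i with hti | rfl | hti
    · simp only [if_pos hti.le, if_pos (show t + 1 ≤ i by omega)]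
      exact h.adj t (by omega)
    · simp only [le_refl, if_true, if_neg (show ¬ t + 1 ≤ t by omega)]
      rwa [show t + 1 + c = t + c + 1 by omega]
    · simp only [if_neg (show ¬ t ≤ i by omega), if_neg (show ¬ t + 1 ≤ i by omega)]
      rw [show t + 1 + c = t + c + 1 by omega]
      exact h.adj _ (by omega)
  · split_ifs with hti
    · exact h.inner t ht (by omega)
    · exact h.inner _ (by omega) (by omega)

/-- Cutting out a closed part of the walk. -/
theorem IsPathThrough.cut {S : Set V} {x y : V} {k : ℕ} {w : ℕ → V}
    (h : IsPathThrough G S x y k w) {i c : ℕ} (hk : i + c ≤ k) (heq : w i = w (i + c)) :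
    IsPathThrough G S x y (k - c) fun t => if t ≤ i then w t else w (t + c) := by
  refine ⟨by simp [h.start], ?_, fun t ht => ?_, fun t ht ht' => ?_⟩
  · split_ifs with hki
    · rw [show k - c = i by omega, heq, show i + c = k by omega, h.finish]
    · rw [show k - c + c = k by omega, h.finish]
  · rcases lt_trichotomy t i with hti | rfl | hti
    · simp only [if_pos hti.le, if_pos (show t + 1 ≤ i by omega)]
      exact h.adj t (by omega)
    · simp only [le_refl, if_true, if_neg (show ¬ t + 1 ≤ t by omega)]
      rw [show t + 1 + c = t + c + 1 by omega, heq]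
      exact h.adj _ (by omega)
    · simp only [if_neg (show ¬ t ≤ i by omega), if_neg (show ¬ t + 1 ≤ i by omega)]
      rw [show t + 1 + c = t + c + 1 by omega]
      exact h.adj _ (by omega)
  · split_ifs with hti
    · exact h.inner t ht (by omega)
    · exact h.inner _ (by omega) (by omega)

/-- A shortest walk through `S` is an induced path. -/
theorem IsPathThrough.exists_induced {S : Set V} {x y : V} {k : ℕ} {w : ℕ → V}
    (h : IsPathThrough G S x y k w) :
    ∃ k w, IsPathThrough G S x y k w ∧
      ∀ i j, i < j → j ≤ k → w i ≠ w j ∧ (G.Adj (w i) (w j) → j = i + 1) := by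
  classical
  have hex : ∃ k w, IsPathThrough G S x y k w := ⟨k, w, h⟩
  obtain ⟨w, hw⟩ := Nat.find_spec hex
  refine ⟨_, w, hw, fun i j hij hj => ⟨fun heq => ?_, fun hadj => ?_⟩⟩
  · obtain ⟨c, rfl⟩ := Nat.exists_eq_add_of_lt hij
    exact Nat.find_min hex (by omega) ⟨_, hw.cut (i := i) (c := c + 1) (by omega) heq⟩
  · by_contra hne
    obtain ⟨c, rfl⟩ := Nat.exists_eq_add_of_lt hij
    exact Nat.find_min hex (by omega) ⟨_, hw.shortcut (i := i) (c := c) (by omega) hadj⟩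

theorem cycleGraph_adj_iff {n : ℕ} (hn : 3 ≤ n) (u v : Fin n) :
    (SimpleGraph.cycleGraph n).Adj u v ↔ u.val + 1 = v.val ∨ v.val + 1 = u.val ∨
      (u.val = 0 ∧ v.val + 1 = n) ∨ (v.val = 0 ∧ u.val + 1 = n) := by
  rw [SimpleGraph.cycleGraph_adj']
  rcases lt_trichotomy u v with h | rfl | h
  · rw [Fin.coe_sub_iff_lt.2 h, Fin.coe_sub_iff_le.2 h.le]
    have : u.val < v.val := h
    omega
  · rw [Fin.coe_sub_iff_le.2 le_rfl]
    omega
  · rw [Fin.coe_sub_iff_lt.2 h, Fin.coe_sub_iff_le.2 h.le]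
    have : v.val < u.val := h
    omega

/-- In a chordal graph, two nonadjacent neighbours of `a` are not joined by a walk that avoids
the closed neighbourhood of `a`. -/
theorem IsChordal.not_isPathThrough (hG : IsChordal G) {a x y : V} (hx : G.Adj a x)
    (hy : G.Adj a y) (hne : x ≠ y) (hxy : ¬ G.Adj x y) (k : ℕ) (w : ℕ → V) :
    ¬ IsPathThrough G {v | v ≠ a ∧ ¬ G.Adj a v} x y k w := by
  intro hw
  obtain ⟨k, w, hw, hind⟩ := hw.exists_induced
  have hk : 2 ≤ k := by
    rcases k with _ | _ | k
    · exact absurd (hw.start.symm.trans hw.finish) hne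
    · have := hw.adj 0 (by omega)
      rw [hw.start, hw.finish] at this
      exact absurd this hxy
    · omega
  have hadj_a : ∀ i ≤ k, G.Adj a (w i) ↔ i = 0 ∨ i = k := by
    intro i hi
    refine ⟨fun h => ?_, ?_⟩
    · by_contra hcon
      exact (hw.inner i (by omega) (by omega)).2 h
    · rintro (rfl | rfl)
      · rwa [hw.start]
      · rwa [hw.finish]
  have hne_a : ∀ i ≤ k, w i ≠ a := by
    intro i hi h
    rcases Nat.eq_zero_or_pos i with rfl | h0
    · exact hx.ne (h.symm.trans hw.start)
    · rcases hi.lt_or_eq with h1 | rfl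
      · exact (hw.inner i h0 h1).1 h
      · exact hy.ne (h.symm.trans hw.finish)
  have hadj_w : ∀ i j, i ≤ k → j ≤ k → (G.Adj (w i) (w j) ↔ i + 1 = j ∨ j + 1 = i) := by
    intro i j hi hj
    refine ⟨fun h => ?_, ?_⟩
    · rcases lt_trichotomy i j with hij | rfl | hij
      · exact Or.inl ((hind i j hij hj).2 h).symm
      · exact absurd h (G.loopless.irrefl _)
      · exact Or.inr ((hind j i hij hi).2 h.symm).symm
    · rintro (rfl | rfl)
      · exact hw.adj _ (by omega)
      · exact (hw.adj _ (by omega)).symm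
  -- The induced path has `k + 1 ≥ 3` vertices and only its ends are adjacent to `a`, so that `a`
  -- closes it to an induced cycle of length `k + 2 ≥ 4`.
  refine (hG (k + 2) (by omega)).false ⟨⟨fun i => if i.val ≤ k then w i.val else a, ?_⟩, ?_⟩
  · intro i j hij
    simp only at hij
    ext
    split_ifs at hij with h1 h2 h2
    · rcases lt_trichotomy i.val j.val with h | h | h
      · exact absurd hij (hind _ _ h h2).1
      · exact h
      · exact absurd hij.symm (hind _ _ h h1).1
    · exact absurd hij (hne_a _ h1)
    · exact absurd hij.symm (hne_a _ h2)
    · omega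
  · intro i j
    rw [cycleGraph_adj_iff (by omega)]
    change G.Adj (if i.val ≤ k then w i.val else a) (if j.val ≤ k then w j.val else a) ↔ _
    have := i.isLt
    have := j.isLt
    split_ifs with h1 h2 h2
    · rw [hadj_w _ _ h1 h2]
      omega
    · rw [SimpleGraph.adj_comm, hadj_a _ h1]
      omega
    · rw [hadj_a _ h2]
      omega
    · simp only [SimpleGraph.irrefl, false_iff]
      omega

/-! ### LexBFS orders -/

/-- The characteristic property of LexBFS, where `τ v` is the time at which `v` is visited. -/
def IsLexOrder (G : SimpleGraph V) (τ : V → ℕ) : Prop :=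
  ∀ a b c, τ c < τ b → τ b < τ a → G.Adj c a → ¬ G.Adj c b →
    ∃ d, τ d < τ c ∧ G.Adj d b ∧ ¬ G.Adj d a

/-- On a chordal graph, LexBFS computes a perfect elimination order. -/
theorem IsLexOrder.adj_of_earlier (hG : IsChordal G) {τ : V → ℕ} (hτ : Function.Injective τ)
    (h : IsLexOrder G τ) {a x y : V} (hx : G.Adj a x) (hy : G.Adj a y) (hxa : τ x < τ a)
    (hya : τ y < τ a) (hne : x ≠ y) : G.Adj x y := by
  -- If `c` precedes `b` and is not adjacent to it, no walk joins them through vertices visited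
  -- after `b`. The induction is on the visiting time of `b`; the theorem is the case of a walk with
  -- the single interior vertex `a`.
  have key : ∀ N b c, τ b ≤ N → τ c < τ b → ¬ G.Adj c b →
      ∀ k w, ¬ IsPathThrough G {v | τ b < τ v} b c k w := by
    intro N
    induction N with
    | zero => intro b c hb hc; omega
    | succ N ih =>
      intro b c hb hcb hnadj k w hw
      obtain ⟨k, w, hw, hind⟩ := hw.exists_induced
      obtain ⟨k, rfl⟩ : ∃ l, k = l + 2 := by
        rcases k with _ | _ | k
        · exact absurd (congrArg τ (hw.start.symm.trans hw.finish)) hcb.ne'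
        · have := hw.adj 0 (by omega)
          rw [hw.start, hw.finish] at this
          exact absurd this.symm hnadj
        · exact ⟨k, rfl⟩
      have hca : G.Adj c (w (k + 1)) := by
        have := hw.adj (k + 1) (by omega)
        rw [hw.finish] at this
        exact this.symm
      obtain ⟨d, hdc, hdb, hda⟩ := h _ b c hcb (hw.inner (k + 1) (by omega) (by omega)) hca hnadj
      -- If `d` is adjacent to `c`, the walk from `c` via `d` and `b` back along the path to `w k`
      -- avoids the closed neighbourhood of `w (k + 1)` and joins two of its nonadjacent neighbours,
      -- against chordality.
      by_cases hd : G.Adj d c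
      · refine hG.not_isPathThrough (a := w (k + 1)) (x := c) (y := w k) hca.symm
          (hw.adj k (by omega)).symm ?_ ?_ (k + 2)
          (fun t => if t = 0 then c else if t = 1 then d else w (t - 2)) ⟨by simp, by simp, ?_, ?_⟩
        · have := (hind k (k + 2) (by omega) le_rfl).1
          rw [hw.finish] at this
          exact this.symm
        · intro hadj
          have := (hind k (k + 2) (by omega) le_rfl).2
          rw [hw.finish] at this
          exact absurd (this hadj.symm) (by omega)
        · rintro (_ | _ | t) ht
          · simpa using hd.symm
          · simpa [hw.start] using hdb
          · simpa using hw.adj t (by omega)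
        · rintro (_ | _ | t) ht ht'
          · omega
          · simp only [Nat.zero_add, one_ne_zero, if_false, if_true, Set.mem_ofPred_eq]
            refine ⟨?_, fun h => hda h.symm⟩
            rintro rfl
            have := hw.inner (k + 1) (by omega) (by omega)
            simp only [Set.mem_ofPred_eq] at this
            omega
          · have := hind t (k + 1) (by omega) (by omega)
            simp only [Set.mem_ofPred_eq, Nat.add_eq_zero_iff]
            rw [if_neg (by omega), if_neg (by omega)]
            exact ⟨this.1, fun h => absurd (this.2 h.symm) (by omega)⟩
      -- Otherwise `d`, `c` is a pair of the same kind with an earlier second vertex: the path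
      -- reversed and prolonged from `b` to `d` has its interior after `c`.
      · refine ih c d (by omega) hdc hd (k + 3)
          (fun t => if t ≤ k + 2 then w (k + 2 - t) else d) ⟨by simp [hw.finish], by simp, ?_, ?_⟩
        · intro i hi
          rcases Nat.lt_or_ge i (k + 2) with hi' | hi'
          · simp only [if_pos hi'.le, if_pos (show i + 1 ≤ k + 2 by omega)]
            have := hw.adj (k + 2 - (i + 1)) (by omega)
            rw [show k + 2 - (i + 1) + 1 = k + 2 - i by omega] at this
            exact this.symm
          · obtain rfl : i = k + 2 := by omega
            simpa [hw.start] using hdb.symm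
        · intro i h0 hi
          simp only [if_pos (show i ≤ k + 2 by omega), Set.mem_ofPred_eq]
          rcases Nat.lt_or_ge i (k + 2) with hi' | hi'
          · have := hw.inner (k + 2 - i) (by omega) (by omega)
            simp only [Set.mem_ofPred_eq] at this
            omega
          · rw [show k + 2 - i = 0 by omega, hw.start]
            exact hcb
  by_contra hxy
  rcases lt_trichotomy (τ x) (τ y) with hlt | heq | hlt
  · refine key _ y x le_rfl hlt hxy 2 (fun t => if t = 0 then y else if t = 1 then a else x)
      ⟨by simp, by simp, fun i hi => ?_, fun i h0 hi => ?_⟩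
    · interval_cases i
      · simpa using hy.symm
      · simpa using hx
    · obtain rfl : i = 1 := by omega
      simpa using hya
  · exact hne (hτ heq)
  · refine key _ x y le_rfl hlt (fun h => hxy h.symm) 2
      (fun t => if t = 0 then x else if t = 1 then a else y)
      ⟨by simp, by simp, fun i hi => ?_, fun i h0 hi => ?_⟩
    · interval_cases i
      · simpa using hx.symm
      · simpa using hy
    · obtain rfl : i = 1 := by omega
      simpa using hxa

/-- `f` is the vertex of the closed neighbourhood of `a` that is visited first. -/
def IsFirstNear (G : SimpleGraph V) (τ : V → ℕ) (a f : V) : Prop :=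
  (f = a ∨ G.Adj a f) ∧ ∀ z, (z = a ∨ G.Adj a z) → τ f ≤ τ z

theorem exists_isFirstNear (G : SimpleGraph V) (τ : V → ℕ) (a : V) :
    ∃ f, IsFirstNear G τ a f := by
  have hne : {z | z = a ∨ G.Adj a z}.Nonempty := ⟨a, Or.inl rfl⟩
  exact ⟨Function.argminOn τ _ hne, Function.argminOn_mem τ _ hne,
    fun z hz => Function.argminOn_le τ _ hz⟩

/-- If `fu` came before `fx`, it would be adjacent to `u` but not to `x`. The LexBFS property then
gives a neighbour of `x` visited even before `fu`, although `fx` is the first one. -/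
theorem IsLexOrder.isFirstNear_mono {τ : V → ℕ} (h : IsLexOrder G τ) {x u fx fu : V}
    (hxu : τ x ≤ τ u) (hτ : Function.Injective τ) (hx : IsFirstNear G τ x fx)
    (hu : IsFirstNear G τ u fu) : τ fx ≤ τ fu := by
  by_contra! hlt
  have hfx : τ fx ≤ τ x := hx.2 x (Or.inl rfl)
  have hxu' : τ x < τ u := by
    refine lt_of_le_of_ne hxu fun h => ?_
    obtain rfl := hτ h
    exact absurd (hx.2 _ hu.1) (by omega)
  rcases hu.1 with rfl | hadj
  · omega
  · obtain ⟨d, hd, hdx, -⟩ := h u x fu (by omega) hxu' hadj.symm fun hc =>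
      absurd (hx.2 fu (Or.inr hc.symm)) (by omega)
    exact absurd (hx.2 d (Or.inr hdx.symm)) (by omega)

/-- The distance from the start vertex is monotone in the time of the visit. -/
theorem IsLexOrder.dist_mono (hconn : G.Connected) {τ : V → ℕ} (hτ : Function.Injective τ)
    (h : IsLexOrder G τ) {s : V} (hs : ∀ v, τ s ≤ τ v) :
    ∀ (m : ℕ) (x u : V), τ x ≤ τ u → G.dist s u ≤ m → G.dist s x ≤ m := by
  intro m
  induction m with
  | zero =>
    intro x u hxu hu
    have : s = u := hconn.dist_eq_zero_iff.1 (by omega)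
    subst this
    have : s = x := hτ (le_antisymm (hs x) hxu)
    simp [this]
  | succ m ih =>
    intro x u hxu hu
    obtain ⟨fx, hfx⟩ := exists_isFirstNear G τ x
    obtain ⟨fu, hfu⟩ := exists_isFirstNear G τ u
    have hle := h.isFirstNear_mono hxu hτ hfx hfu
    obtain ⟨w, hw, hwd⟩ : ∃ w, (w = u ∨ G.Adj u w) ∧ G.dist s w ≤ m := by
      by_cases hsu : u = s
      · exact ⟨u, Or.inl rfl, by simp [hsu]⟩
      · obtain ⟨p, hp⟩ := hconn.exists_walk_length_eq_dist u s
        cases p with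
        | nil => exact absurd rfl hsu
        | cons hadj q =>
          refine ⟨_, Or.inr hadj, ?_⟩
          have := SimpleGraph.dist_le q
          rw [SimpleGraph.Walk.length_cons, SimpleGraph.dist_comm] at hp
          rw [SimpleGraph.dist_comm]
          omega
    -- The vertex `w` precedes `u` on a geodesic from `s` (or is `s`). Since `fx` is visited no
    -- later than `fu`, and `fu` no later than `w`, the induction hypothesis applies to `fx`.
    have h1 := ih fx w (hle.trans (hfu.2 w hw)) hwd
    have h2 := hconn.dist_triangle (u := s) (v := fx) (w := x)
    have h3 : G.dist fx x ≤ 1 := by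
      rcases hfx.1 with rfl | hadj
      · simp
      · exact (SimpleGraph.dist_eq_one_iff_adj.2 hadj.symm).le
    omega

theorem dist_le_one (G : SimpleGraph V) {x y : V} (h : x = y ∨ G.Adj x y) : G.dist x y ≤ 1 := by
  rcases h with rfl | h
  · simp
  · exact (SimpleGraph.dist_eq_one_iff_adj.2 h).le

theorem exists_geodesic (hconn : G.Connected) (x y : V) :
    ∃ w : ℕ → V, w 0 = x ∧ w (G.dist x y) = y ∧
      ∀ i j, i ≤ j → j ≤ G.dist x y → G.dist (w i) (w j) = j - i := by
  obtain ⟨p, hp⟩ := hconn.exists_walk_length_eq_dist x y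
  have hle : ∀ i c, i + c ≤ G.dist x y → G.dist (p.getVert i) (p.getVert (i + c)) ≤ c := by
    intro i c
    induction c with
    | zero => simp
    | succ c ih =>
      intro hc
      have h1 := ih (by omega)
      have h2 := p.adj_getVert_succ (i := i + c) (by omega)
      have h3 := hconn.dist_triangle (u := p.getVert i) (v := p.getVert (i + c))
        (w := p.getVert (i + c + 1))
      have h4 := dist_le_one G (Or.inr h2)
      rw [← Nat.add_assoc]
      omega
  refine ⟨p.getVert, by simp, by rw [← hp]; simp, fun i j hij hj => ?_⟩
  have h1 := hle 0 i (by omega)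
  have h2 := hle i (j - i) (by omega)
  have h3 := hle j (G.dist x y - j) (by omega)
  rw [show i + (j - i) = j by omega] at h2
  rw [show j + (G.dist x y - j) = G.dist x y by omega, ← hp, p.getVert_length] at h3
  rw [Nat.zero_add, p.getVert_zero] at h1
  have h4 := hconn.dist_triangle (u := x) (v := p.getVert i) (w := y)
  have h5 := hconn.dist_triangle (u := p.getVert i) (v := p.getVert j) (w := y)
  omega

end Chordal
-- Odd powers of a chordal graph.
section Chordal

variable {V : Type*} {G : SimpleGraph V}

/-- Both `f` and `w` are earlier neighbours of `a`, and earlier neighbours form a clique. -/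
theorem IsFirstNear.eq_or_adj (hG : IsChordal G) {τ : V → ℕ} (hτ : Function.Injective τ)
    (h : IsLexOrder G τ) {a f w : V} (hf : IsFirstNear G τ a f) (hw : G.Adj a w)
    (hwa : τ w < τ a) : f = w ∨ (G.Adj w f ∧ τ f < τ w) := by
  by_cases hfw : f = w
  · exact Or.inl hfw
  · have hle := hf.2 w (Or.inr hw)
    have hlt : τ f < τ w := lt_of_le_of_ne hle fun h => hfw (hτ h)
    refine Or.inr ⟨?_, hlt⟩
    rcases hf.1 with rfl | hadj
    · omega
    · exact h.adj_of_earlier hG hτ hw hadj hwa (by omega) (Ne.symm hfw)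

/-- The core of the induction for odd powers: any `x` visited before `u` is adjacent or equal to a
vertex, visited early, that is closer to the first neighbour of `u`. -/
theorem IsLexOrder.exists_near (hconn : G.Connected) (hG : IsChordal G) {τ : V → ℕ}
    (hτ : Function.Injective τ) (h : IsLexOrder G τ) {u x fu : V} (hxu : τ x ≤ τ u)
    (hfu : IsFirstNear G τ u fu) :
    ∃ x', G.dist x x' ≤ 1 ∧ τ x' ≤ τ fu ∧ G.dist fu x' ≤ max 1 (G.dist u x - 2) := by
  obtain ⟨w, hw0, hwj, hw⟩ := exists_geodesic hconn u x
  obtain ⟨fx, hfx⟩ := exists_isFirstNear G τ x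
  have hle : τ fx ≤ τ fu := h.isFirstNear_mono hxu hτ hfx hfu
  have hxfx : G.dist x fx ≤ 1 := dist_le_one G (hfx.1.imp Eq.symm id)
  obtain ⟨j, hj⟩ : ∃ j, j = G.dist u x := ⟨_, rfl⟩
  rw [← hj] at hwj hw ⊢
  have peo : ∀ {a x y : V}, G.Adj a x → G.Adj a y → τ x < τ a → τ y < τ a → G.dist x y ≤ 1 := by
    intro a x y h1 h2 h3 h4
    by_cases hxy : x = y
    · exact dist_le_one G (Or.inl hxy)
    · exact dist_le_one G (Or.inr (h.adj_of_earlier hG hτ h1 h2 h3 h4 hxy))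
  have hadj : ∀ i, i < j → G.Adj (w i) (w (i + 1)) := fun i hi =>
    SimpleGraph.dist_eq_one_iff_adj.1 (by rw [hw i (i + 1) (by omega) (by omega)]; omega)
  have hneτ : ∀ i, i < j → τ (w i) ≠ τ (w (i + 1)) := fun i hi he => (hadj i hi).ne (hτ he)
  -- The neighbours of a peak of `τ` on the geodesic would be adjacent, but they are at distance
  -- two. Hence `τ` first decreases along the geodesic and then increases.
  have valley : ∀ i, i + 2 ≤ j → τ (w i) < τ (w (i + 1)) → τ (w (i + 1)) < τ (w (i + 2)) := by
    intro i hi h1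
    by_contra hcon
    have h2 := hneτ (i + 1) (by omega)
    change ¬ τ (w (i + 1)) < τ (w (i + 1 + 1)) at hcon
    have h3 := peo (hadj i (by omega)).symm (hadj (i + 1) (by omega)) h1 (by omega)
    rw [hw i (i + 1 + 1) (by omega) (by omega)] at h3
    omega
  have up : ∀ c i, i + c + 1 ≤ j → τ (w i) < τ (w (i + 1)) →
      τ (w (i + c)) < τ (w (i + c + 1)) ∧ τ (w i) < τ (w (i + c + 1)) := by
    intro c
    induction c with
    | zero => intro i _ h1; exact ⟨h1, h1⟩
    | succ c ih =>
      intro i hi h1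
      have h2 := ih i (by omega) h1
      have h3 := valley (i + c) (by omega) h2.1
      rw [← Nat.add_assoc]
      exact ⟨h3, by rw [show i + c + 2 = i + c + 1 + 1 by omega] at h3; omega⟩
  rcases Nat.eq_zero_or_pos j with hj0 | hjpos
  · have : u = x := hconn.dist_eq_zero_iff.1 (by omega)
    subst this
    exact ⟨fu, dist_le_one G (hfu.1.imp Eq.symm id), le_rfl, by simp⟩
  -- An ascent in the first step would continue up to `x`, which is not visited after `u`.
  have hdown : τ (w 1) < τ u := by
    have h1 := hneτ 0 (by omega)
    rw [Nat.zero_add] at h1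
    by_contra hcon
    have h2 := (up (j - 1) 0 (by omega) (by rw [Nat.zero_add, hw0] at *; omega)).2
    rw [show 0 + (j - 1) + 1 = j by omega, hwj, hw0] at h2
    omega
  have hu1 : G.Adj u (w 1) := by simpa [hw0] using hadj 0 (by omega)
  have hfu1 := hfu.eq_or_adj hG hτ h hu1 hdown
  -- two descending steps at the end `u`
  have hfu2 : 2 ≤ j → τ (w 2) < τ (w 1) → G.dist fu (w 2) ≤ 1 := by
    intro h2 h12
    rcases hfu1 with rfl | ⟨h3, h4⟩
    · exact dist_le_one G (Or.inr (hadj 1 (by omega)))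
    · exact peo h3 (hadj 1 (by omega)) h4 h12
  by_cases hj1 : j = 1
  · rw [hj1] at hwj
    rw [hwj] at hu1 hdown hfu1
    rcases hfu1 with rfl | ⟨h1, h2⟩
    · exact ⟨fu, by simp, le_rfl, by simp⟩
    · refine ⟨fx, hxfx, hle, le_max_of_le_left ?_⟩
      have hne : fx ≠ x := by rintro rfl; omega
      exact peo h1 (hfx.1.resolve_left hne) h2 (by omega)
  by_cases hj2 : j = 2
  · have h12 := hadj 1 (by omega)
    have h12' := hneτ 1 (by omega)
    rw [hj2] at hwj
    simp only [Nat.reduceAdd, hwj] at h12 h12'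
    rcases lt_or_gt_of_ne h12' with hlt | hlt
    · refine ⟨fx, hxfx, hle, le_max_of_le_left ?_⟩
      rcases hfu1 with rfl | ⟨h1, h2⟩
      · rcases hfx.eq_or_adj hG hτ h h12.symm hlt with rfl | ⟨h3, h4⟩
        · simp
        · exact dist_le_one G (Or.inr h3)
      · rcases hfx.eq_or_adj hG hτ h h12.symm hlt with rfl | ⟨h3, h4⟩
        · exact dist_le_one G (Or.inr h1.symm)
        · exact peo h1 h3 h2 h4
    · have h3 := hfu2 (by omega) (by rwa [hwj])
      rw [hwj] at h3
      by_cases hxfu : τ x ≤ τ fu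
      · exact ⟨x, by simp, hxfu, le_max_of_le_left h3⟩
      · refine ⟨fx, hxfx, hle, le_max_of_le_left ?_⟩
        have hne : fx ≠ x := by rintro rfl; omega
        have hxfu' : G.Adj x fu := by
          have h0 : G.dist fu x ≠ 0 := by
            rw [Ne, hconn.dist_eq_zero_iff]
            rintro rfl
            omega
          exact (SimpleGraph.dist_eq_one_iff_adj.1 (by omega)).symm
        exact peo hxfu' (hfx.1.resolve_left hne) (by omega) (by omega)
  have hmax : max 1 (j - 2) = j - 2 := by omega
  rw [hmax]
  have hx1 : G.Adj x (w (j - 1)) := by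
    have := hadj (j - 1) (by omega)
    rw [show j - 1 + 1 = j by omega, hwj] at this
    exact this.symm
  have hlast : τ (w (j - 1)) ≠ τ x := by
    have := hneτ (j - 1) (by omega)
    rwa [show j - 1 + 1 = j by omega, hwj] at this
  have hjadj : G.Adj (w (j - 1)) (w (j - 2)) := by
    have := hadj (j - 2) (by omega)
    rw [show j - 2 + 1 = j - 1 by omega] at this
    exact this.symm
  have hj12 : τ (w (j - 2)) ≠ τ (w (j - 1)) := fun he => hjadj.ne (hτ he).symm
  -- The mirror image of `hfu2` at the end `x`: both `w (j - 2)` and `fx` are adjacent to or equal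
  -- to earlier neighbours of `w (j - 1)`.
  have hfx2 : τ (w (j - 2)) < τ (w (j - 1)) → τ (w (j - 1)) < τ x → G.dist (w (j - 2)) fx ≤ 1 := by
    intro h1 h2
    rcases hfx.eq_or_adj hG hτ h hx1 h2 with rfl | ⟨h3, h4⟩
    · exact dist_le_one G (Or.inr hjadj.symm)
    · exact peo hjadj h3 h1 h4
  have hcross : ∀ i, i ≤ j → G.dist fu (w i) ≤ 1 → i ≤ 2 := by
    intro i hi h1
    have h2 := hconn.dist_triangle (u := u) (v := fu) (w := w i)
    have h3 := dist_le_one G (hfu.1.imp Eq.symm id)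
    rw [← hw0, hw 0 i (by omega) hi, hw0] at h2
    omega
  rcases lt_or_gt_of_ne (hneτ 1 (by omega)) with hA | hA
  · -- ascending from `w 1` on
    have hup := fun c hc => up c 1 hc hA
    have h1 := (hup (j - 3) (by omega)).1
    have h2 := (hup (j - 2) (by omega)).1
    rw [show 1 + (j - 3) = j - 2 by omega, show j - 2 + 1 = j - 1 by omega] at h1
    rw [show 1 + (j - 2) = j - 1 by omega, show j - 1 + 1 = j by omega, hwj] at h2
    have h3 := hfx2 h1 h2
    refine ⟨fx, hxfx, hle, ?_⟩
    -- If `fu = w 1`, the two steps saved are the one from `u` and the one that `fx` saves at `x`.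
    -- Otherwise `fx` is no later than `fu`, hence strictly before `w 1`, and so it differs from `w
    -- (j - 2)`.
    rcases hfu1 with rfl | ⟨h4, h5⟩
    · have h6 := hconn.dist_triangle (u := w 1) (v := w (j - 2)) (w := fx)
      rw [hw 1 (j - 2) (by omega) (by omega)] at h6
      omega
    · have hfx3 : G.dist (w (j - 2)) fx ≠ 0 := by
        rw [Ne, hconn.dist_eq_zero_iff]
        rintro he
        rcases Nat.lt_or_ge 3 j with hj3 | hj3
        · have := (hup (j - 4) (by omega)).2
          rw [show 1 + (j - 4) + 1 = j - 2 by omega, he] at this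
          omega
        · rw [show j - 2 = 1 by omega] at he
          rw [← he] at hle
          omega
      have h7 : G.Adj (w (j - 2)) fx := SimpleGraph.dist_eq_one_iff_adj.1 (by omega)
      rcases Nat.lt_or_ge 3 j with hj3 | hj3
      -- Here `w (j - 3)` and `fx` are both earlier neighbours of `w (j - 2)`, so `x` would be
      -- within distance two of `w (j - 3)`, while the geodesic gives distance three.
      · exfalso
        have h8 := (hup (j - 4) (by omega))
        rw [show 1 + (j - 4) = j - 3 by omega, show j - 3 + 1 = j - 2 by omega] at h8
        have h9 := hadj (j - 3) (by omega)
        rw [show j - 3 + 1 = j - 2 by omega] at h9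
        have h10 := peo h9.symm h7 h8.1 (by omega)
        have h11 := hconn.dist_triangle (u := w (j - 3)) (v := fx) (w := x)
        have h12 := hw (j - 3) j (by omega) le_rfl
        rw [hwj] at h12
        rw [SimpleGraph.dist_comm (u := fx)] at h11
        omega
      · obtain rfl : j = 3 := by omega
        exact peo h4 h7 h5 (by omega)
  · have h1 := hfu2 (by omega) hA
    -- Since `fu` is within distance one of `w 2`, replacing `u` by `fu` saves one step; the second
    -- one is saved by moving from `x` to `x'`.
    have hbound : ∀ i, 2 ≤ i → i ≤ j → G.dist fu (w i) ≤ i - 1 := by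
      intro i hi hij
      have h2 := hconn.dist_triangle (u := fu) (v := w 2) (w := w i)
      rw [hw 2 i hi hij] at h2
      omega
    have hxw : G.dist x (w (j - 1)) ≤ 1 := dist_le_one G (Or.inr hx1)
    -- By the valley shape, a descending step forces all steps before it to descend.
    have hdesc : ∀ c i, i + c + 1 ≤ j → τ (w (i + c + 1)) < τ (w (i + c)) →
        τ (w (i + 1)) < τ (w i) ∧ τ (w (i + c + 1)) ≤ τ (w (i + 1)) := by
      intro c
      induction c with
      | zero => intro i hi hlt; exact ⟨hlt, le_rfl⟩
      | succ c ih =>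
        intro i hi hlt
        have h2 := hneτ (i + c) (by omega)
        have h3 : τ (w (i + c + 1)) < τ (w (i + c)) := by
          by_contra hcon
          have := valley (i + c) (by omega) (by omega)
          rw [← Nat.add_assoc] at hlt
          rw [show i + c + 2 = i + c + 1 + 1 by omega] at this
          omega
        have := ih i (by omega) h3
        rw [← Nat.add_assoc] at hlt
        exact ⟨this.1, by rw [← Nat.add_assoc]; omega⟩
    -- If `fu` came before `w 2`, then `fu` and `w 3` would be earlier neighbours of `w 2` and
    -- within distance one, which is too close for the geodesic from `u`.
    have h23 : τ (w 3) < τ (w 2) → τ (w 2) ≤ τ fu := by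
      intro h2
      by_contra hcon
      have h0 : G.dist (w 2) fu ≠ 0 := by
        rw [Ne, hconn.dist_eq_zero_iff]
        rintro he
        rw [he] at hcon
        omega
      have h3 : G.Adj (w 2) fu := by
        rw [SimpleGraph.dist_comm] at h0
        exact (SimpleGraph.dist_eq_one_iff_adj.1 (by omega)).symm
      have h4 := hcross 3 (by omega) (peo h3 (hadj 2 (by omega)) (by omega) h2)
      omega
    rcases lt_or_gt_of_ne hlast with hB | hB
    · rcases lt_or_gt_of_ne hj12 with hC | hC
      · have h2 := hfx2 hC hB
        refine ⟨fx, hxfx, hle, ?_⟩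
        have hj3 : j ≠ 3 := by
          rintro rfl
          simp only [Nat.reduceSub, Nat.reduceAdd] at hC hA
          omega
        have h3 := hbound (j - 2) (by omega) (by omega)
        have h4 := hconn.dist_triangle (u := fu) (v := w (j - 2)) (w := fx)
        omega
      · rcases Nat.lt_or_ge 3 j with hj3 | hj3
        · have h2 := hdesc (j - 4) 2 (by omega)
            (by rw [show 2 + (j - 4) + 1 = j - 1 by omega, show 2 + (j - 4) = j - 2 by omega]
                exact hC)
          rw [show 2 + (j - 4) + 1 = j - 1 by omega] at h2
          simp only [Nat.reduceAdd] at h2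
          have h3 := h23 h2.1
          exact ⟨w (j - 1), hxw, by omega, by have := hbound (j - 1) (by omega) (by omega); omega⟩
        · obtain hj3 : j = 3 := by omega
          simp only [hj3, Nat.reduceSub] at hB hxw hx1 ⊢
          by_cases h2 : τ (w 2) ≤ τ fu
          · exact ⟨w 2, hxw, h2, h1⟩
          -- For `j = 3` and `w 2` visited after `fu`, both `fu` and `fx` are earlier neighbours of
          -- `w 2`, unless `fx = w 2`, which is excluded by the order.
          · refine ⟨fx, hxfx, hle, ?_⟩
            have h0 : G.dist (w 2) fu ≠ 0 := by
              rw [Ne, hconn.dist_eq_zero_iff]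
              rintro he
              rw [he] at h2
              omega
            have h3 : G.Adj (w 2) fu := by
              rw [SimpleGraph.dist_comm] at h0
              exact (SimpleGraph.dist_eq_one_iff_adj.1 (by omega)).symm
            rcases hfx.eq_or_adj hG hτ h hx1 hB with rfl | ⟨h4, h5⟩
            · omega
            · exact peo h3 h4 (by omega) h5
    -- The last step descends, hence so does the whole geodesic, and `w (j - 1)` is no later than `w
    -- 2`, which is no later than `fu`.
    · have h2 := hdesc (j - 3) 2 (by omega)
        (by rw [show 2 + (j - 3) + 1 = j by omega, show 2 + (j - 3) = j - 1 by omega, hwj]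
            exact hB)
      have h3 := hdesc (j - 1 - 2) 1 (by omega)
        (by
          have := hneτ (j - 2) (by omega)
          rw [show 1 + (j - 1 - 2) + 1 = j - 1 by omega, show 1 + (j - 1 - 2) = j - 2 by omega]
          by_contra hcon
          have h5 := valley (j - 2) (by omega) (by
            rw [show j - 2 + 1 = j - 1 by omega]; omega)
          rw [show j - 2 + 1 = j - 1 by omega, show j - 2 + 2 = j by omega, hwj] at h5
          omega)
      rw [show 1 + (j - 1 - 2) + 1 = j - 1 by omega] at h3
      simp only [Nat.reduceAdd] at h2 h3
      have h4 := h23 h2.1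
      exact ⟨w (j - 1), hxw, by omega, by have := hbound (j - 1) (by omega) (by omega); omega⟩

/-- On a chordal graph, the LexBFS order is a perfect elimination order of all odd powers. -/
theorem IsLexOrder.dist_le_of_earlier (hconn : G.Connected) (hG : IsChordal G) {τ : V → ℕ}
    (hτ : Function.Injective τ) (h : IsLexOrder G τ) (k : ℕ) :
    ∀ u x y, τ x ≤ τ u → τ y ≤ τ u → G.dist u x ≤ 2 * k + 1 → G.dist u y ≤ 2 * k + 1 →
      G.dist x y ≤ 2 * k + 1 := by
  induction k with
  | zero =>
    intro u x y hxu hyu hx hy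
    rcases hxu.lt_or_eq with hxu | hxu
    · rcases hyu.lt_or_eq with hyu | hyu
      · have hadj : ∀ z, τ z < τ u → G.dist u z ≤ 1 → G.Adj u z := by
          intro z hz hd
          have h0 : G.dist u z ≠ 0 := by
            rw [Ne, hconn.dist_eq_zero_iff]
            rintro rfl
            omega
          exact SimpleGraph.dist_eq_one_iff_adj.1 (by omega)
        by_cases hxy : x = y
        · simp [hxy]
        · exact dist_le_one G (Or.inr
            (h.adj_of_earlier hG hτ (hadj x hxu hx) (hadj y hyu hy) hxu hyu hxy))
      · rw [hτ hyu, SimpleGraph.dist_comm]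
        exact hx
    · rw [hτ hxu]
      exact hy
  | succ k ih =>
    intro u x y hxu hyu hx hy
    obtain ⟨fu, hfu⟩ := exists_isFirstNear G τ u
    obtain ⟨x', hx1, hx2, hx3⟩ := h.exists_near hconn hG hτ hxu hfu
    obtain ⟨y', hy1, hy2, hy3⟩ := h.exists_near hconn hG hτ hyu hfu
    -- Seen from `fu`, both `x'` and `y'` are within `max 1 (2 * k + 1)` and visited no later. The
    -- two steps from `x` to `x'` and from `y'` to `y` account for the increase by two.
    have h1 := ih fu x' y' hx2 hy2 (by omega) (by omega)
    have h2 := hconn.dist_triangle (u := x) (v := x') (w := y)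
    have h3 := hconn.dist_triangle (u := x') (v := y') (w := y)
    rw [SimpleGraph.dist_comm (u := y')] at h3
    omega

end Chordal

section Sweep

/-! ### Executions of LexBFS -/

/-- Lexicographic comparison of two sublists of a strictly decreasing list. -/
theorem filter_map_lt {α : Type*} (f : α → ℕ) (p q : α → Bool) (l : List α)
    (hl : l.Pairwise fun a b => f b < f a)
    (h : ∃ c ∈ l, q c = true ∧ p c = false ∧ ∀ d ∈ l, f c < f d → p d = true → q d = true) :
    (l.filter p).map f < (l.filter q).map f := by
  induction l with
  | nil => simp at h
  | cons a l ih =>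
    obtain ⟨c, hc, hqc, hpc, hd⟩ := h
    rw [List.pairwise_cons] at hl
    rcases List.mem_cons.1 hc with rfl | hc'
    · rw [List.filter_cons_of_neg (by simp [hpc]), List.filter_cons_of_pos hqc, List.map_cons]
      cases hr : l.filter p with
      | nil => exact List.nil_lt_cons _ _
      | cons b r =>
        have hb : b ∈ l := List.mem_of_mem_filter (p := p) (by rw [hr]; simp)
        rw [List.map_cons, List.cons_lt_cons_iff]
        exact Or.inl (hl.1 b hb)
    · have hac := hl.1 c hc'
      have hih := ih hl.2 ⟨c, hc', hqc, hpc, fun d hdl => hd d (by simp [hdl])⟩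
      cases hpa : p a
      · rw [List.filter_cons_of_neg (by simp [hpa])]
        cases hqa : q a
        · rwa [List.filter_cons_of_neg (by simp [hqa])]
        · rw [List.filter_cons_of_pos hqa, List.map_cons]
          cases hr : l.filter p with
          | nil => exact List.nil_lt_cons _ _
          | cons b r =>
            have hb : b ∈ l := List.mem_of_mem_filter (p := p) (by rw [hr]; simp)
            rw [List.map_cons, List.cons_lt_cons_iff]
            exact Or.inl (hl.1 b hb)
      · have hqa := hd a (by simp) hac hpa
        rw [List.filter_cons_of_pos hpa, List.filter_cons_of_pos hqa, List.map_cons,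
          List.map_cons, List.cons_lt_cons_iff]
        exact Or.inr ⟨rfl, hih⟩

/-- If no such `d` existed, then `c` would witness that the label of `a` exceeds that of `b` when
`b` is visited: every earlier vertex that contributes to the label of `b` also contributes to that
of `a`. -/
theorem IsLexBFS.isLexOrder {V : Type*} {G : SimpleGraph V} {n : ℕ} {σ : Fin (n + 1) ≃ V}
    (h : IsLexBFS G σ) : IsLexOrder G fun v => (σ.symm v).val := by
  classical
  intro a b c hcb hba hca hncb
  by_contra! hcon
  have hle := h (σ.symm b) (σ.symm a) (Fin.le_def.2 hba.le)
  refine absurd ?_ (not_lt_of_ge hle)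
  unfold lexLabel
  refine filter_map_lt (fun j : Fin (n + 1) => n + 1 - j.val) _ _ _ ?_ ?_
  · refine (List.pairwise_lt_finRange (n + 1)).imp fun {i j} hij => ?_
    have h1 : i.val < j.val := hij
    have h2 := j.isLt
    change n + 1 - j.val < n + 1 - i.val
    omega
  · refine ⟨σ.symm c, List.mem_finRange _, ?_, ?_, fun d _ hd hp => ?_⟩
    · simpa using ⟨Fin.lt_def.2 hcb, hca⟩
    · simpa using fun _ => hncb
    · simp only [Equiv.apply_symm_apply, decide_eq_true_eq] at hp ⊢
      refine ⟨hp.1, ?_⟩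
      have := hcon (σ d) (by
        have := d.isLt
        have := (σ.symm c).isLt
        simp only [Equiv.symm_apply_apply]
        omega) hp.2
      exact this

/-! ### The diameter in the presence of a dominating shortest path. -/

variable {V : Type*} {G : SimpleGraph V}

/-- Any two vertices `x`, `y` have positions on a dominating shortest path. -/
theorem HasDominatingShortestPath.exists_position (hconn : G.Connected)
    (h : HasDominatingShortestPath G) : ∃ (ℓ : ℕ) (pos : V → ℕ), (∃ x y, G.dist x y = ℓ) ∧
      (∀ v, pos v ≤ ℓ) ∧ ∀ u v, G.dist u v ≤ (pos u - pos v) + (pos v - pos u) + 2 := by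
  obtain ⟨x, y, p, hp, hdom⟩ := h
  have hpos : ∀ v, ∃ i ≤ p.length, G.dist v (p.getVert i) ≤ 1 := by
    intro v
    obtain ⟨q, hq, hv⟩ := hdom v
    obtain ⟨i, rfl, hi⟩ := SimpleGraph.Walk.mem_support_iff_exists_getVert.1 hq
    exact ⟨i, hi, dist_le_one G hv⟩
  choose pos hpos1 hpos2 using hpos
  have hle : ∀ i c, i + c ≤ p.length → G.dist (p.getVert i) (p.getVert (i + c)) ≤ c := by
    intro i c
    induction c with
    | zero => simp
    | succ c ih =>
      intro hc
      have h1 := ih (by omega)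
      have h2 := dist_le_one G (Or.inr (p.adj_getVert_succ (i := i + c) (by omega)))
      have h3 := hconn.dist_triangle (u := p.getVert i) (v := p.getVert (i + c))
        (w := p.getVert (i + c + 1))
      rw [← Nat.add_assoc]
      omega
  have hle' : ∀ i j, i ≤ p.length → j ≤ p.length →
      G.dist (p.getVert i) (p.getVert j) ≤ (i - j) + (j - i) := by
    intro i j hi hj
    rcases le_total i j with hij | hij
    · have := hle i (j - i) (by omega)
      rw [show i + (j - i) = j by omega] at this
      omega
    · have := hle j (i - j) (by omega)
      rw [show j + (i - j) = i by omega, SimpleGraph.dist_comm] at this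
      omega
  refine ⟨p.length, pos, ⟨x, y, hp.symm⟩, hpos1, fun u v => ?_⟩
  have h1 := hle' (pos u) (pos v) (hpos1 u) (hpos1 v)
  have h2 := hpos2 u
  have h3 := hpos2 v
  have h4 := hconn.dist_triangle (u := u) (v := p.getVert (pos u)) (w := v)
  have h5 := hconn.dist_triangle (u := p.getVert (pos u)) (v := p.getVert (pos v)) (w := v)
  rw [SimpleGraph.dist_comm (u := p.getVert (pos v))] at h5
  omega

/-- If the last vertex `u` of a LexBFS order of a chordal graph has eccentricity at most `2 k` and
there are vertices `x`, `y` at distance more than `2 k`, then they are both at distance `2 k`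
from `u`. -/
theorem IsLexOrder.dist_last_eq (hconn : G.Connected) (hG : IsChordal G) {τ : V → ℕ}
    (hτ : Function.Injective τ) (h : IsLexOrder G τ) {u x y : V} (hlast : ∀ v, τ v ≤ τ u) {k : ℕ}
    (hk : 1 ≤ k) (he : ∀ v, G.dist u v ≤ 2 * k) (hxy : 2 * k < G.dist x y) :
    G.dist u x = 2 * k := by
  by_contra hne
  have hx := he x
  obtain ⟨y', hy1, hy2⟩ : ∃ y', G.dist u y' ≤ 2 * k - 1 ∧ G.dist y' y ≤ 1 := by
    obtain ⟨w, hw0, hwj, hw⟩ := exists_geodesic hconn u y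
    have hy := he y
    refine ⟨w (G.dist u y - 1), ?_, ?_⟩
    · have := hw 0 (G.dist u y - 1) (by omega) (by omega)
      rw [hw0] at this
      omega
    · have := hw (G.dist u y - 1) (G.dist u y) (by omega) (by omega)
      rw [hwj] at this
      omega
  -- If `x` were closer, both `x` and the vertex `y'` before `y` on a geodesic from `u` would be
  -- within the odd number `2 * k - 1` of `u`, hence of each other.
  have h1 := h.dist_le_of_earlier hconn hG hτ (k - 1) u x y' (hlast x) (hlast y')
    (by omega) (by omega)
  have h2 := hconn.dist_triangle (u := x) (v := y') (w := y)
  omega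

/-- This carries part (1): from `3` on, an upper bound on the eccentricity of the last vertex of the
second run bounds all distances. An odd bound is immediate from the odd powers; an even one needs
the path. -/
theorem sweep_two_dist_le (hconn : G.Connected) (hG : IsChordal G)
    (hdom : HasDominatingShortestPath G) {n : ℕ} {σ₁ σ₂ : Fin (n + 1) ≃ V} (h₁ : IsLexBFS G σ₁)
    (h₂ : IsLexBFS G σ₂) (h : σ₂ 0 = σ₁ (Fin.last n)) {d : ℕ} (hd : 3 ≤ d)
    (he : ∀ v, G.dist (σ₂ (Fin.last n)) v ≤ d) (x y : V) : G.dist x y ≤ d := by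
  have hinj : ∀ σ : Fin (n + 1) ≃ V, Function.Injective fun v => (σ.symm v).val :=
    fun σ => Fin.val_injective.comp σ.symm.injective
  have hlast : ∀ (σ : Fin (n + 1) ≃ V) (v : V),
      (fun v => (σ.symm v).val) v ≤ (fun v => (σ.symm v).val) (σ (Fin.last n)) := by
    intro σ v
    have := (σ.symm v).isLt
    simp only [Equiv.symm_apply_apply, Fin.val_last]
    omega
  have hl₁ := h₁.isLexOrder
  have hl₂ := h₂.isLexOrder
  by_contra! hxy
  rcases Nat.even_or_odd' d with ⟨k, rfl | rfl⟩
  · set u := σ₂ (Fin.last n) with hu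
    set v := σ₁ (Fin.last n) with hv
    -- The run that starts at `v` visits the vertices in the order of their distance from `v`, so
    -- `u` is farthest from `v`.
    have hev : ∀ z, G.dist v z ≤ 2 * k := by
      intro z
      refine hl₂.dist_mono hconn (hinj σ₂) (s := v) (fun z => by simp [← h]) _ z u
        (hlast σ₂ z) ?_
      rw [SimpleGraph.dist_comm]
      exact he v
    have hux : G.dist u x = 2 * k :=
      hl₂.dist_last_eq hconn hG (hinj σ₂) (hlast σ₂) (by omega) he hxy
    have hvx : G.dist v x = 2 * k :=
      hl₁.dist_last_eq hconn hG (hinj σ₁) (hlast σ₁) (by omega) hev hxy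
    have hyx : 2 * k < G.dist y x := by rwa [SimpleGraph.dist_comm]
    have huy : G.dist u y = 2 * k :=
      hl₂.dist_last_eq hconn hG (hinj σ₂) (hlast σ₂) (by omega) he hyx
    have hvy : G.dist v y = 2 * k :=
      hl₁.dist_last_eq hconn hG (hinj σ₁) (hlast σ₁) (by omega) hev hyx
    have huv : 2 * k ≤ G.dist v u := by
      have h1 := hl₂.dist_mono hconn (hinj σ₂) (s := v) (fun z => by simp [← h]) _ x u
        (hlast σ₂ x) le_rfl
      rw [hvx] at h1
      exact h1
    obtain ⟨ℓ, pos, ⟨a, b, hab⟩, hpos, hdist⟩ := hdom.exists_position hconn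
    -- The path is shortest, so its length is a distance, and the eccentricity of `u` is also at
    -- most the odd number `2 * k + 1`.
    have hℓ : G.dist a b ≤ 2 * k + 1 :=
      hl₂.dist_le_of_earlier hconn hG (hinj σ₂) k u a b (hlast σ₂ a) (hlast σ₂ b)
        ((he a).trans (by omega)) ((he b).trans (by omega))
    -- The positions of `u`, `v`, `x`, `y` differ pairwise by at least `2 * k - 2`, so they span at
    -- least `6 * k - 6`. For `k ≥ 2` this exceeds `2 * k + 1`.
    have h1 := hdist u x
    have h2 := hdist u y
    have h3 := hdist v x
    have h4 := hdist v y
    have h5 := hdist v u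
    have h6 := hdist x y
    have h7 := hpos u
    have h8 := hpos v
    have h9 := hpos x
    have h10 := hpos y
    omega
  · have := hl₂.dist_le_of_earlier hconn hG (hinj σ₂) k _ x y (hlast σ₂ x) (hlast σ₂ y) (he x) (he y)
    omega

theorem dist_le_iff_eccent_le (hconn : G.Connected) (w : V) (d : ℕ) :
    G.eccent w ≤ d ↔ ∀ v, G.dist w v ≤ d := by
  rw [SimpleGraph.eccent_le_iff]
  refine forall_congr' fun v => ?_
  rw [← (hconn w v).coe_dist_eq_edist]
  exact Nat.cast_le

theorem diam_le_of_dist_le (hconn : G.Connected) {d : ℕ} (h : ∀ x y, G.dist x y ≤ d) :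
    G.ediam ≤ d := by
  refine SimpleGraph.ediam_le_of_edist_le fun x y => ?_
  rw [← (hconn x y).coe_dist_eq_edist]
  exact Nat.cast_le.2 (h x y)

theorem threeSweep_diam (hconn : G.Connected) (hG : IsChordal G)
    (hdom : HasDominatingShortestPath G) {n : ℕ} {σ₁ σ₂ σ₃ : Fin (n + 1) ≃ V}
    (h : IsThreeSweep G σ₁ σ₂ σ₃) {w : V} (hw : w = σ₂ (Fin.last n) ∨ w = σ₃ (Fin.last n)) {d : ℕ}
    (hd : 3 ≤ d) (he : G.eccent w = d) : G.diam = d := by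
  have hwd := (dist_le_iff_eccent_le hconn w d).1 he.le
  have hall : ∀ x y, G.dist x y ≤ d := by
    intro x y
    rcases hw with rfl | rfl
    · exact sweep_two_dist_le hconn hG hdom h.first h.second h.start_second hd hwd x y
    · have hinj : ∀ σ : Fin (n + 1) ≃ V, Function.Injective fun v => (σ.symm v).val :=
        fun σ => Fin.val_injective.comp σ.symm.injective
      -- The third run starts at the last vertex of the second one and ends at a vertex farthest
      -- from it.
      have hfar : ∀ z, G.dist (σ₂ (Fin.last n)) z ≤ d := by
        intro z
        refine h.third.isLexOrder.dist_mono hconn (hinj σ₃) (fun v => by simp [← h.start_third])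
          _ z (σ₃ (Fin.last n)) ?_ ?_
        · have := (σ₃.symm z).isLt
          simp only [Equiv.symm_apply_apply, Fin.val_last]
          omega
        · rw [SimpleGraph.dist_comm]
          exact hwd _
      exact sweep_two_dist_le hconn hG hdom h.first h.second h.start_second hd hfar x y
  have hle := diam_le_of_dist_le hconn hall
  have hge : (d : ℕ∞) ≤ G.ediam := he ▸ SimpleGraph.eccent_le_ediam
  unfold SimpleGraph.diam
  rw [le_antisymm hle hge]
  simp

end Sweep

/-! ### A structured programming language -/

/-- Expressions of a structured language with variables, a read-only input and 32 unbounded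
arrays. -/
inductive Expr where
  | lit (v : ℕ)
  | var (x : ℕ)
  | add (e f : Expr)
  | sub (e f : Expr)
  | inp (e : Expr)
  | arr (a : Fin 32) (e : Expr)

/-- Commands. The loop `rep e c` evaluates `e` once and then executes `c` that many times. -/
inductive Cmd where
  | skip
  | set (x : ℕ) (e : Expr)
  | put (a : Fin 32) (e f : Expr)
  | seq (c d : Cmd)
  | ite (e : Expr) (c d : Cmd)
  | rep (e : Expr) (c : Cmd)

/-- The values of the variables and arrays, and the number of machine steps made so far. -/
structure Store where
  var : ℕ → ℕ
  arr : Fin 32 → ℕ → ℕ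
  time : ℕ

/-- The input, the number of its cells, and a bound on all values. -/
structure Env where
  inp : ℕ → ℕ
  len : ℕ
  bound : ℕ
  inp_lt : ∀ i, inp i < bound

def Store.tick (k : ℕ) (s : Store) : Store := { s with time := s.time + k }

def Store.setVar (s : Store) (x v : ℕ) : Store := { s with var := Function.update s.var x v }

def Store.setArr (s : Store) (a : Fin 32) (i v : ℕ) : Store :=
  { s with arr := Function.update s.arr a (Function.update (s.arr a) i v) }

def Expr.eval (I : Env) (s : Store) : Expr → ℕ
  | lit v => v
  | var x => s.var x
  | add e f => e.eval I s + f.eval I s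
  | sub e f => e.eval I s - f.eval I s
  | inp e => I.inp (e.eval I s)
  | arr a e => s.arr a (e.eval I s)

/-- The value of every subexpression is less than the bound, and the input is only read within its
length. -/
def Expr.Safe (I : Env) (s : Store) : Expr → Prop
  | lit v => v < I.bound
  | var _ => True
  | add e f => e.Safe I s ∧ f.Safe I s ∧ e.eval I s + f.eval I s < I.bound
  | sub e f => e.Safe I s ∧ f.Safe I s
  | inp e => e.Safe I s ∧ e.eval I s < I.len
  | arr _ e => e.Safe I s

/-- The number of machine instructions of an expression. -/
def Expr.cost : Expr → ℕ
  | lit _ => 1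
  | var _ => 1
  | add e f => e.cost + f.cost + 1
  | sub e f => e.cost + f.cost + 1
  | inp e => e.cost + 1
  | arr _ e => e.cost + 9

/-- The ticks are exact. A loop pays `1` for copying the bound into the counter, `4` per round for
the test, the constant one, the decrement and the jump back, and `1` for the final test. The first
branch of a conditional pays for the jump over the second. -/
def Cmd.exec (I : Env) : Cmd → Store → Store
  | skip, s => s
  | set x e, s => (s.setVar x (e.eval I s)).tick (e.cost + 1)
  | put a e f, s => (s.setArr a (e.eval I s) (f.eval I s)).tick (e.cost + f.cost + 9)
  | seq c d, s => d.exec I (c.exec I s)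
  | ite e c d, s =>
    if e.eval I s = 0 then d.exec I (s.tick (e.cost + 1))
    else (c.exec I (s.tick (e.cost + 1))).tick 1
  | rep e c, s =>
    ((fun s => (c.exec I s).tick 4)^[e.eval I s] (s.tick (e.cost + 1))).tick 1

def Cmd.Safe (I : Env) : Cmd → Store → Prop
  | skip, _ => True
  | set _ e, s => e.Safe I s
  | put _ e f, s => e.Safe I s ∧ f.Safe I s
  | seq c d, s => c.Safe I s ∧ d.Safe I (c.exec I s)
  | ite e c d, s => e.Safe I s ∧
    (if e.eval I s = 0 then d.Safe I (s.tick (e.cost + 1)) else c.Safe I (s.tick (e.cost + 1)))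
  | rep e c, s => e.Safe I s ∧ ∀ j < e.eval I s,
    c.Safe I ((fun s => (c.exec I s).tick 4)^[j] (s.tick (e.cost + 1)))

/-! ### Compilation

Variable `v` is kept in register `4 v`, temporary values in the registers `4 t + 9`, the counter of
a loop of depth `d` in register `4 d + 2`, the length of the input in register `1`; register `5` is
always `0`, and so are the registers `4 r + 3`. Cell `i` of array `a` has the address
`len + 32 i + a`. -/

/-- Replace the index in temporary register `t` by the address of that cell of the array `a`. -/
def addressCode (a t : ℕ) : List Instr :=
  [.add (4 * t + 9) (4 * t + 9) (4 * t + 9), .add (4 * t + 9) (4 * t + 9) (4 * t + 9),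
    .add (4 * t + 9) (4 * t + 9) (4 * t + 9), .add (4 * t + 9) (4 * t + 9) (4 * t + 9),
    .add (4 * t + 9) (4 * t + 9) (4 * t + 9), .add (4 * t + 9) (4 * t + 9) 1,
    .const (4 * (t + 1) + 9) a, .add (4 * t + 9) (4 * t + 9) (4 * (t + 1) + 9)]

/-- The result is left in temporary register `t`. A right operand is computed from `t + 1` on, so
that the left one survives. -/
def Expr.code (t : ℕ) : Expr → List Instr
  | lit v => [.const (4 * t + 9) v]
  | var x => [.add (4 * t + 9) (4 * x) 5]
  | add e f => e.code t ++ (f.code (t + 1) ++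
      [.add (4 * t + 9) (4 * t + 9) (4 * (t + 1) + 9)])
  | sub e f => e.code t ++ (f.code (t + 1) ++
      [.sub (4 * t + 9) (4 * t + 9) (4 * (t + 1) + 9)])
  | inp e => e.code t ++ [.load (4 * t + 9) (4 * t + 9)]
  | arr a e => e.code t ++ (addressCode a t ++ [.load (4 * t + 9) (4 * t + 9)])

def Cmd.size : Cmd → ℕ
  | skip => 0
  | set _ e => e.cost + 1
  | put _ e f => e.cost + f.cost + 9
  | seq c d => c.size + d.size
  | ite e c d => e.cost + c.size + d.size + 2
  | rep e c => e.cost + c.size + 5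

/-- The machine code of a command that starts at position `o`, inside of `d` loops. -/
def Cmd.code (o d : ℕ) : Cmd → List Instr
  | skip => []
  | set x e => e.code 0 ++ [.add (4 * x) 9 5]
  | put a e f => e.code 0 ++ (addressCode a 0 ++ (f.code 1 ++ [.store 9 13]))
  | seq c c' => c.code o d ++ c'.code (o + c.size) d
  | ite e c c' => e.code 0 ++ (.jz 9 (o + e.cost + 1 + c.size + 1) ::
      (c.code (o + e.cost + 1) d ++ (.jz 5 (o + e.cost + 1 + c.size + 1 + c'.size) ::
        c'.code (o + e.cost + 1 + c.size + 1) d)))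
  | rep e c => e.code 0 ++ (.add (4 * d + 2) 9 5 :: .jz (4 * d + 2) (o + e.cost + c.size + 5) ::
      (c.code (o + e.cost + 2) (d + 1) ++
        [.const 9 1, .sub (4 * d + 2) (4 * d + 2) 9, .jz 5 (o + e.cost + 1)]))

theorem Expr.length_code (e : Expr) (t : ℕ) : (e.code t).length = e.cost := by
  induction e generalizing t with
  | lit v => rfl
  | var x => rfl
  | add e f he hf => simp [code, cost, he, hf, Nat.add_assoc]
  | sub e f he hf => simp [code, cost, he, hf, Nat.add_assoc]
  | inp e he => simp [code, cost, he]
  | arr a e he => simp [code, cost, he, addressCode]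

theorem Cmd.length_code (c : Cmd) (o d : ℕ) : (c.code o d).length = c.size := by
  induction c generalizing o d with
  | skip => rfl
  | set x e => simp [code, size, Expr.length_code]
  | put a e f => simp [code, size, Expr.length_code, addressCode]; omega
  | seq c c' hc hc' => simp [code, size, hc, hc']
  | ite e c c' hc hc' => simp [code, size, Expr.length_code, hc, hc']; omega
  | rep e c hc => simp [code, size, Expr.length_code, hc]; omega

/-- The instructions `l` stand in the program `Q` from position `o` on. -/
def CodeAt (Q : Program) (o : ℕ) (l : List Instr) : Prop :=
  ∀ i < l.length, Q[o + i]? = l[i]?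

theorem CodeAt.left {Q : Program} {o : ℕ} {l l' : List Instr} (h : CodeAt Q o (l ++ l')) :
    CodeAt Q o l := fun i hi => by
  rw [h i (by rw [List.length_append]; omega), List.getElem?_append_left hi]

theorem CodeAt.right {Q : Program} {o : ℕ} {l l' : List Instr} (h : CodeAt Q o (l ++ l')) :
    CodeAt Q (o + l.length) l' := fun i hi => by
  rw [Nat.add_assoc, h _ (by rw [List.length_append]; omega),
    List.getElem?_append_right (by omega), Nat.add_sub_cancel_left]

theorem CodeAt.head {Q : Program} {o : ℕ} {a : Instr} {l : List Instr} (h : CodeAt Q o (a :: l)) :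
    Q[o]? = some a := by
  simpa using h 0 (by simp)

theorem CodeAt.tail {Q : Program} {o : ℕ} {a : Instr} {l : List Instr} (h : CodeAt Q o (a :: l)) :
    CodeAt Q (o + 1) l := CodeAt.right (l := [a]) h

theorem CodeAt.mid (l l' l'' : List Instr) : CodeAt (l ++ (l' ++ l'')) l.length l' :=
  fun i hi => by
    rw [List.getElem?_append_right (by omega), Nat.add_sub_cancel_left,
      List.getElem?_append_left hi]

/-- All words of the machine are less than `W`. -/
def State.Bounded (W : ℕ) (σ : State) : Prop := (∀ i, σ.reg i < W) ∧ ∀ i, σ.mem i < W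

/-- The program leads in `t` steps from `σ` to `σ'`, and all words are less than `W` meanwhile. -/
structure Leads (Q : Program) (W : ℕ) (σ : State) (t : ℕ) (σ' : State) : Prop where
  iterate : (step Q)^[t] σ = σ'
  bounded : ∀ j ≤ t, State.Bounded W ((step Q)^[j] σ)

theorem Leads.refl {Q : Program} {W : ℕ} {σ : State} (h : σ.Bounded W) : Leads Q W σ 0 σ :=
  ⟨rfl, fun j hj => by obtain rfl : j = 0 := by omega
                       exact h⟩

theorem Leads.trans {Q : Program} {W : ℕ} {σ σ' σ'' : State} {t t' : ℕ} (h : Leads Q W σ t σ')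
    (h' : Leads Q W σ' t' σ'') : Leads Q W σ (t + t') σ'' := by
  refine ⟨by rw [Nat.add_comm, Function.iterate_add_apply, h.iterate, h'.iterate], fun j hj => ?_⟩
  rcases le_total j t with hjt | hjt
  · exact h.bounded j hjt
  · obtain ⟨c, rfl⟩ := Nat.exists_eq_add_of_le hjt
    rw [Nat.add_comm, Function.iterate_add_apply, h.iterate]
    exact h'.bounded c (by omega)

theorem Leads.right {Q : Program} {W : ℕ} {σ σ' : State} {t : ℕ} (h : Leads Q W σ t σ') :
    σ'.Bounded W := h.iterate ▸ h.bounded t le_rfl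

theorem Leads.single {Q : Program} {W : ℕ} {σ σ' : State} {i : Instr} (hi : Q[σ.pc]? = some i)
    (hσ : i.exec σ = σ') (h : σ.Bounded W) (h' : σ'.Bounded W) : Leads Q W σ 1 σ' := by
  have hstep : step Q σ = σ' := by simp [step, hi, hσ]
  refine ⟨by simpa using hstep, fun j hj => ?_⟩
  interval_cases j
  · exact h
  · simpa [hstep] using h'

theorem State.Bounded.update_reg {W : ℕ} {σ : State} (h : σ.Bounded W) {r v : ℕ} (hv : v < W)
    (p : ℕ) : State.Bounded W ⟨p, Function.update σ.reg r v, σ.mem⟩ := by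
  refine ⟨fun i => ?_, h.2⟩
  by_cases hi : i = r
  · simpa [hi] using hv
  · simpa [hi] using h.1 i

theorem State.Bounded.update_mem {W : ℕ} {σ : State} (h : σ.Bounded W) {r v : ℕ} (hv : v < W)
    (p : ℕ) : State.Bounded W ⟨p, σ.reg, Function.update σ.mem r v⟩ := by
  refine ⟨h.1, fun i => ?_⟩
  by_cases hi : i = r
  · simpa [hi] using hv
  · simpa [hi] using h.2 i

/-- The machine state `σ` represents the store `s`. -/
structure Represents (I : Env) (W : ℕ) (s : Store) (σ : State) : Prop where
  var : ∀ v, σ.reg (4 * v) = s.var v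
  len : σ.reg 1 = I.len
  zero : σ.reg 5 = 0
  -- These registers are reserved for a program that is simulated afterwards and expects its
  -- registers to be `0`.
  rest : ∀ r, σ.reg (4 * r + 3) = 0
  inp : ∀ i < I.len, σ.mem i = I.inp i
  arr : ∀ (a : Fin 32) i, σ.mem (I.len + 32 * i + a) = s.arr a i
  var_lt : ∀ v, s.var v < I.bound
  arr_lt : ∀ a i, s.arr a i < I.bound
  bounded : σ.Bounded W

/-- Temporaries and loop counters are not part of the store and may change freely. -/
theorem Represents.of_eq {I : Env} {W : ℕ} {s : Store} {σ σ' : State} (h : Represents I W s σ)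
    (hmem : σ'.mem = σ.mem) (hreg : ∀ r, (r % 4 = 1 → r < 9) → r % 4 ≠ 2 → σ'.reg r = σ.reg r)
    (hb : σ'.Bounded W) : Represents I W s σ' where
  var v := by rw [hreg _ (by omega) (by omega), h.var]
  len := by rw [hreg _ (by omega) (by omega), h.len]
  zero := by rw [hreg _ (by omega) (by omega), h.zero]
  rest r := by rw [hreg _ (by omega) (by omega), h.rest]
  inp i hi := by rw [hmem, h.inp i hi]
  arr a i := by rw [hmem, h.arr a i]
  var_lt := h.var_lt
  arr_lt := h.arr_lt
  bounded := hb

theorem Represents.tick {I : Env} {W : ℕ} {s : Store} {σ : State} (h : Represents I W s σ)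
    (k : ℕ) : Represents I W (s.tick k) σ :=
  ⟨h.var, h.len, h.zero, h.rest, h.inp, h.arr, h.var_lt, h.arr_lt, h.bounded⟩

theorem Represents.eval_lt {I : Env} {W : ℕ} {s : Store} {σ : State} (h : Represents I W s σ)
    (e : Expr) (hs : e.Safe I s) : e.eval I s < I.bound := by
  induction e with
  | lit v => exact hs
  | var x => exact h.var_lt x
  | add e f he hf => exact hs.2.2
  | sub e f he hf => exact lt_of_le_of_lt (Nat.sub_le _ _) (he hs.1)
  | inp e he => exact I.inp_lt _
  | arr a e he => exact h.arr_lt _ _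

/-- Five doublings multiply the index by the number of arrays; the offset of the input and the
number of the array are added. -/
theorem leads_address {Q : Program} {W : ℕ} {σ : State} (hb : σ.Bounded W) {t a i : ℕ}
    (hQ : CodeAt Q σ.pc (addressCode a t)) (ha : a < W) (hi : σ.reg (4 * t + 9) = i)
    (hW : σ.reg 1 + 32 * i + a < W) :
    ∃ σ', Leads Q W σ 8 σ' ∧ σ'.pc = σ.pc + 8 ∧ σ'.reg (4 * t + 9) = σ.reg 1 + 32 * i + a ∧
      σ'.mem = σ.mem ∧ ∀ r, r ≠ 4 * t + 9 → r ≠ 4 * (t + 1) + 9 → σ'.reg r = σ.reg r := by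
  have dbl : ∀ {σ : State} {v : ℕ}, σ.Bounded W →
      Q[σ.pc]? = some (.add (4 * t + 9) (4 * t + 9) (4 * t + 9)) → σ.reg (4 * t + 9) = v →
      v + v < W → Leads Q W σ 1 ⟨σ.pc + 1, Function.update σ.reg (4 * t + 9) (v + v), σ.mem⟩ := by
    intro σ v hb h hv hlt
    exact Leads.single h (by simp [Instr.exec, hv]) hb (hb.update_reg hlt _)
  have q0 := hQ.head
  have q1 := hQ.tail.head
  have q2 := hQ.tail.tail.head
  have q3 := hQ.tail.tail.tail.head
  have q4 := hQ.tail.tail.tail.tail.head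
  have q5 := hQ.tail.tail.tail.tail.tail.head
  have q6 := hQ.tail.tail.tail.tail.tail.tail.head
  have q7 := hQ.tail.tail.tail.tail.tail.tail.tail.head
  have l0 := dbl hb q0 hi (by omega)
  have l1 := dbl l0.right q1 (Function.update_self _ _ _) (by omega)
  have l2 := dbl l1.right q2 (Function.update_self _ _ _) (by omega)
  have l3 := dbl l2.right q3 (Function.update_self _ _ _) (by omega)
  have l4 := dbl l3.right q4 (Function.update_self _ _ _) (by omega)
  have l5 := Leads.single (W := W) q5 rfl l4.right (l4.right.update_reg (by
    simp only [Function.update_self, Function.update_of_ne (show 1 ≠ 4 * t + 9 by omega)]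
    omega) _)
  have l6 := Leads.single (W := W) q6 rfl l5.right (l5.right.update_reg ha _)
  have l7 := Leads.single (W := W) q7 rfl l6.right (l6.right.update_reg (by
    simp only [Instr.exec, Function.update_self, Function.update_of_ne (show 1 ≠ 4 * t + 9 by omega),
      Function.update_of_ne (show 4 * t + 9 ≠ 4 * (t + 1) + 9 by omega)]
    omega) _)
  refine ⟨_, ((((((l0.trans l1).trans l2).trans l3).trans l4).trans l5).trans l6).trans l7,
    rfl, ?_, rfl, fun r h1 h2 => ?_⟩
  · simp only [Instr.exec, Function.update_self, Function.update_of_ne (show 1 ≠ 4 * t + 9 by omega),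
      Function.update_of_ne (show 4 * t + 9 ≠ 4 * (t + 1) + 9 by omega)]
    omega
  · simp only [Instr.exec, Function.update_of_ne h1, Function.update_of_ne h2]

/-- The hypothesis on `W` leaves room for every address, as indices are less than the bound. The
last clause is what the induction needs: only temporaries from `t` on are overwritten. -/
theorem leads_expr {Q : Program} {I : Env} {W : ℕ} (hW : I.len + 32 * I.bound + 32 ≤ W)
    (e : Expr) : ∀ (t : ℕ) (s : Store) (σ : State), CodeAt Q σ.pc (e.code t) →
      Represents I W s σ → e.Safe I s →
      ∃ σ', Leads Q W σ e.cost σ' ∧ σ'.pc = σ.pc + e.cost ∧ σ'.reg (4 * t + 9) = e.eval I s ∧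
        σ'.mem = σ.mem ∧ ∀ r, (r % 4 = 1 → r < 4 * t + 9) → σ'.reg r = σ.reg r := by
  induction e with
  | lit v =>
    intro t s σ hQ hr hs
    have hv : v < I.bound := hs
    refine ⟨_, Leads.single hQ.head rfl hr.bounded (hr.bounded.update_reg (by omega) _), rfl,
      by simp [Instr.exec, Expr.eval], rfl, fun r h => ?_⟩
    exact Function.update_of_ne (by omega) _ _
  | var x =>
    intro t s σ hQ hr hs
    have hx := hr.var_lt x
    have hval : σ.reg (4 * x) + σ.reg 5 = s.var x := by rw [hr.var, hr.zero]; rfl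
    refine ⟨_, Leads.single hQ.head rfl hr.bounded
      (hr.bounded.update_reg (by rw [hval]; omega) _), rfl,
      by simp [Instr.exec, Expr.eval, hval], rfl, fun r h => ?_⟩
    exact Function.update_of_ne (by omega) _ _
  | add e f he hf =>
    intro t s σ hQ hr hs
    obtain ⟨σ₁, l1, p1, v1, m1, r1⟩ := he t s σ hQ.left hr hs.1
    have hr1 := hr.of_eq m1 (fun r h _ => r1 r (by omega)) l1.right
    have hQ1 := hQ.right
    rw [Expr.length_code, ← p1] at hQ1
    obtain ⟨σ₂, l2, p2, v2, m2, r2⟩ := hf (t + 1) s σ₁ hQ1.left hr1 hs.2.1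
    have hQ2 := hQ1.right
    rw [Expr.length_code, ← p2] at hQ2
    have hval : σ₂.reg (4 * t + 9) + σ₂.reg (4 * (t + 1) + 9) = e.eval I s + f.eval I s := by
      rw [v2, r2 _ (by omega), v1]
    have hlt := hs.2.2
    refine ⟨_, (l1.trans l2).trans (Leads.single hQ2.head rfl l2.right
      (l2.right.update_reg (by rw [hval]; omega) _)), by simp [Instr.exec, Expr.cost, p2, p1, Nat.add_assoc],
      by simp [Instr.exec, Expr.eval, hval], by simp [Instr.exec, m1, m2], fun r h => ?_⟩
    simp only [Instr.exec]
    rw [Function.update_of_ne (by omega), r2 r (by omega), r1 r h]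
  | sub e f he hf =>
    intro t s σ hQ hr hs
    obtain ⟨σ₁, l1, p1, v1, m1, r1⟩ := he t s σ hQ.left hr hs.1
    have hr1 := hr.of_eq m1 (fun r h _ => r1 r (by omega)) l1.right
    have hQ1 := hQ.right
    rw [Expr.length_code, ← p1] at hQ1
    obtain ⟨σ₂, l2, p2, v2, m2, r2⟩ := hf (t + 1) s σ₁ hQ1.left hr1 hs.2
    have hQ2 := hQ1.right
    rw [Expr.length_code, ← p2] at hQ2
    have hval : σ₂.reg (4 * t + 9) - σ₂.reg (4 * (t + 1) + 9) = e.eval I s - f.eval I s := by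
      rw [v2, r2 _ (by omega), v1]
    have hlt := hr.eval_lt e hs.1
    refine ⟨_, (l1.trans l2).trans (Leads.single hQ2.head rfl l2.right
      (l2.right.update_reg (by rw [hval]; omega) _)), by simp [Instr.exec, Expr.cost, p2, p1, Nat.add_assoc],
      by simp [Instr.exec, Expr.eval, hval], by simp [Instr.exec, m1, m2], fun r h => ?_⟩
    simp only [Instr.exec]
    rw [Function.update_of_ne (by omega), r2 r (by omega), r1 r h]
  | inp e he =>
    intro t s σ hQ hr hs
    obtain ⟨σ₁, l1, p1, v1, m1, r1⟩ := he t s σ hQ.left hr hs.1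
    have hQ1 := hQ.right
    rw [Expr.length_code, ← p1] at hQ1
    have hval : σ₁.mem (σ₁.reg (4 * t + 9)) = I.inp (e.eval I s) := by
      rw [v1, m1, hr.inp _ hs.2]
    have hlt := I.inp_lt (e.eval I s)
    refine ⟨_, l1.trans (Leads.single hQ1.head rfl l1.right
      (l1.right.update_reg (by rw [hval]; omega) _)), by simp [Instr.exec, Expr.cost, p1, Nat.add_assoc],
      by simp [Instr.exec, Expr.eval, hval], by simp [Instr.exec, m1], fun r h => ?_⟩
    simp only [Instr.exec]
    rw [Function.update_of_ne (by omega), r1 r h]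
  | arr a e he =>
    intro t s σ hQ hr hs
    obtain ⟨σ₁, l1, p1, v1, m1, r1⟩ := he t s σ hQ.left hr hs
    have hQ1 := hQ.right
    rw [Expr.length_code, ← p1] at hQ1
    have hlt := hr.eval_lt e hs
    have ha := a.isLt
    have hlen : σ₁.reg 1 = I.len := by rw [r1 1 (by omega), hr.len]
    obtain ⟨σ₂, l2, p2, v2, m2, r2⟩ := leads_address l1.right hQ1.left (by omega) v1
      (by rw [hlen]; omega)
    have hQ2 := hQ1.right
    rw [show (addressCode a t).length = 8 from rfl, ← p2] at hQ2
    have hval : σ₂.mem (σ₂.reg (4 * t + 9)) = s.arr a (e.eval I s) := by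
      rw [v2, m2, m1, hlen, hr.arr]
    have hlt' := hr.arr_lt a (e.eval I s)
    refine ⟨_, (l1.trans l2).trans (Leads.single hQ2.head rfl l2.right
      (l2.right.update_reg (by rw [hval]; omega) _)),
      by simp [Instr.exec, Expr.cost, p2, p1, Nat.add_assoc],
      by simp [Instr.exec, Expr.eval, hval], by simp [Instr.exec, m1, m2], fun r h => ?_⟩
    simp only [Instr.exec]
    rw [Function.update_of_ne (by omega), r2 r (by omega) (by omega), r1 r h]


theorem Represents.setVar {I : Env} {W : ℕ} {s : Store} {σ : State} (h : Represents I W s σ)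
    {x v : ℕ} (hv : v < I.bound) (hW : v < W) (p : ℕ) :
    Represents I W (s.setVar x v) ⟨p, Function.update σ.reg (4 * x) v, σ.mem⟩ where
  var y := by
    by_cases hy : y = x
    · simp [hy, Store.setVar]
    · simp [Store.setVar, hy, h.var]
  len := by simp only [Function.update_of_ne (show 1 ≠ 4 * x by omega), h.len]
  zero := by simp only [Function.update_of_ne (show 5 ≠ 4 * x by omega), h.zero]
  rest r := by simp only [Function.update_of_ne (show 4 * r + 3 ≠ 4 * x by omega), h.rest]
  inp := h.inp
  arr := h.arr
  var_lt y := by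
    by_cases hy : y = x
    · simpa [hy, Store.setVar] using hv
    · simpa [Store.setVar, hy] using h.var_lt y
  arr_lt := h.arr_lt
  bounded := h.bounded.update_reg hW p

theorem Represents.setArr {I : Env} {W : ℕ} {s : Store} {σ : State} (h : Represents I W s σ)
    {a : Fin 32} {i v : ℕ} (hv : v < I.bound) (hW : v < W) (p : ℕ) :
    Represents I W (s.setArr a i v)
      ⟨p, σ.reg, Function.update σ.mem (I.len + 32 * i + a) v⟩ where
  var := h.var
  len := h.len
  zero := h.zero
  rest := h.rest
  inp j hj := by simp only [Function.update_of_ne (show j ≠ I.len + 32 * i + a by omega), h.inp j hj]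
  arr b j := by
    have ha := a.isLt
    have hb := b.isLt
    by_cases hab : b = a
    · subst hab
      by_cases hij : j = i
      · simp [hij, Store.setArr]
      · simp [Store.setArr, Function.update_of_ne hij, h.arr,
          Function.update_of_ne (show I.len + 32 * j + b.val ≠ I.len + 32 * i + b.val by omega)]
    · have hab' : b.val ≠ a.val := fun h => hab (Fin.ext h)
      simp [Store.setArr, Function.update_of_ne hab, h.arr,
        Function.update_of_ne (show I.len + 32 * j + b.val ≠ I.len + 32 * i + a.val by omega)]
  var_lt := h.var_lt
  arr_lt b j := by
    by_cases hab : b = a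
    · subst hab
      by_cases hij : j = i
      · simpa [hij, Store.setArr] using hv
      · simpa [Store.setArr, Function.update_of_ne hij] using h.arr_lt b j
    · simpa [Store.setArr, Function.update_of_ne hab] using h.arr_lt b j
  bounded := h.bounded.update_mem hW p

theorem Represents.update_rest {I : Env} {W : ℕ} {s : Store} {σ : State}
    (h : Represents I W s σ) {r v : ℕ} (hr : r % 4 = 1 → 9 ≤ r) (hr' : r % 4 = 1 ∨ r % 4 = 2)
    (hv : v < W) (p : ℕ) : Represents I W s ⟨p, Function.update σ.reg r v, σ.mem⟩ :=
  h.of_eq rfl (fun r' h1 h2 => Function.update_of_ne (by rintro rfl; omega) _ _)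
    (h.bounded.update_reg hv p)

theorem Represents.jump {I : Env} {W : ℕ} {s : Store} {σ : State} (h : Represents I W s σ)
    (p : ℕ) : Represents I W s ⟨p, σ.reg, σ.mem⟩ :=
  h.of_eq rfl (fun _ _ _ => rfl) h.bounded

/-- The machine code of a command does what the command says. -/
theorem leads_cmd {Q : Program} {I : Env} {W : ℕ} (hW : I.len + 32 * I.bound + 32 ≤ W)
    (c : Cmd) : ∀ (d : ℕ) (s : Store) (σ : State), CodeAt Q σ.pc (c.code σ.pc d) →
      Represents I W s σ → c.Safe I s →
      ∃ t σ', Leads Q W σ t σ' ∧ (c.exec I s).time = s.time + t ∧ σ'.pc = σ.pc + c.size ∧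
        Represents I W (c.exec I s) σ' ∧ ∀ d' < d, σ'.reg (4 * d' + 2) = σ.reg (4 * d' + 2) := by
  induction c with
  | skip =>
    intro d s σ hQ hr hs
    exact ⟨0, σ, Leads.refl hr.bounded, rfl, rfl, hr, fun _ _ => rfl⟩
  | set x e =>
    intro d s σ hQ hr hs
    obtain ⟨σ₁, l1, p1, v1, m1, r1⟩ := leads_expr hW e 0 s σ hQ.left hr hs
    have hr1 := hr.of_eq m1 (fun r h _ => r1 r (by omega)) l1.right
    have hQ1 := hQ.right
    rw [Expr.length_code, ← p1] at hQ1
    have hlt := hr.eval_lt e hs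
    have hval : σ₁.reg 9 + σ₁.reg 5 = e.eval I s := by rw [v1, hr1.zero]; rfl
    have hr2 := hr1.setVar (x := x) hlt (by omega) (σ₁.pc + 1)
    refine ⟨_, _, l1.trans (Leads.single hQ1.head (by rw [Instr.exec, hval]) l1.right hr2.bounded),
      rfl, by simp [Cmd.size, p1, Nat.add_assoc], hr2.tick _, fun d' _ => ?_⟩
    simp only
    rw [Function.update_of_ne (by omega), r1 _ (by omega)]
  | put a e f =>
    intro d s σ hQ hr hs
    obtain ⟨σ₁, l1, p1, v1, m1, r1⟩ := leads_expr hW e 0 s σ hQ.left hr hs.1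
    have hr1 := hr.of_eq m1 (fun r h _ => r1 r (by omega)) l1.right
    have hQ1 := hQ.right
    rw [Expr.length_code, ← p1] at hQ1
    have hlt := hr.eval_lt e hs.1
    have hlt' := hr.eval_lt f hs.2
    have ha := a.isLt
    obtain ⟨σ₂, l2, p2, v2, m2, r2⟩ := leads_address l1.right hQ1.left (by omega) v1
      (by rw [hr1.len]; omega)
    have hr2 := hr1.of_eq m2 (fun r h _ => r2 r (by omega) (by omega)) l2.right
    have hQ2 := hQ1.right
    rw [show (addressCode a 0).length = 8 from rfl, ← p2] at hQ2
    obtain ⟨σ₃, l3, p3, v3, m3, r3⟩ := leads_expr hW f 1 s σ₂ hQ2.left hr2 hs.2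
    have hr3 := hr2.of_eq m3 (fun r h _ => r3 r (by omega)) l3.right
    have hQ3 := hQ2.right
    rw [Expr.length_code, ← p3] at hQ3
    have hr4 := hr3.setArr (a := a) (i := e.eval I s) hlt' (by omega) (σ₃.pc + 1)
    refine ⟨_, _, ((l1.trans l2).trans l3).trans (Leads.single hQ3.head ?_ l3.right hr4.bounded),
      ?_, ?_, hr4.tick _, fun d' _ => ?_⟩
    · rw [Instr.exec, show σ₃.reg 13 = f.eval I s from v3, r3 9 (by omega),
        show σ₂.reg 9 = _ from v2, hr1.len]
    · simp only [Cmd.exec, Store.tick, Store.setArr]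
      omega
    · simp only [Cmd.size, p3, p2, p1]
      omega
    · simp only
      rw [r3 _ (by omega), r2 _ (by omega) (by omega), r1 _ (by omega)]
  | seq c c' hc hc' =>
    intro d s σ hQ hr hs
    obtain ⟨t1, σ₁, l1, h1, p1, hr1, r1⟩ := hc d s σ hQ.left hr hs.1
    have hQ1 := hQ.right
    rw [Cmd.length_code, ← p1] at hQ1
    obtain ⟨t2, σ₂, l2, h2, p2, hr2, r2⟩ := hc' d _ σ₁ hQ1 hr1 hs.2
    refine ⟨_, _, l1.trans l2, ?_, ?_, hr2, fun d' hd => ?_⟩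
    · simp only [Cmd.exec]
      omega
    · simp only [Cmd.size]
      omega
    · rw [r2 d' hd, r1 d' hd]
  | ite e c c' hc hc' =>
    intro d s σ hQ hr hs
    obtain ⟨σ₁, l1, p1, v1, m1, r1⟩ := leads_expr hW e 0 s σ hQ.left hr hs.1
    have hr1 := hr.of_eq m1 (fun r h _ => r1 r (by omega)) l1.right
    have hQ1 := hQ.right
    rw [Expr.length_code, ← p1] at hQ1
    have hQ2 := hQ1.tail.left
    have hQ3 := hQ1.tail.right
    rw [Cmd.length_code] at hQ3
    have hsafe := hs.2
    by_cases he : e.eval I s = 0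
    · rw [if_pos he] at hsafe
      have hr2 := (hr1.jump (σ₁.pc + 1 + c.size + 1)).tick (e.cost + 1)
      have l2 := Leads.single (W := W) hQ1.head
        (by rw [Instr.exec, if_pos (show σ₁.reg 9 = 0 from v1.trans he)]) l1.right hr2.bounded
      have hQ4 := hQ3.tail
      obtain ⟨t3, σ₃, l3, h3, p3, hr3, r3⟩ := hc' d _ _ hQ4 hr2 hsafe
      refine ⟨_, _, (l1.trans l2).trans l3, ?_, ?_, ?_, fun d' hd => ?_⟩
      · simp only [Cmd.exec, if_pos he, h3]
        simp only [Store.tick]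
        omega
      · simp only [Cmd.size, p3]
        omega
      · simpa only [Cmd.exec, if_pos he] using hr3
      · rw [r3 d' hd, r1 _ (by omega)]
    · rw [if_neg he] at hsafe
      have hr2 := (hr1.jump (σ₁.pc + 1)).tick (e.cost + 1)
      have l2 := Leads.single (W := W) hQ1.head
        (by rw [Instr.exec, if_neg (show σ₁.reg 9 ≠ 0 from fun h => he (v1.symm.trans h))])
        l1.right hr2.bounded
      obtain ⟨t3, σ₃, l3, h3, p3, hr3, r3⟩ := hc d _ ⟨σ₁.pc + 1, σ₁.reg, σ₁.mem⟩ hQ2 hr2 hsafe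
      have hr4 := (hr3.jump (σ₁.pc + 1 + c.size + 1 + c'.size)).tick 1
      have hQ4 := hQ3.head
      have l4 := Leads.single (W := W) (σ := σ₃) (by rw [p3]; exact hQ4)
        (by rw [Instr.exec, if_pos hr3.zero]) l3.right hr4.bounded
      refine ⟨_, _, ((l1.trans l2).trans l3).trans l4, ?_, ?_, ?_, fun d' hd => ?_⟩
      · simp only [Cmd.exec, if_neg he, Store.tick] at h3 ⊢
        omega
      · simp only [Cmd.size]
        omega
      · simpa only [Cmd.exec, if_neg he] using hr4
      · simp only
        rw [r3 d' hd, r1 _ (by omega)]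
  | rep e c hc =>
    intro d s σ hQ hr hs
    obtain ⟨σ₁, l1, p1, v1, m1, r1⟩ := leads_expr hW e 0 s σ hQ.left hr hs.1
    have hr1 := hr.of_eq m1 (fun r h _ => r1 r (by omega)) l1.right
    have hQ1 := hQ.right
    rw [Expr.length_code, ← p1] at hQ1
    have hlt := hr.eval_lt e hs.1
    have hval : σ₁.reg 9 + σ₁.reg 5 = e.eval I s := by rw [v1, hr1.zero]; rfl
    have hr2 := (hr1.update_rest (r := 4 * d + 2) (v := e.eval I s) (by omega) (by omega) (by omega)
      (σ₁.pc + 1)).tick (e.cost + 1)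
    have l2 := Leads.single (W := W) hQ1.head (by rw [Instr.exec, hval]) l1.right hr2.bounded
    have hQ2 := hQ1.tail
    have hQ3 := hQ2.tail.left
    have hQ4 := hQ2.tail.right
    rw [Cmd.length_code] at hQ4
    set F := fun s => (c.exec I s).tick 4 with hF
    -- Induction on the content `k` of the counter, from the moment when the test at the head of the
    -- loop is about to be executed. The body sits one loop deeper and therefore preserves this
    -- counter.
    have loop : ∀ k (s : Store) (σ' : State), σ'.pc = σ₁.pc + 1 → σ'.reg (4 * d + 2) = k →
        Represents I W s σ' → (∀ j < k, c.Safe I (F^[j] s)) →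
        ∃ t σ'', Leads Q W σ' t σ'' ∧ (F^[k] s).time + 1 = s.time + t ∧
          σ''.pc = σ₁.pc + c.size + 5 ∧ Represents I W (F^[k] s) σ'' ∧
          ∀ d' < d, σ''.reg (4 * d' + 2) = σ'.reg (4 * d' + 2) := by
      intro k
      induction k with
      | zero =>
        intro s σ' hpc hk hr' _
        have hr3 := hr'.jump (σ₁.pc + c.size + 5)
        exact ⟨1, _, Leads.single (by rw [hpc]; exact hQ2.head) (by rw [Instr.exec, if_pos hk])
          hr'.bounded hr3.bounded, rfl, rfl, hr3, fun _ _ => rfl⟩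
      | succ k ih =>
        intro s σ' hpc hk hr' hsafe
        have hr3 := hr'.jump (σ'.pc + 1)
        have l3 := Leads.single (W := W) (σ := σ') (by rw [hpc]; exact hQ2.head)
          (by rw [Instr.exec, if_neg (by omega)]) hr'.bounded hr3.bounded
        have hpc3 : σ'.pc + 1 = σ₁.pc + 2 := by omega
        obtain ⟨t4, σ₄, l4, h4, p4, hr4, r4⟩ := hc (d + 1) s ⟨σ'.pc + 1, σ'.reg, σ'.mem⟩
          (by rw [hpc3]; rw [show σ₁.pc + 1 + 1 = σ₁.pc + 2 by omega] at hQ3; exact hQ3)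
          hr3 (hsafe 0 (by omega))
        have hk4 : σ₄.reg (4 * d + 2) = k + 1 := by rw [r4 d (by omega)]; exact hk
        have hkW : k + 1 < W := hk ▸ hr'.bounded.1 _
        have hpc4 : σ₄.pc = σ₁.pc + 1 + 1 + c.size := by rw [p4, hpc]
        have hr5 := hr4.update_rest (r := 9) (v := 1) (by omega) (by omega) (by omega) (σ₄.pc + 1)
        have l5 := Leads.single (W := W) (i := .const 9 1) (by rw [hpc4]; exact hQ4.head) rfl
          l4.right hr5.bounded
        have hr6 := hr5.update_rest (r := 4 * d + 2) (v := k) (by omega) (by omega) (by omega)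
          (σ₄.pc + 1 + 1)
        have l6 := Leads.single (W := W) (σ := ⟨σ₄.pc + 1, Function.update σ₄.reg 9 1, σ₄.mem⟩)
          (by simp only [hpc4]; exact hQ4.tail.head)
          (by rw [Instr.exec]
              simp only [Function.update_self, Function.update_of_ne
                (show 4 * d + 2 ≠ 9 by omega), hk4, Nat.add_sub_cancel]) l5.right hr6.bounded
        have hr7 := (hr6.jump (σ₁.pc + 1)).tick 4
        have l7 := Leads.single (W := W) (σ := ⟨σ₄.pc + 1 + 1, _, σ₄.mem⟩)
          (by simp only [hpc4]; exact hQ4.tail.tail.head)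
          (by rw [Instr.exec, if_pos hr6.zero]) l6.right hr7.bounded
        obtain ⟨t8, σ₈, l8, h8, p8, hr8, r8⟩ := ih (F s) _ rfl
          (by simp only [Function.update_self]) hr7 (fun j hj => by
            have := hsafe (j + 1) (by omega)
            rwa [Function.iterate_succ_apply] at this)
        refine ⟨_, _, ((((l3.trans l4).trans l5).trans l6).trans l7).trans l8, ?_, p8, ?_,
          fun d' hd => ?_⟩
        · rw [Function.iterate_succ_apply, h8]
          simp only [hF, Store.tick, h4]
          omega
        · rw [Function.iterate_succ_apply]
          exact hr8
        · rw [r8 d' hd]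
          simp only
          rw [Function.update_of_ne (by omega), Function.update_of_ne (by omega), r4 d' (by omega)]
    obtain ⟨t3, σ₃, l3, h3, p3, hr3, r3⟩ := loop (e.eval I s) _ _ rfl
      (by simp only [Function.update_self]) hr2 hs.2
    refine ⟨_, _, (l1.trans l2).trans l3, ?_, ?_, hr3.tick 1, fun d' hd => ?_⟩
    · change (F^[e.eval I s] (s.tick (e.cost + 1))).time + 1 = _
      rw [h3]
      simp only [Store.tick]
      omega
    · rw [p3, Cmd.size]
      omega
    · rw [r3 d' hd]
      simp only
      rw [Function.update_of_ne (by omega), r1 _ (by omega)]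

/-- Put `2 + q * mem[1]`, which has to be at least the length of the input, into register `1`. -/
def prologue (q : ℕ) : List Instr :=
  .const 9 1 :: .load 9 9 :: .const 1 2 :: List.replicate q (.add 1 1 9)

/-- Cell `1` of the input is the number of edges or of clauses, so `q = 2` suffices for graphs and
`q = k + 1` for clauses of width `k`. The factor is fixed and the product is formed by `q`
additions. -/
def Cmd.compile (q : ℕ) (c : Cmd) : Program := prologue q ++ c.code (3 + q) 0

theorem Cmd.length_compile (q : ℕ) (c : Cmd) : (c.compile q).length = 3 + q + c.size := by
  simp [compile, prologue, Cmd.length_code]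
  omega

/-- The time starts at the number of steps of the prologue. -/
def initStore (q : ℕ) : Store := ⟨fun _ => 0, fun _ _ => 0, 3 + q⟩

/-- The rest `R` of the program is arbitrary, so that a second program can follow the compiled one.
-/
theorem leads_compile (q : ℕ) (c : Cmd) (R : Program) (x : List ℕ) (I : Env) {W : ℕ}
    (hinp : I.inp = fun i => x.getD i 0) (hlen : I.len = 2 + q * x.getD 1 0)
    (hx : x.length ≤ I.len) (hW : I.len + 32 * I.bound + 32 ≤ W) (hs : c.Safe I (initStore q)) :
    ∃ σ, Leads (c.compile q ++ R) W (initState x) (c.exec I (initStore q)).time σ ∧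
      σ.pc = (c.compile q).length ∧ Represents I W (c.exec I (initStore q)) σ := by
  have hbd : ∀ i, x.getD i 0 < I.bound := fun i => by simpa [hinp] using I.inp_lt i
  have hb0 := hbd 0
  set Q := c.compile q ++ R with hQdef
  have hQ : CodeAt Q 0 (prologue q ++ c.code (3 + q) 0) := by
    simpa [Cmd.compile, hQdef] using CodeAt.mid [] (c.compile q) R
  have hQ1 := hQ.left
  have hQ2 := hQ.right
  rw [show 0 + (prologue q).length = 3 + q by simp [prologue]; omega] at hQ2
  have hinit : (initState x).Bounded W :=
    ⟨fun i => by simp [initState]; omega,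
      fun i => lt_of_lt_of_le (hbd i) (by omega)⟩
  have l1 := Leads.single (W := W) (σ := initState x) hQ1.head rfl hinit
    (hinit.update_reg (by omega) _)
  have l2 := Leads.single (W := W) hQ1.tail.head rfl l1.right
    (l1.right.update_reg (lt_of_lt_of_le (hbd 1) (by omega)) _)
  have l3 := Leads.single (W := W) hQ1.tail.tail.head rfl l2.right
    (l2.right.update_reg (v := 2) (by omega) _)
  have hQ3 := hQ1.tail.tail.tail
  -- Here `k` counts the additions of the prologue that are still to come.
  have loop : ∀ k (σ : State), σ.pc = 3 + (q - k) → k ≤ q → σ.Bounded W →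
      σ.reg 9 = x.getD 1 0 → σ.reg 1 = 2 + (q - k) * x.getD 1 0 →
      ∃ σ', Leads Q W σ k σ' ∧ σ'.pc = 3 + q ∧ σ'.reg 1 = 2 + q * x.getD 1 0 ∧
        σ'.mem = σ.mem ∧ ∀ r, r ≠ 1 → σ'.reg r = σ.reg r := by
    intro k
    induction k with
    | zero =>
      intro σ h1 _ h3 h4 h5
      exact ⟨σ, Leads.refl h3, h1, h5, rfl, fun _ _ => rfl⟩
    | succ k ih =>
      intro σ h1 h2 h3 h4 h5
      have hval : σ.reg 1 + σ.reg 9 = 2 + (q - k) * x.getD 1 0 := by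
        rw [h4, h5, show q - k = q - (k + 1) + 1 by omega, Nat.add_mul]
        omega
      have hget : Q[σ.pc]? = some (.add 1 1 9) := by
        have := hQ3 (q - (k + 1)) (by simp; omega)
        rw [List.getElem?_replicate, if_pos (by omega)] at this
        rw [h1, ← this]
      have hle : (q - k) * x.getD 1 0 ≤ q * x.getD 1 0 := Nat.mul_le_mul_right _ (by omega)
      have l := Leads.single (W := W) hget (by rw [Instr.exec, hval]) h3
        (h3.update_reg (by omega) _)
      obtain ⟨σ', l', g1, g2, g3, g4⟩ := ih _ (by simp only; omega) (by omega) l.right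
        (by simpa using h4) (by simp)
      refine ⟨σ', by rw [Nat.add_comm k]; exact l.trans l', g1, g2, g3, fun r hr => ?_⟩
      rw [g4 r hr]
      exact Function.update_of_ne hr _ _
  obtain ⟨σ', l4, g1, g2, g3, g4⟩ := loop q _ (by simp [Instr.exec, initState]) le_rfl l3.right
    (by simp [Instr.exec, initState]) (by simp [Instr.exec])
  have hreg : ∀ r, r ≠ 1 → r ≠ 9 → σ'.reg r = 0 := by
    intro r h1 h9
    rw [g4 r h1]
    simp only [Instr.exec, Function.update_of_ne h1, Function.update_of_ne h9, initState]
  have hr : Represents I W (initStore q) σ' := by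
    refine ⟨fun v => ?_, by rw [g2, hlen], hreg _ (by omega) (by omega),
      fun r => hreg _ (by omega) (by omega), fun i _ => ?_, fun a i => ?_,
      fun v => ?_, fun a i => ?_, l4.right⟩
    · rw [hreg _ (by omega) (by omega)]
      rfl
    · rw [g3, hinp]
      rfl
    · rw [g3]
      exact List.getD_eq_default _ _ (by omega)
    · exact lt_of_le_of_lt (Nat.zero_le _) hb0
    · exact lt_of_le_of_lt (Nat.zero_le _) hb0
  obtain ⟨t, σ₅, l5, h5, p5, hr5, -⟩ := leads_cmd hW c 0 (initStore q) σ'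
    (by rw [g1]; exact hQ2) hr hs
  refine ⟨σ₅, ?_, by rw [p5, g1, Cmd.length_compile], hr5⟩
  have := (((l1.trans l2).trans l3).trans l4).trans l5
  rw [h5]
  exact this


/-! ### Reasoning about programs -/

/-- The command `c` can safely be executed in `s` and leads to a store that satisfies `Q`. -/
def Cmd.Wp (I : Env) (c : Cmd) (Q : Store → Prop) (s : Store) : Prop :=
  c.Safe I s ∧ Q (c.exec I s)

attribute [simp] Expr.eval Expr.Safe Expr.cost

@[simp] theorem Store.tick_var (s : Store) (k : ℕ) : (s.tick k).var = s.var := rfl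
@[simp] theorem Store.tick_arr (s : Store) (k : ℕ) : (s.tick k).arr = s.arr := rfl
@[simp] theorem Store.tick_time (s : Store) (k : ℕ) : (s.tick k).time = s.time + k := rfl
@[simp] theorem Store.setVar_var (s : Store) (x v y : ℕ) :
    (s.setVar x v).var y = if y = x then v else s.var y := Function.update_apply _ _ _ _
@[simp] theorem Store.setVar_arr (s : Store) (x v : ℕ) : (s.setVar x v).arr = s.arr := rfl
@[simp] theorem Store.setVar_time (s : Store) (x v : ℕ) : (s.setVar x v).time = s.time := rfl
@[simp] theorem Store.setArr_var (s : Store) (a : Fin 32) (i v : ℕ) :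
    (s.setArr a i v).var = s.var := rfl
@[simp] theorem Store.setArr_arr (s : Store) (a b : Fin 32) (i v : ℕ) :
    (s.setArr a i v).arr b = if b = a then Function.update (s.arr a) i v else s.arr b := by
  simp only [setArr, Function.update_apply]
@[simp] theorem Store.setArr_time (s : Store) (a : Fin 32) (i v : ℕ) :
    (s.setArr a i v).time = s.time := rfl

section Rules

variable {I : Env} {s : Store} {Q : Store → Prop}

@[simp] theorem Cmd.wp_skip : Cmd.skip.Wp I Q s ↔ Q s := by simp [Wp, Safe, exec]

@[simp] theorem Cmd.wp_set {x : ℕ} {e : Expr} : (Cmd.set x e).Wp I Q s ↔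
    e.Safe I s ∧ Q ((s.setVar x (e.eval I s)).tick (e.cost + 1)) := Iff.rfl

@[simp] theorem Cmd.wp_put {a : Fin 32} {e f : Expr} : (Cmd.put a e f).Wp I Q s ↔
    (e.Safe I s ∧ f.Safe I s) ∧
      Q ((s.setArr a (e.eval I s) (f.eval I s)).tick (e.cost + f.cost + 9)) := Iff.rfl

@[simp] theorem Cmd.wp_seq {c d : Cmd} : (Cmd.seq c d).Wp I Q s ↔ c.Wp I (d.Wp I Q) s := by
  simp [Wp, Safe, exec, and_assoc]

theorem Cmd.wp_ite {e : Expr} {c d : Cmd} : (Cmd.ite e c d).Wp I Q s ↔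
    e.Safe I s ∧ (e.eval I s = 0 → d.Wp I Q (s.tick (e.cost + 1))) ∧
      (e.eval I s ≠ 0 → c.Wp I (fun s => Q (s.tick 1)) (s.tick (e.cost + 1))) := by
  by_cases h : e.eval I s = 0 <;> simp [Wp, Safe, exec, h, and_assoc]

/-- The invariant rule. The number of rounds is known in advance because the bound is evaluated only
once. -/
theorem Cmd.wp_rep {e : Expr} {c : Cmd} (Inv : ℕ → Store → Prop) (n : ℕ) (hs : e.Safe I s)
    (hn : e.eval I s = n) (h0 : Inv 0 (s.tick (e.cost + 1)))
    (hstep : ∀ j < n, ∀ s, Inv j s → c.Wp I (fun s => Inv (j + 1) (s.tick 4)) s)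
    (hQ : ∀ s, Inv n s → Q (s.tick 1)) : (Cmd.rep e c).Wp I Q s := by
  have key : ∀ j ≤ n, Inv j ((fun s => (c.exec I s).tick 4)^[j] (s.tick (e.cost + 1))) := by
    intro j
    induction j with
    | zero => exact fun _ => h0
    | succ j ih =>
      intro hj
      rw [Function.iterate_succ_apply']
      exact (hstep j (by omega) _ (ih (by omega))).2
  refine ⟨⟨hs, fun j hj => ?_⟩, ?_⟩
  · exact (hstep j (by omega) _ (key j (by omega))).1
  · simp only [exec, hn]
    exact hQ _ (key n le_rfl)

theorem Cmd.Wp.mono {c : Cmd} {Q' : Store → Prop} (h : c.Wp I Q s) (hQ : ∀ s, Q s → Q' s) :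
    c.Wp I Q' s := ⟨h.1, hQ _ h.2⟩

end Rules

infixr:60 " ;; " => Cmd.seq

/-! ### Adjacency lists -/

/-- The nodes reached from `p` by following `next` carry the entries of the list; all of them are
less than `k`. -/
def Chain (nbr next : ℕ → ℕ) (k : ℕ) : ℕ → List ℕ → Prop
  | _, [] => True
  | p, y :: l => p < k ∧ nbr p = y ∧ Chain nbr next k (next p) l

/-- Node `k` is fresh, so no existing chain runs through it. -/
theorem Chain.update {nbr next : ℕ → ℕ} {k : ℕ} (v w : ℕ) :
    ∀ {l : List ℕ} {p : ℕ}, Chain nbr next k p l →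
      Chain (Function.update nbr k v) (Function.update next k w) (k + 1) p l
  | [], _, _ => trivial
  | _ :: _, p, h => by
    have hp : p ≠ k := h.1.ne
    refine ⟨by have := h.1; omega, by rw [Function.update_of_ne hp, h.2.1], ?_⟩
    rw [Function.update_of_ne hp]
    exact h.2.2.update v w

/-- Insert `v` into the list of `u`. -/
def insertHalf (L : ℕ → List ℕ) (u v : ℕ) : ℕ → List ℕ := Function.update L u (v :: L u)

/-- The linked lists represent the lists `L`, and `deg` contains their lengths. -/
def ListsAt (nbr next head deg : ℕ → ℕ) (k : ℕ) (L : ℕ → List ℕ) : Prop :=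
  ∀ x, Chain nbr next k (head x) (L x) ∧ deg x = (L x).length

theorem ListsAt.insert {nbr next head deg : ℕ → ℕ} {k : ℕ} {L : ℕ → List ℕ}
    (h : ListsAt nbr next head deg k L) (u v : ℕ) :
    ListsAt (Function.update nbr k v) (Function.update next k (head u)) (Function.update head u k)
      (Function.update deg u (deg u + 1)) (k + 1) (insertHalf L u v) := by
  intro x
  by_cases hx : x = u
  · subst hx
    simp only [insertHalf, Function.update_self, Chain]
    exact ⟨⟨by omega, trivial, (h x).1.update _ _⟩, by simp [(h x).2]⟩
  · simp only [insertHalf, Function.update_of_ne hx]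
    exact ⟨(h x).1.update _ _, (h x).2⟩

/-- The adjacency lists of a list of edges. -/
def adjLists (E : List (ℕ × ℕ)) : ℕ → List ℕ :=
  E.foldl (fun L e => insertHalf (insertHalf L e.1 e.2) e.2 e.1) fun _ => []

theorem adjLists_concat (E : List (ℕ × ℕ)) (e : ℕ × ℕ) :
    adjLists (E ++ [e]) = insertHalf (insertHalf (adjLists E) e.1 e.2) e.2 e.1 := by
  simp [adjLists]

theorem mem_insertHalf {L : ℕ → List ℕ} {u v x y : ℕ} :
    y ∈ insertHalf L u v x ↔ y ∈ L x ∨ (x = u ∧ y = v) := by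
  by_cases hx : x = u
  · subst hx
    simp [insertHalf, or_comm]
  · simp [insertHalf, hx]

theorem mem_adjLists (E : List (ℕ × ℕ)) (x y : ℕ) :
    y ∈ adjLists E x ↔ (x, y) ∈ E ∨ (y, x) ∈ E := by
  induction E using List.reverseRecOn with
  | nil => simp [adjLists]
  | append_singleton E e ih =>
    obtain ⟨a, b⟩ := e
    rw [adjLists_concat, mem_insertHalf, mem_insertHalf, ih]
    simp only [List.mem_append, List.mem_singleton, Prod.mk.injEq]
    tauto

theorem nodup_insertHalf {L : ℕ → List ℕ} {u v : ℕ} (h : ∀ x, (L x).Nodup) (hv : v ∉ L u)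
    (x : ℕ) : (insertHalf L u v x).Nodup := by
  by_cases hx : x = u
  · subst hx
    simp [insertHalf, hv, h]
  · simp [insertHalf, hx, h]

/-- LexBFS must not treat a neighbour twice; this is where edges being distinct as unordered pairs
matters. -/
theorem nodup_adjLists (E : List (ℕ × ℕ)) (hl : ∀ e ∈ E, e.1 ≠ e.2)
    (hE : (E.map fun e => s(e.1, e.2)).Nodup) (x : ℕ) : (adjLists E x).Nodup := by
  induction E using List.reverseRecOn generalizing x with
  | nil => simp [adjLists]
  | append_singleton E e ih =>
    obtain ⟨a, b⟩ := e
    rw [List.map_append, List.nodup_append] at hE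
    have hab : a ≠ b := hl (a, b) (by simp)
    have hnot : ∀ x y, s(x, y) = s(a, b) → y ∉ adjLists E x := by
      intro x y hxy hmem
      rw [mem_adjLists] at hmem
      rcases hmem with hmem | hmem
      · exact hE.2.2 _ (List.mem_map.2 ⟨_, hmem, rfl⟩) s(a, b) (by simp) hxy
      · exact hE.2.2 _ (List.mem_map.2 ⟨_, hmem, rfl⟩) s(a, b) (by simp) (Sym2.eq_swap.trans hxy)
    rw [adjLists_concat]
    refine nodup_insertHalf (nodup_insertHalf (ih (fun e he => hl e (by simp [he])) hE.1)
      (hnot a b rfl)) ?_ x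
    rw [mem_insertHalf]
    rintro (h | h)
    · exact hnot b a Sym2.eq_swap h
    · exact hab h.2

theorem length_insertHalf (L : ℕ → List ℕ) (u v x : ℕ) :
    (insertHalf L u v x).length = (L x).length + if x = u then 1 else 0 := by
  by_cases hx : x = u
  · subst hx
    simp [insertHalf]
  · simp [insertHalf, hx]

theorem length_adjLists_le (E : List (ℕ × ℕ)) (x : ℕ) :
    (adjLists E x).length ≤ 2 * E.length := by
  induction E using List.reverseRecOn with
  | nil => simp [adjLists]
  | append_singleton E e ih =>
    rw [adjLists_concat, length_insertHalf, length_insertHalf]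
    simp only [List.length_append, List.length_singleton]
    split_ifs <;> omega

/-- The degree sum is what makes scanning all adjacency lists a linear-time task. -/
theorem sum_length_adjLists_le (E : List (ℕ × ℕ)) (n : ℕ) :
    ∑ x ∈ Finset.range n, (adjLists E x).length ≤ 2 * E.length := by
  induction E using List.reverseRecOn with
  | nil => simp [adjLists]
  | append_singleton E e ih =>
    simp only [adjLists_concat, length_insertHalf, Finset.sum_add_distrib, List.length_append,
      List.length_singleton, Finset.sum_ite_eq']
    split_ifs <;> omega

/-- The number of vertices in variable `1`, the number of edges in variable `2`, and the edges in
the input. -/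
structure EdgeInput (I : Env) (n : ℕ) (E : List (ℕ × ℕ)) : Prop where
  order : I.inp 0 = n
  size : I.inp 1 = E.length
  fst : ∀ i (h : i < E.length), I.inp (2 + 2 * i) = E[i].1
  snd : ∀ i (h : i < E.length), I.inp (3 + 2 * i) = E[i].2
  lt : ∀ e ∈ E, e.1 < n ∧ e.2 < n
  ne : ∀ e ∈ E, e.1 ≠ e.2
  len : 2 + 2 * E.length ≤ I.len
  bound : 8 * (n + E.length) + 16 ≤ I.bound

/-- Build adjacency lists. Array `0` contains the first nodes of the lists, the arrays `1` and `2`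
the vertices and the successors of the nodes, and array `3` the degrees. -/
def buildLists : Cmd :=
  .set 1 (.inp (.lit 0)) ;; .set 2 (.inp (.lit 1)) ;; .set 3 (.lit 0) ;; .set 4 (.lit 2) ;;
  .rep (.var 2) (
    .set 5 (.inp (.var 4)) ;; .set 6 (.inp (.add (.var 4) (.lit 1))) ;;
    .put 1 (.var 3) (.var 6) ;; .put 2 (.var 3) (.arr 0 (.var 5)) ;;
    .put 0 (.var 5) (.var 3) ;; .put 3 (.var 5) (.add (.arr 3 (.var 5)) (.lit 1)) ;;
    .set 3 (.add (.var 3) (.lit 1)) ;;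
    .put 1 (.var 3) (.var 5) ;; .put 2 (.var 3) (.arr 0 (.var 6)) ;;
    .put 0 (.var 6) (.var 3) ;; .put 3 (.var 6) (.add (.arr 3 (.var 6)) (.lit 1)) ;;
    .set 3 (.add (.var 3) (.lit 1)) ;; .set 4 (.add (.var 4) (.lit 2)))

/-- The input sizes are in the variables `1` and `2`, and the adjacency lists have been built. -/
structure HasLists (n : ℕ) (E : List (ℕ × ℕ)) (s : Store) : Prop where
  order : s.var 1 = n
  size : s.var 2 = E.length
  lists : ListsAt (s.arr 1) (s.arr 2) (s.arr 0) (s.arr 3) (2 * E.length) (adjLists E)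

theorem buildLists_wp {I : Env} {n : ℕ} {E : List (ℕ × ℕ)} (h : EdgeInput I n E) (s : Store)
    (hs : ∀ a i, s.arr a i = 0) :
    buildLists.Wp I (fun s' => HasLists n E s' ∧ (∀ a : Fin 32, 4 ≤ a → ∀ i, s'.arr a i = 0) ∧
      s'.time ≤ s.time + 300 * (E.length + 1)) s := by
  have hB := h.bound
  have hL := h.len
  unfold buildLists
  simp only [Cmd.wp_seq, Cmd.wp_set]
  simp only [Expr.Safe, Expr.eval, Expr.cost, h.order, h.size]
  refine ⟨⟨by omega, by omega⟩, ⟨by omega, by omega⟩, by omega, by omega, ?_⟩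
  -- Each edge creates two nodes, one for either end, so `2 * j` nodes are in use after `j` edges,
  -- and the `j`-th edge starts at cell `2 + 2 * j` of the input.
  refine Cmd.wp_rep (fun j s' => s'.var 1 = n ∧ s'.var 2 = E.length ∧ s'.var 3 = 2 * j ∧
    s'.var 4 = 2 + 2 * j ∧ ListsAt (s'.arr 1) (s'.arr 2) (s'.arr 0) (s'.arr 3) (2 * j)
      (adjLists (E.take j)) ∧ (∀ a : Fin 32, 4 ≤ a → ∀ i, s'.arr a i = 0) ∧
    s'.time ≤ s.time + 200 + 300 * j) E.length trivial (by simp) ?_ ?_ ?_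
  · simp [hs, ListsAt, adjLists, Chain]
  · rintro j hj s' ⟨h1, h2, h3, h4, h5, h6, h7⟩
    have hf := h.fst j hj
    have hg := h.snd j hj
    have hlt := h.lt _ (List.getElem_mem hj)
    have hd := h5 E[j].1
    have hd' := h5 E[j].2
    have hlen := length_adjLists_le (E.take j) E[j].1
    have hlen' := length_adjLists_le (E.take j) E[j].2
    rw [List.length_take] at hlen hlen'
    have hne := h.ne _ (List.getElem_mem hj)
    have hgj : I.inp (2 + 2 * j + 1) = E[j].2 := by
      rw [← hg]
      congr 1
      omega
    have hcat : adjLists (E.take (j + 1)) = insertHalf (insertHalf (adjLists (E.take j))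
        E[j].1 E[j].2) E[j].2 E[j].1 := by
      rw [← adjLists_concat, List.take_concat_get']
    simp only [Cmd.wp_seq, Cmd.wp_set, Cmd.wp_put]
    simp [h3, h4, hf, hgj, hne.symm, hd.2, hd'.2]
    refine ⟨by omega, by omega, by omega, by omega, by omega, by omega, by omega, h1, h2, by omega,
      by omega, ?_, ?_, by omega⟩
    · have := (h5.insert E[j].1 E[j].2).insert E[j].2 E[j].1
      rw [hcat, show 2 * (j + 1) = 2 * j + 1 + 1 by omega]
      simpa [hne.symm, hd.2, hd'.2] using this
    · intro a ha i
      have hne' : ∀ b : Fin 32, b < 4 → a ≠ b := fun b hb hab => absurd (hab ▸ ha) (not_le.2 hb)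
      simp [hne' 0 (by decide), hne' 1 (by decide), hne' 2 (by decide), hne' 3 (by decide), h6 a ha]
  · rintro s' ⟨h1, h2, h3, h4, h5, h6, h7⟩
    rw [List.take_length] at h5
    exact ⟨⟨h1, h2, h5⟩, h6, by simp; omega⟩


/-! ### Partition refinement -/

section Partition

variable {A : ℕ → ℕ → Prop} {n i : ℕ} {ord ord' : ℕ → ℕ} {x y z : ℕ}

/-- Among the first `i` vertices, the first one that distinguishes `x` and `y` is adjacent
to `x`. -/
def LexGe (A : ℕ → ℕ → Prop) (ord : ℕ → ℕ) (i x y : ℕ) : Prop :=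
  ∀ c < i, A (ord c) y → ¬ A (ord c) x → ∃ d < c, A (ord d) x ∧ ¬ A (ord d) y

/-- None of the first `i` vertices distinguishes `x` and `y`. -/
def SameNear (A : ℕ → ℕ → Prop) (ord : ℕ → ℕ) (i x y : ℕ) : Prop :=
  ∀ c < i, A (ord c) x ↔ A (ord c) y

theorem LexGe.congr_ord (h : LexGe A ord i x y) (ho : ∀ c < i, ord' c = ord c) :
    LexGe A ord' i x y := by
  intro c hc h1 h2
  rw [ho c hc] at h1 h2
  obtain ⟨d, hd, h3⟩ := h c hc h1 h2
  exact ⟨d, hd, by rwa [ho d (by omega)]⟩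

theorem SameNear.congr_ord (h : SameNear A ord i x y) (ho : ∀ c < i, ord' c = ord c) :
    SameNear A ord' i x y := fun c hc => by
  rw [ho c hc]
  exact h c hc

theorem SameNear.symm (h : SameNear A ord i x y) : SameNear A ord i y x :=
  fun c hc => (h c hc).symm

theorem SameNear.trans (h : SameNear A ord i x y) (h' : SameNear A ord i y z) :
    SameNear A ord i x z := fun c hc => (h c hc).trans (h' c hc)

theorem SameNear.refl (A : ℕ → ℕ → Prop) (ord : ℕ → ℕ) (i x : ℕ) : SameNear A ord i x x :=
  fun _ _ => Iff.rfl

theorem LexGe.congr (h : LexGe A ord i x y) {x' y' : ℕ} (hx : SameNear A ord i x x')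
    (hy : SameNear A ord i y y') : LexGe A ord i x' y' := by
  intro c hc h1 h2
  obtain ⟨d, hd, h3, h4⟩ := h c hc ((hy c hc).2 h1) fun h => h2 ((hx c hc).1 h)
  exact ⟨d, hd, (hx d (by omega)).1 h3, fun h => h4 ((hy d (by omega)).2 h)⟩

/-- Antisymmetry: at the first vertex that distinguishes `x` and `y`, one of the two comparisons
would need an even earlier one. -/
theorem LexGe.sameNear (h : LexGe A ord i x y) (h' : LexGe A ord i y x) :
    SameNear A ord i x y := by
  intro c
  induction c using Nat.strong_induction_on with
  | _ c ih =>
    intro hc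
    constructor
    · intro h1
      by_contra h2
      obtain ⟨d, hd, h3, h4⟩ := h' c hc h1 h2
      exact h4 ((ih d hd (by omega)).2 h3)
    · intro h1
      by_contra h2
      obtain ⟨d, hd, h3, h4⟩ := h c hc h1 h2
      exact h4 ((ih d hd (by omega)).1 h3)

/-- The new vertex only matters for ties. If some earlier vertex distinguishes `x` and `y`, then the
comparison up to `i` yields one that favours `x`. -/
theorem LexGe.succ (h : LexGe A ord i x y)
    (h' : SameNear A ord i x y → A (ord i) y → A (ord i) x) : LexGe A ord (i + 1) x y := by
  intro c hc h1 h2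
  rcases Nat.lt_succ_iff_lt_or_eq.1 hc with hc | rfl
  · exact h c hc h1 h2
  · have hns : ¬ SameNear A ord c x y := fun hs => h2 (h' hs h1)
    unfold SameNear at hns
    push Not at hns
    obtain ⟨d, hd, ⟨h3, h4⟩ | ⟨h3, h4⟩⟩ := hns
    · exact ⟨d, hd, h3, h4⟩
    · obtain ⟨e, he, h5⟩ := h d hd h4 h3
      exact ⟨e, by omega, h5⟩

theorem sameNear_succ : SameNear A ord (i + 1) x y ↔
    SameNear A ord i x y ∧ (A (ord i) x ↔ A (ord i) y) := by
  constructor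
  · exact fun h => ⟨fun c hc => h c (by omega), h i (by omega)⟩
  · rintro ⟨h1, h2⟩ c hc
    rcases Nat.lt_succ_iff_lt_or_eq.1 hc with hc | rfl
    · exact h1 c hc
    · exact h2

/-- `ord` and `pos` are inverse permutations of `0, …, n - 1`. -/
structure IsOrder (n : ℕ) (ord pos : ℕ → ℕ) : Prop where
  ord_lt : ∀ p < n, ord p < n
  pos_lt : ∀ x < n, pos x < n
  pos_ord : ∀ p < n, pos (ord p) = p
  ord_pos : ∀ x < n, ord (pos x) = x

/-- The vertices at positions less than `i` have been visited; the other ones are sorted by their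
labels, and `cls` is constant exactly on the sets of vertices with equal labels, the first of which
stands at position `start`. -/
structure Partitioned (A : ℕ → ℕ → Prop) (n i : ℕ) (ord pos cls start mark : ℕ → ℕ) (K : ℕ) :
    Prop where
  order : IsOrder n ord pos
  done : ∀ b < i, ∀ y < n, b < pos y → LexGe A ord b (ord b) y
  sorted : ∀ x < n, ∀ y < n, i ≤ pos x → pos x < pos y → LexGe A ord i x y
  cls_iff : ∀ x < n, ∀ y < n, i ≤ pos x → i ≤ pos y → (cls x = cls y ↔ SameNear A ord i x y)
  cls_lt : ∀ x < n, cls x < K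
  start : ∀ x < n, i ≤ pos x →
    i ≤ start (cls x) ∧ start (cls x) ≤ pos x ∧ cls (ord (start (cls x))) = cls x
  mark_le : ∀ c, mark c ≤ i
  mark_eq : ∀ c, K ≤ c → mark c = 0

/-- The state while the neighbours of the vertex at position `i` are processed: those in `S` have
been moved to the front of their classes and form classes of their own. The array `mark` contains
`i + 1` for classes that have been split, and `newc` the new class. -/
structure Refining (A : ℕ → ℕ → Prop) (n i : ℕ) (S : ℕ → Prop)
    (ord pos cls start mark newc : ℕ → ℕ) (K : ℕ) : Prop where
  order : IsOrder n ord pos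
  done : ∀ b ≤ i, ∀ y < n, b < pos y → LexGe A ord b (ord b) y
  sorted : ∀ x < n, ∀ y < n, i < pos x → pos x < pos y →
    LexGe A ord i x y ∧ (SameNear A ord i x y → S y → S x)
  cls_iff : ∀ x < n, ∀ y < n, i < pos x → i < pos y →
    (cls x = cls y ↔ SameNear A ord i x y ∧ (S x ↔ S y))
  cls_lt : ∀ x < n, cls x < K
  start : ∀ x < n, i < pos x →
    i < start (cls x) ∧ start (cls x) ≤ pos x ∧ cls (ord (start (cls x))) = cls x
  mark_le : ∀ c, mark c ≤ i + 1
  mark_eq : ∀ c, K ≤ c → mark c = 0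
  split : ∀ x < n, i < pos x → ¬ S x →
    (mark (cls x) = i + 1 ↔ ∃ y < n, i < pos y ∧ S y ∧ SameNear A ord i x y) ∧
    ∀ y < n, i < pos y → S y → SameNear A ord i x y → newc (cls x) = cls y

variable {pos cls start mark newc : ℕ → ℕ} {K : ℕ} {S : ℕ → Prop}

/-- The pivot at position `i` has a largest label, as the unvisited vertices are sorted. It leaves
its class from the front, which is why the start of this class moves to `i + 1`. All marks are at
most `i`, so no class counts as split yet. -/
theorem Partitioned.refining (h : Partitioned A n i ord pos cls start mark K) (hi : i < n) :
    Refining A n i (fun _ => False) ord pos cls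
      (Function.update start (cls (ord i)) (i + 1)) mark newc K := by
  have hp := h.order.ord_lt i hi
  have hpi := h.order.pos_ord i hi
  refine ⟨h.order, fun b hb y hy hby => ?_, fun x hx y hy hix hxy => ?_,
    fun x hx y hy hix hiy => ?_, h.cls_lt, fun x hx hix => ?_, fun c => (h.mark_le c).trans (by omega),
    h.mark_eq, fun x hx hix _ => ⟨?_, by simp⟩⟩
  · rcases hb.lt_or_eq with hb | rfl
    · exact h.done b hb y hy hby
    · exact h.sorted _ hp y hy (by omega) (by omega)
  · exact ⟨h.sorted x hx y hy hix.le hxy, fun _ h => h⟩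
  · rw [h.cls_iff x hx y hy hix.le hiy.le]
    simp
  · obtain ⟨h1, h2, h3⟩ := h.start x hx hix.le
    by_cases hc : cls x = cls (ord i)
    · rw [hc, Function.update_self]
      refine ⟨by omega, hix, ?_⟩
      have hlt : i + 1 < n := by have := h.order.pos_lt x hx; omega
      have hv := h.order.ord_lt (i + 1) hlt
      have hvp := h.order.pos_ord (i + 1) hlt
      -- The vertex at position `i + 1` is sandwiched between the pivot and `x`, which have equal
      -- labels, and hence belongs to their class by antisymmetry.
      rcases Nat.lt_or_ge (i + 1) (pos x) with hlt' | hge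
      · have g1 := h.sorted _ hp _ hv (by omega) (by omega)
        have g2 := h.sorted _ hv x hx (by omega) (by omega)
        have g3 := (h.cls_iff x hx _ hp hix.le (by omega)).1 hc
        rw [h.cls_iff _ hv _ hp (by omega) (by omega)]
        exact (g1.sameNear (g2.congr (SameNear.refl _ _ _ _) g3)).symm
      · have : pos x = i + 1 := by omega
        rw [← this, h.order.ord_pos x hx, hc]
    · rw [Function.update_of_ne hc]
      refine ⟨lt_of_le_of_ne h1 fun he => ?_, h2, h3⟩
      rw [← he] at h3
      exact hc h3.symm
  · have := h.mark_le (cls x)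
    simp only [false_and, and_false, exists_false, iff_false]
    omega

theorem Refining.partitioned (h : Refining A n i S ord pos cls start mark newc K)
    (hS : ∀ x < n, S x ↔ A (ord i) x) :
    Partitioned A n (i + 1) ord pos cls start mark K where
  order := h.order
  done b hb y hy hby := h.done b (by omega) y hy hby
  sorted x hx y hy hix hxy := by
    have := h.sorted x hx y hy hix hxy
    rw [hS x hx, hS y hy] at this
    exact this.1.succ this.2
  cls_iff x hx y hy hix hiy := by
    rw [h.cls_iff x hx y hy hix hiy, sameNear_succ, hS x hx, hS y hy]
  cls_lt := h.cls_lt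
  start x hx hix := h.start x hx hix
  mark_le := h.mark_le
  mark_eq := h.mark_eq

/-- Only vertices after the pivot matter, so neighbours that have been visited can be added to `S`
without any work. -/
theorem Refining.congr_set (h : Refining A n i S ord pos cls start mark newc K) {S' : ℕ → Prop}
    (hS : ∀ x < n, i < pos x → (S' x ↔ S x)) :
    Refining A n i S' ord pos cls start mark newc K where
  order := h.order
  done := h.done
  sorted x hx y hy hix hxy := by
    rw [hS x hx hix, hS y hy (by omega)]
    exact h.sorted x hx y hy hix hxy
  cls_iff x hx y hy hix hiy := by
    rw [hS x hx hix, hS y hy hiy]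
    exact h.cls_iff x hx y hy hix hiy
  cls_lt := h.cls_lt
  start := h.start
  mark_le := h.mark_le
  mark_eq := h.mark_eq
  split x hx hix hxS := by
    rw [hS x hx hix] at hxS
    obtain ⟨h1, h2⟩ := h.split x hx hix hxS
    refine ⟨h1.trans ⟨?_, ?_⟩, fun y hy hiy hyS => h2 y hy hiy ((hS y hy hiy).1 hyS)⟩
    · rintro ⟨y, hy, hiy, hyS, hs⟩
      exact ⟨y, hy, hiy, (hS y hy hiy).2 hyS, hs⟩
    · rintro ⟨y, hy, hiy, hyS, hs⟩
      exact ⟨y, hy, hiy, (hS y hy hiy).1 hyS, hs⟩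

/-- The array entries after the class of `x` has been split, if necessary. -/
structure SplitAt (A : ℕ → ℕ → Prop) (n i : ℕ) (S : ℕ → Prop)
    (ord pos cls start mark newc : ℕ → ℕ) (K : ℕ)
    (start₁ mark₁ newc₁ : ℕ → ℕ) (K₁ x : ℕ) : Prop where
  le : K ≤ K₁
  lt : newc₁ (cls x) < K₁
  ne : newc₁ (cls x) ≠ cls x
  cls_iff : ∀ z < n, i < pos z → (cls z = newc₁ (cls x) ↔ SameNear A ord i x z ∧ S z)
  start_eq : ∀ c < K, start₁ c = start c
  mark_self : mark₁ (cls x) = i + 1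
  mark_ne : ∀ c, c ≠ cls x → mark₁ c = mark c
  newc_ne : ∀ c, c ≠ cls x → newc₁ c = newc c
  start_gt : i < start₁ (newc₁ (cls x))
  start_or : start₁ (newc₁ (cls x)) = start (cls x) ∨ (start₁ (newc₁ (cls x)) < start (cls x) ∧
    cls (ord (start₁ (newc₁ (cls x)))) = newc₁ (cls x))
  start_le : ∀ z < n, i < pos z → cls z = newc₁ (cls x) → start₁ (newc₁ (cls x)) ≤ pos z

/-- The mark says that the class has already been split for this pivot. Its moved part is the class
`newc (cls x)`, which stands in front of the rest because members of `S` precede nonmembers with the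
same label. -/
theorem Refining.splitAt_old (h : Refining A n i S ord pos cls start mark newc K) (hx : x < n)
    (hix : i < pos x) (hxS : ¬ S x) (hm : mark (cls x) = i + 1) :
    SplitAt A n i S ord pos cls start mark newc K start mark newc K x := by
  obtain ⟨h1, h2⟩ := h.split x hx hix hxS
  obtain ⟨y, hy, hiy, hyS, hs⟩ := h1.1 hm
  have hc := h2 y hy hiy hyS hs
  obtain ⟨g1, g2, g3⟩ := h.start y hy hiy
  obtain ⟨f1, f2, f3⟩ := h.start x hx hix
  have hne : newc (cls x) ≠ cls x := by
    rw [hc]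
    intro he
    exact hxS (((h.cls_iff y hy x hx hiy hix).1 he).2.1 hyS)
  refine ⟨le_rfl, hc ▸ h.cls_lt y hy, hne, fun z hz hiz => ⟨fun he => ?_, fun he => ?_⟩,
    fun _ _ => rfl, hm,
    fun _ _ => rfl, fun _ _ => rfl, hc ▸ g1, Or.inr ⟨?_, ?_⟩, fun z hz hiz he => ?_⟩
  · rw [hc] at he
    obtain ⟨e1, e2⟩ := (h.cls_iff z hz y hy hiz hiy).1 he
    exact ⟨hs.trans e1.symm, e2.2 hyS⟩
  · exact (h2 z hz hiz he.2 he.1).symm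
  · rw [hc]
    have hsx : start (cls x) < n := lt_of_le_of_lt f2 (h.order.pos_lt x hx)
    have hsy : start (cls y) < n := lt_of_le_of_lt g2 (h.order.pos_lt y hy)
    have hv := h.order.ord_lt _ hsx
    have hw := h.order.ord_lt _ hsy
    have hvp := h.order.pos_ord _ hsx
    have hwp := h.order.pos_ord _ hsy
    have e1 := (h.cls_iff _ hv x hx (by omega) hix).1 f3
    have e2 := (h.cls_iff _ hw y hy (by omega) hiy).1 g3
    by_contra hge
    rcases (not_lt.1 hge).lt_or_eq with hlt | heq
    · have := (h.sorted _ hv _ hw (by omega) (by omega)).2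
        (e1.1.trans (hs.trans e2.1.symm)) (e2.2.2 hyS)
      exact hxS (e1.2.1 this)
    · rw [← heq] at e2
      exact hxS (e1.2.1 (e2.2.2 hyS))
  · rw [hc]
    exact g3
  · rw [← he]
    exact (h.start z hz hiz).2.1

/-- The number `K` is fresh, so the new class is still empty. It will start where the old class
starts, since `x` is about to be moved there. -/
theorem Refining.splitAt_new (h : Refining A n i S ord pos cls start mark newc K) (hx : x < n)
    (hix : i < pos x) (hxS : ¬ S x) (hm : mark (cls x) ≠ i + 1) :
    SplitAt A n i S ord pos cls start mark newc K (Function.update start K (start (cls x)))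
      (Function.update mark (cls x) (i + 1)) (Function.update newc (cls x) K) (K + 1) x := by
  have hK := h.cls_lt x hx
  refine ⟨by omega, by simp, by simp; omega, fun z hz hiz => ⟨fun he => ?_, fun he => ?_⟩,
    fun c hc => ?_, by simp,
    fun c hc => Function.update_of_ne hc _ _, fun c hc => Function.update_of_ne hc _ _, ?_, ?_,
    fun z hz _ he => ?_⟩
  · have := h.cls_lt z hz
    simp at he
    omega
  · exact absurd ((h.split x hx hix hxS).1.2 ⟨z, hz, hiz, he.2, he.1⟩) hm
  · exact Function.update_of_ne (by omega) _ _
  · simpa using (h.start x hx hix).1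
  · simp
  · have := h.cls_lt z hz
    simp at he
    omega

theorem IsOrder.swap (h : IsOrder n ord pos) {p q : ℕ} (hp : p < n) (hq : q < n) :
    IsOrder n (Function.update (Function.update ord q (ord p)) p (ord q))
      (Function.update (Function.update pos (ord p) q) (ord q) p) := by
  have hinj : ∀ {a b}, a < n → b < n → ord a = ord b → a = b := by
    intro a b ha hb hab
    rw [← h.pos_ord a ha, ← h.pos_ord b hb, hab]
  refine ⟨fun r hr => ?_, fun x hx => ?_, fun r hr => ?_, fun x hx => ?_⟩
  · simp only [Function.update_apply]
    split_ifs
    exacts [h.ord_lt q hq, h.ord_lt p hp, h.ord_lt r hr]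
  · simp only [Function.update_apply]
    split_ifs
    exacts [hp, hq, h.pos_lt x hx]
  · by_cases h1 : r = p
    · simp [h1]
    · by_cases h2 : r = q
      · subst h2
        have : ord p ≠ ord r := fun he => h1 (hinj hp hr he).symm
        simp [h1, this]
      · have h3 : ord r ≠ ord q := fun he => h2 (hinj hr hq he)
        have h4 : ord r ≠ ord p := fun he => h1 (hinj hr hp he)
        simp [h1, h2, h3, h4, h.pos_ord r hr]
  · by_cases h1 : x = ord q
    · simp [h1]
    · by_cases h2 : x = ord p
      · subst h2
        have : q ≠ p := by rintro rfl; exact h1 rfl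
        simp [h1, this]
      · have h3 : pos x ≠ p := by rintro rfl; exact h2 (h.ord_pos x hx).symm
        have h4 : pos x ≠ q := by rintro rfl; exact h1 (h.ord_pos x hx).symm
        simp [h1, h2, h3, h4, h.ord_pos x hx]

/-- Moving `x` to the front of its class and into the new class. -/
theorem Refining.step (h : Refining A n i S ord pos cls start mark newc K) (hx : x < n)
    (hix : i < pos x) (hxS : ¬ S x) {start₁ mark₁ newc₁ : ℕ → ℕ} {K₁ : ℕ}
    (h₁ : SplitAt A n i S ord pos cls start mark newc K start₁ mark₁ newc₁ K₁ x) {q : ℕ}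
    (hq : q = start (cls x)) :
    Refining A n i (fun z => S z ∨ z = x)
      (Function.update (Function.update ord q x) (pos x) (ord q))
      (Function.update (Function.update pos x q) (ord q) (pos x))
      (Function.update cls x (newc₁ (cls x)))
      (Function.update start₁ (cls x) (q + 1)) mark₁ newc₁ K₁ := by
  obtain ⟨f1, f2, f3⟩ := h.start x hx hix
  rw [← hq] at f1 f2 f3
  have hpx := h.order.pos_lt x hx
  have hqn : q < n := by omega
  obtain ⟨y, hy⟩ : ∃ y, y = ord q := ⟨_, rfl⟩
  have hyn : y < n := hy ▸ h.order.ord_lt q hqn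
  have hyp : pos y = q := by rw [hy, h.order.pos_ord q hqn]
  rw [← hy] at f3 ⊢
  -- The vertex `y` at the front of the class has the same label as `x` and is not in `S` either.
  -- Hence exchanging them preserves all comparisons up to `i`.
  have hxy := (h.cls_iff y hyn x hx (by omega) hix).1 f3
  have hyS : ¬ S y := fun hs => hxS (hxy.2.1 hs)
  set ord' := Function.update (Function.update ord q x) (pos x) y with hord'
  set pos' := Function.update (Function.update pos x q) y (pos x) with hpos'
  set cls' := Function.update cls x (newc₁ (cls x)) with hcls'
  have horder : IsOrder n ord' pos' := by
    have := h.order.swap (p := pos x) (q := q) hpx hqn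
    rwa [h.order.ord_pos x hx, ← hy] at this
  have ho : ∀ c ≤ i, ord' c = ord c := by
    intro c hc
    rw [hord', Function.update_of_ne (by omega), Function.update_of_ne (by omega)]
  have hSN : ∀ a b, SameNear A ord' i a b ↔ SameNear A ord i a b := fun a b =>
    ⟨fun hs => hs.congr_ord fun c hc => (ho c hc.le).symm, fun hs => hs.congr_ord fun c hc => ho c hc.le⟩
  -- the position of `z` before the swap
  have hsw : ∀ z < n, i < pos' z ∨ i < pos z → ∃ z' < n, pos' z = pos z' ∧ i < pos z' ∧
      i < pos z ∧ SameNear A ord i z z' ∧ ((z = x ∧ z' = y) ∨ (z = y ∧ z' = x) ∨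
        (z ≠ x ∧ z ≠ y ∧ z' = z)) := by
    intro z hz hiz
    by_cases h1 : z = y
    · refine ⟨x, hx, ?_, hix, by rw [h1]; omega, h1 ▸ hxy.1, Or.inr (Or.inl ⟨h1, rfl⟩)⟩
      rw [hpos', h1, Function.update_self]
    · by_cases h2 : z = x
      · refine ⟨y, hyn, ?_, by omega, by rw [h2]; omega, h2 ▸ hxy.1.symm, Or.inl ⟨h2, rfl⟩⟩
        rw [hpos', Function.update_of_ne h1, h2, Function.update_self, hyp]
      · have h3 : pos' z = pos z := by
          rw [hpos', Function.update_of_ne h1, Function.update_of_ne h2]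
        exact ⟨z, hz, h3, by omega, by omega, SameNear.refl _ _ _ _, Or.inr (Or.inr ⟨h2, h1, rfl⟩)⟩
  have hpx' : pos' x = q := by
    by_cases h1 : x = y
    · rw [hpos', ← h1, Function.update_self, ← hyp, h1]
    · rw [hpos', Function.update_of_ne h1, Function.update_self]
  have hpy' : pos' y = pos x := by rw [hpos', Function.update_self]
  have hpz' : ∀ z, z ≠ x → z ≠ y → pos' z = pos z := fun z h1 h2 => by
    rw [hpos', Function.update_of_ne h2, Function.update_of_ne h1]
  have hiff : ∀ z < n, (i < pos' z ↔ i < pos z) := by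
    intro z hz
    constructor
    · intro h1
      obtain ⟨z', -, -, -, h2, -⟩ := hsw z hz (Or.inl h1)
      exact h2
    · intro h1
      obtain ⟨z', -, h2, h3, -⟩ := hsw z hz (Or.inr h1)
      omega
  have hcx : cls' x = newc₁ (cls x) := Function.update_self _ _ _
  have hcz : ∀ z, z ≠ x → cls' z = cls z := fun z hz => Function.update_of_ne hz _ _
  have hsorted : ∀ a < n, ∀ b < n, i < pos' a → pos' a < pos' b →
      LexGe A ord i a b ∧ (SameNear A ord i a b → (S b ∨ b = x) → (S a ∨ a = x)) := by
    intro a ha b hb hia hab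
    obtain ⟨a', ha', e1, e2, e3, e4, e5⟩ := hsw a ha (Or.inl hia)
    obtain ⟨b', hb', g1, g2, g3, g4, g5⟩ := hsw b hb (Or.inl (by omega))
    have hs := h.sorted a' ha' b' hb' e2 (by omega)
    refine ⟨hs.1.congr e4.symm g4.symm, fun hab' hbS => ?_⟩
    rcases hbS with hbS | rfl
    · have hbb : b' = b := by
        rcases g5 with ⟨rfl, -⟩ | ⟨rfl, -⟩ | ⟨-, -, g⟩
        exacts [absurd hbS hxS, absurd hbS hyS, g]
      subst hbb
      have haS := hs.2 (e4.symm.trans hab') hbS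
      rcases e5 with ⟨-, rfl⟩ | ⟨-, rfl⟩ | ⟨-, -, rfl⟩
      exacts [absurd haS hyS, absurd haS hxS, Or.inl haS]
    · rcases e5 with ⟨-, rfl⟩ | ⟨-, rfl⟩ | ⟨-, -, rfl⟩
      · omega
      · omega
      -- A vertex outside of `S` with the label of `x` belongs to the class of `x` and therefore
      -- stood at position `q` or later, whereas `a'` stands before `q`.
      · by_contra hcon
        have haS : ¬ S a' := fun hs => hcon (Or.inl hs)
        have := (h.cls_iff a' ha b hx e3 hix).2 ⟨hab', by simp [haS, hxS]⟩
        have g := (h.start a' ha e3).2.1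
        rw [this, ← hq] at g
        omega
  have hclsiff : ∀ a < n, ∀ b < n, i < pos a → i < pos b → (cls' a = cls' b ↔
      SameNear A ord i a b ∧ ((S a ∨ a = x) ↔ (S b ∨ b = x))) := by
    intro a ha b hb hia hib
    by_cases h1 : a = x <;> by_cases h2 : b = x
    · rw [h1, h2]
      exact iff_of_true rfl ⟨SameNear.refl _ _ _ _, Iff.rfl⟩
    · rw [h1, hcx, hcz b h2, eq_comm, h₁.cls_iff b hb hib]
      simp [h2]
    · rw [h2, hcx, hcz a h1, h₁.cls_iff a ha hia]
      simp only [h1, or_false, or_true, iff_true]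
      exact and_congr_left fun _ => ⟨SameNear.symm, SameNear.symm⟩
    · rw [hcz a h1, hcz b h2, h.cls_iff a ha b hb hia hib]
      simp [h1, h2]
  refine ⟨horder, fun b hb z hz hbz => ?_, fun a ha b hb hia hab => ?_,
    fun a ha b hb hia hib => ?_, fun z hz => ?_, fun z hz hiz => ?_, fun c => ?_, fun c hc => ?_,
    fun z hz hiz hzS => ?_⟩
  · have hbz' : b < pos z := by
      by_cases h1 : z = x
      · rw [h1]; omega
      · by_cases h2 : z = y
        · rw [h2]; omega
        · rwa [hpz' z h1 h2] at hbz
    rw [ho b hb]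
    exact (h.done b hb z hz hbz').congr_ord fun c hc => ho c (by omega)
  · rw [hSN]
    obtain ⟨h2, h3⟩ := hsorted a ha b hb hia hab
    exact ⟨h2.congr_ord fun c hc => ho c hc.le, h3⟩
  · rw [hSN]
    exact hclsiff a ha b hb ((hiff a ha).1 hia) ((hiff b hb).1 hib)
  · by_cases h1 : z = x
    · rw [h1, hcx]
      exact h₁.lt
    · rw [hcz z h1]
      exact (h.cls_lt z hz).trans_le h₁.le
  · have hiz' := (hiff z hz).1 hiz
    have hordq : ord' q = x := by
      rw [← hpx', horder.ord_pos x hx]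
    have hords : ∀ s, s ≠ q → s ≠ pos x → ord' s = ord s := fun s h1 h2 => by
      rw [hord', Function.update_of_ne h2, Function.update_of_ne h1]
    by_cases hc' : cls' z = newc₁ (cls x)
    · rw [hc', Function.update_of_ne h₁.ne]
      refine ⟨h₁.start_gt, ?_, ?_⟩
      · by_cases h1 : z = x
        · rw [h1, hpx']
          rcases h₁.start_or with h2 | h2 <;> omega
        · rw [hcz z h1] at hc'
          have h2 : z ≠ y := by
            rintro rfl
            exact h₁.ne (hc'.symm.trans f3)
          rw [hpz' z h1 h2]
          exact h₁.start_le z hz hiz' hc'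
      · rcases h₁.start_or with h2 | ⟨h2, h3⟩
        · rw [h2, ← hq, hordq, hcx]
        · rw [hords _ (by omega) (by omega), hcz, h3]
          intro h4
          rw [h4] at h3
          exact h₁.ne h3.symm
    · have h1 : z ≠ x := by
        rintro rfl
        exact hc' hcx
      rw [hcz z h1] at hc' ⊢
      by_cases hcc : cls z = cls x
      · rw [hcc, Function.update_self]
        have hle : q + 1 ≤ pos' z := by
          by_cases h2 : z = y
          · rw [h2, hpy']
            by_contra h3
            have h4 : pos x = pos y := by omega
            apply h1
            rw [h2, ← h.order.ord_pos x hx, h4, h.order.ord_pos y hyn]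
          · rw [hpz' z h1 h2]
            have h3 := (h.start z hz hiz').2.1
            rw [hcc, ← hq] at h3
            by_contra h4
            have h5 : pos z = q := by omega
            apply h2
            rw [hy, ← h5, h.order.ord_pos z hz]
        refine ⟨by omega, hle, ?_⟩
        rcases hle.eq_or_lt with heq | hlt
        · rw [heq, horder.ord_pos z hz, hcz z h1, hcc]
        -- The class has lost its front to `x`. The vertex at `q + 1` lies between `x` and `z` and
        -- so has their label; it is not in `S`, because otherwise `y`, which stood before it, would
        -- be in `S` too.
        · have hqn' : q + 1 < n := by have := horder.pos_lt z hz; omega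
          have hw := horder.ord_lt _ hqn'
          have hwp := horder.pos_ord _ hqn'
          set w := ord' (q + 1) with hwdef
          have hwx : w ≠ x := by
            intro h2
            rw [h2] at hwp
            omega
          obtain ⟨w', hw', e1, e2, e3, e4, e5⟩ := hsw w hw (Or.inl (by omega))
          have s1 := (hsorted x hx w hw (by omega) (by omega)).1
          have s2 := (hsorted w hw z hz (by omega) (by omega)).1
          have s3 := ((h.cls_iff z hz x hx hiz' hix).1 hcc).1
          have s4 := s1.sameNear (s2.congr (SameNear.refl _ _ _ _) s3)
          rw [hcz w hwx]
          rcases e5 with ⟨e5, -⟩ | ⟨e5, -⟩ | ⟨-, -, rfl⟩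
          · exact absurd e5 hwx
          · rw [e5, f3]
          · have hwS : ¬ S w := fun hs => hyS
              ((h.sorted y hyn w hw (by omega) (by omega)).2 (hxy.1.trans s4) hs)
            exact (h.cls_iff w hw x hx e3 hix).2 ⟨s4.symm, by simp [hwS, hxS]⟩
      · rw [Function.update_of_ne hcc, h₁.start_eq _ (h.cls_lt z hz)]
        obtain ⟨g1, g2, g3⟩ := h.start z hz hiz'
        have h2 : z ≠ y := by
          rintro rfl
          exact hcc f3
        rw [hpz' z h1 h2]
        refine ⟨g1, g2, ?_⟩
        have h3 : start (cls z) ≠ q := by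
          intro h3
          rw [h3, ← hy, f3] at g3
          exact hcc g3.symm
        have h4 : start (cls z) ≠ pos x := by
          intro h4
          rw [h4, h.order.ord_pos x hx] at g3
          exact hcc g3.symm
        rw [hords _ h3 h4, hcz, g3]
        intro h5
        rw [h5] at g3
        exact hcc g3.symm
  · by_cases h1 : c = cls x
    · rw [h1, h₁.mark_self]
    · rw [h₁.mark_ne c h1]
      exact h.mark_le c
  · have h1 := h.cls_lt x hx
    have h2 := h₁.le
    rw [h₁.mark_ne c (by omega)]
    exact h.mark_eq c (by omega)
  · push Not at hzS
    have hiz' := (hiff z hz).1 hiz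
    simp only [hSN]
    rw [hcz z hzS.2]
    by_cases hcc : cls z = cls x
    · have hzx := ((h.cls_iff z hz x hx hiz' hix).1 hcc).1
      rw [hcc]
      refine ⟨iff_of_true h₁.mark_self ⟨x, hx, by omega, Or.inr rfl, hzx⟩,
        fun w hw hiw hwS hzw => ?_⟩
      by_cases h1 : w = x
      · rw [h1, hcx]
      · rw [hcz w h1, ((h₁.cls_iff w hw ((hiff w hw).1 hiw)).2
          ⟨hzx.symm.trans hzw, hwS.resolve_right h1⟩)]
    · have hzx : ¬ SameNear A ord i z x := fun hs =>
        hcc ((h.cls_iff z hz x hx hiz' hix).2 ⟨hs, by simp [hzS.1, hxS]⟩)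
      obtain ⟨g1, g2⟩ := h.split z hz hiz' hzS.1
      rw [h₁.mark_ne _ hcc, h₁.newc_ne _ hcc, g1]
      refine ⟨⟨?_, ?_⟩, fun w hw hiw hwS hzw => ?_⟩
      · rintro ⟨w, hw, hiw, hwS, hzw⟩
        exact ⟨w, hw, (hiff w hw).2 hiw, Or.inl hwS, hzw⟩
      · rintro ⟨w, hw, hiw, hwS, hzw⟩
        refine ⟨w, hw, (hiff w hw).1 hiw, hwS.resolve_right ?_, hzw⟩
        rintro rfl
        exact hzx hzw
      · have h1 : w ≠ x := by
          rintro rfl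
          exact hzx hzw
        rw [hcz w h1]
        exact g2 w hw ((hiff w hw).1 hiw) (hwS.resolve_right h1) hzw

end Partition

/-! ### Lexicographic breadth-first search as a program -/

/-- Array `4` contains the visiting order, array `5` the positions, array `6` the classes, and
the arrays `7`, `8` and `9` what `Refining` calls `start`, `mark` and `newc`. The number of classes
is in variable `15`. -/
def Refines (A : ℕ → ℕ → Prop) (n i : ℕ) (S : ℕ → Prop) (s : Store) : Prop :=
  Refining A n i S (s.arr 4) (s.arr 5) (s.arr 6) (s.arr 7) (s.arr 8) (s.arr 9) (s.var 15)

/-- Only the variables from `9` on and the arrays `4`, …, `9` differ. -/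
structure SameData (s s' : Store) : Prop where
  var : ∀ v < 9, s'.var v = s.var v
  arr_lt : ∀ a : Fin 32, a < 4 → s'.arr a = s.arr a
  arr_ge : ∀ a : Fin 32, 10 ≤ a → s'.arr a = s.arr a

theorem SameData.trans {s s' s'' : Store} (h : SameData s s') (h' : SameData s' s'') :
    SameData s s'' :=
  ⟨fun v hv => (h'.var v hv).trans (h.var v hv), fun a ha => (h'.arr_lt a ha).trans (h.arr_lt a ha),
    fun a ha => (h'.arr_ge a ha).trans (h.arr_ge a ha)⟩

/-- Let `newc` of the class in variable `11` be a class that was made for the current vertex. -/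
def splitClass : Cmd :=
  .ite (.sub (.arr 8 (.var 11)) (.var 7)) .skip (
    .put 8 (.var 11) (.add (.var 7) (.lit 1)) ;; .put 9 (.var 11) (.var 15) ;;
    .put 7 (.var 15) (.var 12) ;; .set 15 (.add (.var 15) (.lit 1)))

/-- Marks never exceed `i + 1`, so the truncated difference of the mark and `i` is nonzero exactly
for classes already split for the current pivot. -/
theorem splitClass_wp {I : Env} {A : ℕ → ℕ → Prop} {n i x : ℕ} {S : ℕ → Prop} {s : Store}
    (h : Refines A n i S s) (hx : x < n) (hix : i < s.arr 5 x) (hxS : ¬ S x) (h7 : s.var 7 = i)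
    (h11 : s.var 11 = s.arr 6 x) (h12 : s.var 12 = s.arr 7 (s.arr 6 x)) (hn : n + 1 < I.bound)
    (hK : s.var 15 + 1 < I.bound) :
    splitClass.Wp I (fun s' => SplitAt A n i S (s.arr 4) (s.arr 5) (s.arr 6) (s.arr 7) (s.arr 8)
      (s.arr 9) (s.var 15) (s'.arr 7) (s'.arr 8) (s'.arr 9) (s'.var 15) x ∧
      (∀ v < 15, s'.var v = s.var v) ∧ (∀ a : Fin 32, a < 7 ∨ 10 ≤ a → s'.arr a = s.arr a) ∧
      s'.var 15 ≤ s.var 15 + 1 ∧ s'.time ≤ s.time + 100) s := by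
  have hin : i < n := hix.trans (h.order.pos_lt x hx)
  have hm := h.mark_le (s.arr 6 x)
  unfold splitClass
  rw [Cmd.wp_ite]
  simp only [Expr.Safe, Expr.eval, Expr.cost, h7, h11]
  refine ⟨⟨trivial, trivial⟩, fun h0 => ?_, fun h0 => ?_⟩
  · simp only [Cmd.wp_seq, Cmd.wp_set, Cmd.wp_put]
    simp [h7, h11, h12]
    refine ⟨by omega, by omega, ?_, fun v hv => ?_, fun a ha => ?_⟩
    · exact Refining.splitAt_new h hx hix hxS (by omega)
    · omega
    · have hne : ∀ b : Fin 32, 7 ≤ b → b < 10 → a ≠ b := by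
        rintro b hb hb' rfl
        rcases ha with ha | ha
        · exact absurd ha (not_lt.2 hb)
        · exact absurd ha (not_le.2 hb')
      simp [hne 7 (by decide) (by decide), hne 8 (by decide) (by decide),
        hne 9 (by decide) (by decide)]
  · rw [Cmd.wp_skip]
    refine ⟨Refining.splitAt_old h hx hix hxS (by omega), fun _ _ => rfl, fun _ _ => rfl,
      by simp, by simp⟩

/-- Process the neighbour in variable `10`, which has not been visited. -/
def moveVertex : Cmd :=
  .set 11 (.arr 6 (.var 10)) ;; .set 12 (.arr 7 (.var 11)) ;; splitClass ;;
  .set 13 (.arr 4 (.var 12)) ;; .set 14 (.arr 5 (.var 10)) ;;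
  .put 4 (.var 12) (.var 10) ;; .put 5 (.var 10) (.var 12) ;;
  .put 4 (.var 14) (.var 13) ;; .put 5 (.var 13) (.var 14) ;;
  .put 7 (.var 11) (.add (.var 12) (.lit 1)) ;; .put 6 (.var 10) (.arr 9 (.var 11))

theorem moveVertex_wp {I : Env} {A : ℕ → ℕ → Prop} {n i x : ℕ} {S : ℕ → Prop} {s : Store}
    (h : Refines A n i S s) (hx : x < n) (hix : i < s.arr 5 x) (hxS : ¬ S x) (h7 : s.var 7 = i)
    (h10 : s.var 10 = x) (hn : n + 1 < I.bound) (hK : s.var 15 + 1 < I.bound) :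
    moveVertex.Wp I (fun s' => Refines A n i (fun z => S z ∨ z = x) s' ∧
      SameData s s' ∧ s'.var 9 = s.var 9 ∧ (∀ c ≤ i, s'.arr 4 c = s.arr 4 c) ∧
      s'.var 15 ≤ s.var 15 + 1 ∧ s'.time ≤ s.time + 350) s := by
  obtain ⟨f1, f2, -⟩ := h.start x hx hix
  have hpx := h.order.pos_lt x hx
  unfold moveVertex
  simp only [Cmd.wp_seq, Cmd.wp_set]
  simp only [Expr.Safe, Expr.eval, true_and, Expr.cost]
  refine Cmd.Wp.mono (splitClass_wp (S := S) (x := x) h hx hix hxS (by simpa using h7) (by simp [h10])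
    (by simp [h10]) hn hK) ?_
  rintro s' ⟨g1, g2, g3, g4, g5⟩
  have e10 := g2 10 (by omega)
  have e11 := g2 11 (by omega)
  have e12 := g2 12 (by omega)
  have e9 := g2 9 (by omega)
  have a4 := g3 4 (by decide)
  have a5 := g3 5 (by decide)
  have a6 := g3 6 (by decide)
  simp [h10] at e9 e10 e11 e12 a4 a5 a6 g1 g4 g5
  simp [e10, e11, e12, e9, a4, a5]
  refine ⟨by omega, ?_, ⟨fun v hv => ?_, fun a ha => ?_, fun a ha => ?_⟩, fun c hc => ?_, g4, by omega⟩
  · have := Refining.step h hx hix hxS g1 rfl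
    simpa [Refines, a4, a5, a6] using this
  · have := g2 v (by omega)
    simp [show v ≠ 11 by omega, show v ≠ 12 by omega] at this
    simp [this, show v ≠ 13 by omega, show v ≠ 14 by omega]
  · have hne : ∀ b : Fin 32, 4 ≤ b → a ≠ b := fun b hb hab => absurd (hab ▸ ha) (not_lt.2 hb)
    simp [hne 4 (by decide), hne 5 (by decide), hne 6 (by decide), hne 7 (by decide)]
    exact g3 a (Or.inl (ha.trans (by decide)))
  · have hne : ∀ b : Fin 32, b < 10 → a ≠ b := fun b hb hab => absurd (hab ▸ ha) (not_le.2 hb)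
    simp [hne 4 (by decide), hne 5 (by decide), hne 6 (by decide), hne 7 (by decide)]
    exact g3 a (Or.inr ha)
  · rw [Function.update_of_ne (by omega), Function.update_of_ne (by omega)]

/-- Follow the adjacency list in variable `9` for one step. -/
def scanEdge : Cmd :=
  .set 10 (.arr 1 (.var 9)) ;; .set 9 (.arr 2 (.var 9)) ;;
  .ite (.sub (.arr 5 (.var 10)) (.var 7)) moveVertex .skip

/-- The truncated difference of the position of the neighbour and `i` is nonzero exactly if it comes
after the pivot; other neighbours need no action. -/
theorem scanEdge_wp {I : Env} {A : ℕ → ℕ → Prop} {n i x : ℕ} {S : ℕ → Prop} {s : Store}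
    (h : Refines A n i S s) (hx : x < n) (hxS : ¬ S x) (h7 : s.var 7 = i)
    (hsx : s.arr 1 (s.var 9) = x) (hn : n + 1 < I.bound) (hK : s.var 15 + 1 < I.bound) :
    scanEdge.Wp I (fun s' => Refines A n i (fun z => S z ∨ z = x) s' ∧
      SameData s s' ∧ s'.var 9 = s.arr 2 (s.var 9) ∧ (∀ c ≤ i, s'.arr 4 c = s.arr 4 c) ∧
      s'.var 15 ≤ s.var 15 + 1 ∧ s'.time ≤ s.time + 420) s := by
  unfold scanEdge
  simp only [Cmd.wp_seq, Cmd.wp_set, Cmd.wp_ite]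
  simp [hsx, h7]
  have hsame : ∀ s₁ : Store, (∀ v < 9, s₁.var v = s.var v) → s₁.arr = s.arr → SameData s s₁ :=
    fun s₁ h1 h2 => ⟨h1, fun a _ => by rw [h2], fun a _ => by rw [h2]⟩
  constructor
  · intro h0
    refine ⟨?_, hsame _ (fun v hv => by simp [show v ≠ 10 by omega, show v ≠ 9 by omega]) rfl⟩
    refine Refining.congr_set (S := S) h fun z _ hz => ?_
    simp only [or_iff_left_iff_imp]
    rintro rfl
    change i < s.arr 5 _ at hz
    omega
  · intro h0
    refine Cmd.Wp.mono (moveVertex_wp (S := S) (x := x) (i := i) (n := n) (A := A) h hx (by simp; omega)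
      hxS (by simp [h7]) (by simp) hn (by simpa using hK)) ?_
    rintro s' ⟨g1, g2, g3, g4, g5, g6⟩
    simp at g3 g4 g5 g6
    refine ⟨g1, (hsame _ ?_ ?_).trans (g2.trans ⟨fun _ _ => rfl, fun _ _ => rfl, fun _ _ => rfl⟩),
      g3, g4, g5, by omega⟩
    · exact fun v hv => by simp [show v ≠ 10 by omega, show v ≠ 9 by omega]
    · rfl

/-- Visit the vertex at the position in variable `7`. -/
def visit : Cmd :=
  .set 8 (.arr 4 (.var 7)) ;; .put 7 (.arr 6 (.var 8)) (.add (.var 7) (.lit 1)) ;;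
  .set 9 (.arr 0 (.var 8)) ;; .rep (.arr 3 (.var 8)) scanEdge ;; .set 7 (.add (.var 7) (.lit 1))

/-- The variable `7` is `i`, and the first `i` vertices have been visited. -/
structure VisitState (n : ℕ) (E : List (ℕ × ℕ)) (i : ℕ) (s : Store) : Prop where
  lists : HasLists n E s
  index : s.var 7 = i
  part : Partitioned (fun x y => y ∈ adjLists E x) n i (s.arr 4) (s.arr 5) (s.arr 6) (s.arr 7)
    (s.arr 8) (s.var 15)

/-- Each neighbour costs constant time and creates at most one class. The order up to position `i`
stays fixed, which keeps the sums over visited vertices meaningful. -/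
theorem visit_wp {I : Env} {n : ℕ} {E : List (ℕ × ℕ)} {i : ℕ} {s : Store}
    (h : VisitState n E i s) (hi : i < n) (hlt : ∀ x, ∀ y ∈ adjLists E x, y < n)
    (hnd : ∀ x, (adjLists E x).Nodup) (hn : n + 1 < I.bound)
    (hK : s.var 15 + (adjLists E (s.arr 4 i)).length + 1 < I.bound) :
    visit.Wp I (fun s' => VisitState n E (i + 1) s' ∧ (∀ c ≤ i, s'.arr 4 c = s.arr 4 c) ∧
      (∀ a : Fin 32, 10 ≤ a → s'.arr a = s.arr a) ∧
      s'.var 15 ≤ s.var 15 + (adjLists E (s.arr 4 i)).length ∧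
      s'.time ≤ s.time + 500 * (1 + (adjLists E (s.arr 4 i)).length)) s := by
  obtain ⟨p, hp⟩ : ∃ p, p = s.arr 4 i := ⟨_, rfl⟩
  rw [← hp] at hK ⊢
  set l := adjLists E p with hl
  have hch := (h.lists.lists p).1
  have hdeg := (h.lists.lists p).2
  rw [← hl] at hch hdeg
  have hr := h.part.refining (newc := s.arr 9) hi
  have h7 := h.index
  unfold visit
  simp only [Cmd.wp_seq, Cmd.wp_set, Cmd.wp_put]
  simp [h7, ← hp]
  refine ⟨⟨by omega, by omega⟩, ?_⟩
  refine Cmd.wp_rep (fun j s' => Refines (fun x y => y ∈ adjLists E x) n i (fun z => z ∈ l.take j) s' ∧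
    (∀ v < 8, s'.var v = s.var v) ∧ (∀ a : Fin 32, a < 4 ∨ 10 ≤ a → s'.arr a = s.arr a) ∧
    Chain (s.arr 1) (s.arr 2) (2 * E.length) (s'.var 9) (l.drop j) ∧
    (∀ c ≤ i, s'.arr 4 c = s.arr 4 c) ∧ s'.var 15 ≤ s.var 15 + j ∧
    s'.time ≤ s.time + 200 + 500 * j) l.length (by simp) (by simp [hdeg]) ?_ ?_ ?_
  · refine ⟨?_, fun v hv => ?_, fun a ha => ?_, ?_⟩
    · simpa [Refines, hp] using hr
    · simp [show v ≠ 8 by omega, show v ≠ 9 by omega]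
    · have : a ≠ 7 := by
        rintro rfl
        exact absurd ha (by decide)
      simp [this]
    · simp [hch]
  · rintro j hj s' ⟨g1, g2, g3, g4, g5, g6, g7⟩
    rw [List.drop_eq_getElem_cons hj] at g4
    obtain ⟨-, g8, g9⟩ := g4
    have hmem : l[j] ∈ l := List.getElem_mem hj
    have a1 := g3 1 (by decide)
    have a2 := g3 2 (by decide)
    refine Cmd.Wp.mono (scanEdge_wp g1 (hlt p _ hmem) ?_ (by rw [g2 7 (by omega), h7])
      (by rw [a1, g8]) hn (by omega)) ?_
    -- The list has no repetition, so its entry number `j` is not among the first `j`.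
    · intro hin
      obtain ⟨k, hk, hkj⟩ := List.mem_take_iff_getElem.1 hin
      have := (hnd p).getElem_inj_iff.1 hkj
      omega
    · rintro s'' ⟨f1, f2, f3, f4, f5, f6⟩
      refine ⟨?_, fun v hv => ?_, fun a ha => ?_, ?_, fun c hc => ?_, ?_, ?_⟩
      · have : (fun z => z ∈ l.take j ∨ z = l[j]) = fun z => z ∈ l.take (j + 1) := by
          ext z
          rw [List.take_add_one, List.getElem?_eq_getElem hj, List.mem_append]
          simp
        rw [this] at f1
        exact f1
      · rw [← g2 v hv]
        exact f2.var v (by omega)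
      · rw [← g3 a ha]
        rcases ha with ha | ha
        exacts [f2.arr_lt a ha, f2.arr_ge a ha]
      · simp only [Store.tick_var]
        rw [f3, a2]
        exact g9
      · rw [← g5 c hc]
        exact f4 c hc
      · simp only [Store.tick_var]
        omega
      · simp only [Store.tick_time]
        omega
  · rintro s' ⟨g1, g2, g3, g4, g5, g6, g7⟩
    rw [List.take_length] at g1
    have e7 := g2 7 (by omega)
    simp [e7, h7]
    refine ⟨⟨by omega, by omega⟩, ⟨⟨?_, ?_, ?_⟩, ?_, ?_⟩, g5, fun a ha => g3 a (Or.inr ha), g6, by omega⟩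
    · simp [g2 1, h.lists.order]
    · simp [g2 2, h.lists.size]
    · simp only [Store.tick_arr, Store.setVar_arr]
      rw [g3 0 (by decide), g3 1 (by decide), g3 2 (by decide), g3 3 (by decide)]
      exact h.lists.lists
    · simp
    · have := Refining.partitioned g1 fun z _ => by rw [g5 i le_rfl, ← hp]
      simpa using this

/-- The degrees are summed in the order of visits; this turns the total into the degree sum. -/
theorem IsOrder.sum_comp {n : ℕ} {ord pos : ℕ → ℕ} (h : IsOrder n ord pos) (f : ℕ → ℕ) :
    ∑ c ∈ Finset.range n, f (ord c) = ∑ x ∈ Finset.range n, f x :=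
  Finset.sum_nbij' ord pos (by simpa using h.ord_lt) (by simpa using h.pos_lt)
    (by simpa using h.pos_ord) (by simpa using h.ord_pos) fun _ _ => rfl

/-- Compute a visiting order of LexBFS in array `4`. -/
def lexBFS : Cmd :=
  .set 7 (.lit 0) ;;
  .rep (.var 1) (.put 4 (.var 7) (.var 7) ;; .put 5 (.var 7) (.var 7) ;;
    .set 7 (.add (.var 7) (.lit 1))) ;;
  .set 7 (.lit 0) ;; .set 15 (.lit 1) ;; .rep (.var 1) visit

theorem lexBFS_wp {I : Env} {n : ℕ} {E : List (ℕ × ℕ)} {s : Store} (h : HasLists n E s)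
    (hlt : ∀ x, ∀ y ∈ adjLists E x, y < n) (hnd : ∀ x, (adjLists E x).Nodup)
    (hB : n + 2 * E.length + 4 < I.bound) (hs : ∀ a : Fin 32, 4 ≤ a → ∀ i, s.arr a i = 0) :
    lexBFS.Wp I (fun s' => VisitState n E n s' ∧ (∀ a : Fin 32, 10 ≤ a → ∀ i, s'.arr a i = 0) ∧
      s'.time ≤ s.time + 1000 * (n + 2 * E.length + 1)) s := by
  unfold lexBFS
  simp only [Cmd.wp_seq, Cmd.wp_set]
  refine ⟨by simp; omega, ?_⟩
  refine Cmd.wp_rep (fun j s' => s'.var 7 = j ∧ s'.var 1 = n ∧ s'.var 2 = E.length ∧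
    (∀ c < j, s'.arr 4 c = c ∧ s'.arr 5 c = c) ∧ (∀ a : Fin 32, a < 4 → s'.arr a = s.arr a) ∧
    (∀ a : Fin 32, 6 ≤ a → ∀ i, s'.arr a i = 0) ∧ s'.time ≤ s.time + 10 + 100 * j) n (by simp)
    (by simp [h.order]) ?_ ?_ ?_
  · simp [h.order, h.size]
    exact fun a ha => hs a (le_trans (by decide) ha)
  · rintro j hj s' ⟨h1, h2, h3, h4, h5, h6, h7⟩
    simp only [Cmd.wp_seq, Cmd.wp_set, Cmd.wp_put]
    simp [h1, h2, h3]
    refine ⟨by omega, fun c hc => ?_, fun a ha => ?_, fun a ha => ?_, by omega⟩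
    · rcases hc.lt_or_eq with hc | rfl
      · simp [Function.update_of_ne hc.ne, h4 c hc]
      · simp
    · have hne : ∀ b : Fin 32, 4 ≤ b → a ≠ b := fun b hb hab => absurd (hab ▸ ha) (not_lt.2 hb)
      simp [hne 4 (by decide), hne 5 (by decide), h5 a ha]
    · have hne : ∀ b : Fin 32, b < 6 → a ≠ b := fun b hb hab => absurd (hab ▸ ha) (not_le.2 hb)
      simp [hne 4 (by decide), hne 5 (by decide)]
      exact h6 a ha
  · rintro s₁ ⟨h1, h2, h3, h4, h5, h6, h7⟩
    simp only [Cmd.wp_seq, Cmd.wp_set, Expr.Safe]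
    refine ⟨by omega, by omega, ?_⟩
    -- Time and number of classes are charged to the degrees of the vertices visited so far.
    refine Cmd.wp_rep (fun j s' => VisitState n E j s' ∧
      (∀ a : Fin 32, 10 ≤ a → ∀ i, s'.arr a i = 0) ∧
      s'.var 15 ≤ 1 + ∑ c ∈ Finset.range j, (adjLists E (s'.arr 4 c)).length ∧
      s'.time ≤ s.time + 100 + 600 * j + 100 * n +
        500 * ∑ c ∈ Finset.range j, (adjLists E (s'.arr 4 c)).length) n (by simp)
      (by simp [h2]) ?_ ?_ ?_
    · refine ⟨⟨⟨by simp [h2], by simp [h3], ?_⟩, by simp, ?_⟩, fun a ha => ?_, by simp, by simp; omega⟩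
      · simp
        rw [h5 0 (by decide), h5 1 (by decide), h5 2 (by decide), h5 3 (by decide)]
        exact h.lists
      · simp
        have h60 : s₁.arr 6 = fun _ => 0 := funext (h6 6 (by decide))
        have h70 : s₁.arr 7 = fun _ => 0 := funext (h6 7 (by decide))
        have h80 : s₁.arr 8 = fun _ => 0 := funext (h6 8 (by decide))
        rw [h60, h70, h80]
        refine ⟨⟨fun p hp => ?_, fun p hp => ?_, fun p hp => ?_, fun p hp => ?_⟩, by simp,
          fun _ _ _ _ _ _ c hc => absurd hc (by omega), fun _ _ _ _ _ _ => ?_, by simp, by simp,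
          by simp, by simp⟩
        · rwa [(h4 p hp).1]
        · rwa [(h4 p hp).2]
        · rw [(h4 p hp).1, (h4 p hp).2]
        · rw [(h4 p hp).2, (h4 p hp).1]
        · exact iff_of_true rfl fun c hc => absurd hc (by omega)
      · simp
        exact h6 a (le_trans (by decide) ha)
    · rintro j hj s' ⟨g1, g2, g3, g4⟩
      have hsum := sum_length_adjLists_le E n
      rw [← g1.part.order.sum_comp] at hsum
      have hle : ∑ c ∈ Finset.range (j + 1), (adjLists E (s'.arr 4 c)).length ≤ 2 * E.length :=
        (Finset.sum_le_sum_of_subset (Finset.range_mono (by omega))).trans hsum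
      rw [Finset.sum_range_succ] at hle
      refine Cmd.Wp.mono (visit_wp g1 hj hlt hnd (by omega) (by omega)) ?_
      rintro s'' ⟨f1, f2, f3, f4, f5⟩
      have heq : ∑ c ∈ Finset.range (j + 1), (adjLists E ((s''.tick 4).arr 4 c)).length =
          ∑ c ∈ Finset.range j, (adjLists E (s'.arr 4 c)).length +
            (adjLists E (s'.arr 4 j)).length := by
        rw [Finset.sum_range_succ, Store.tick_arr, f2 j le_rfl]
        congr 1
        refine Finset.sum_congr rfl fun c hc => ?_
        rw [f2 c (Finset.mem_range.1 hc).le]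
      refine ⟨⟨⟨f1.lists.order, f1.lists.size, f1.lists.lists⟩, f1.index, f1.part⟩,
        fun a ha i => ?_, ?_, ?_⟩
      · rw [Store.tick_arr, f3 a ha, g2 a ha]
      · rw [heq, Store.tick_var]
        omega
      · rw [heq, Store.tick_time]
        omega
    · rintro s' ⟨g1, g2, g3, g4⟩
      have hsum := sum_length_adjLists_le E n
      rw [← g1.part.order.sum_comp] at hsum
      refine ⟨⟨⟨g1.lists.order, g1.lists.size, g1.lists.lists⟩, g1.index, g1.part⟩, g2, ?_⟩
      rw [Store.tick_time]
      omega


/-! ### Vertices at distance at most three -/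

/-- The vertex `b` can be reached from `u` in at most `r` steps. -/
def Near (E : List (ℕ × ℕ)) (u : ℕ) : ℕ → ℕ → Prop
  | 0, b => b = u
  | r + 1, b => Near E u r b ∨ ∃ a, Near E u r a ∧ b ∈ adjLists E a

/-- Positive labels `4 - r` are only given to vertices that can be reached in `r` steps. -/
def Labels (E : List (ℕ × ℕ)) (u : ℕ) (lab : ℕ → ℕ) : Prop :=
  ∀ b, 0 < lab b → lab b ≤ 4 ∧ Near E u (4 - lab b) b

/-- Raise the label of `y` to the label of `x` minus one. -/
def relax (lab : ℕ → ℕ) (x y : ℕ) : ℕ → ℕ :=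
  Function.update lab y (lab y + (lab x - 1 - lab y))

theorem le_relax (lab : ℕ → ℕ) (x y b : ℕ) : lab b ≤ relax lab x y b := by
  by_cases h : b = y
  · simp [relax, h]
  · simp [relax, h]

theorem sub_one_le_relax (lab : ℕ → ℕ) (x y : ℕ) : lab x - 1 ≤ relax lab x y y := by
  simp [relax]
  omega

theorem Labels.relax {E : List (ℕ × ℕ)} {u : ℕ} {lab : ℕ → ℕ} (h : Labels E u lab) {x y : ℕ}
    (hy : y ∈ adjLists E x) : Labels E u (relax lab x y) := by
  intro b
  by_cases hb : b = y
  · subst hb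
    simp only [Dicho.relax, Function.update_self]
    intro h0
    rcases Nat.lt_or_ge (lab b) (lab x - 1) with hlt | hge
    · obtain ⟨h1, h2⟩ := h x (by omega)
      rw [show lab b + (lab x - 1 - lab b) = lab x - 1 by omega,
        show 4 - (lab x - 1) = 4 - lab x + 1 by omega]
      exact ⟨by omega, Or.inr ⟨x, h2, hy⟩⟩
    · rw [show lab b + (lab x - 1 - lab b) = lab b by omega] at h0 ⊢
      exact h b h0
  · simp only [Dicho.relax, Function.update_of_ne hb]
    exact h b

theorem Labels.le {E : List (ℕ × ℕ)} {u : ℕ} {lab : ℕ → ℕ} (h : Labels E u lab) (b : ℕ) :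
    lab b ≤ 4 := by
  rcases Nat.eq_zero_or_pos (lab b) with h0 | h0
  · omega
  · exact (h b h0).1

/-- Relax all edges. -/
def relaxRound : Cmd :=
  .set 4 (.lit 2) ;;
  .rep (.var 2) (
    .set 5 (.inp (.var 4)) ;; .set 6 (.inp (.add (.var 4) (.lit 1))) ;;
    .put 10 (.var 6) (.add (.arr 10 (.var 6))
      (.sub (.sub (.arr 10 (.var 5)) (.lit 1)) (.arr 10 (.var 6)))) ;;
    .put 10 (.var 5) (.add (.arr 10 (.var 5))
      (.sub (.sub (.arr 10 (.var 6)) (.lit 1)) (.arr 10 (.var 5)))) ;;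
    .set 4 (.add (.var 4) (.lit 2)))

/-- All vertices reachable in `r` steps have the correct label. -/
structure RelaxState (n : ℕ) (E : List (ℕ × ℕ)) (u r : ℕ) (s : Store) : Prop where
  order : s.var 1 = n
  size : s.var 2 = E.length
  labels : Labels E u (s.arr 10)
  complete : ∀ b, Near E u r b → 4 - r ≤ s.arr 10 b

/-- Labels may travel along several edges in one round, but this does no harm: `Labels` holds after
every relaxation, and for completeness it is enough that each edge has passed on the label that its
end had at the beginning of the round. -/
theorem relaxRound_wp {I : Env} {n : ℕ} {E : List (ℕ × ℕ)} (h : EdgeInput I n E) {u r : ℕ}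
    {s : Store} (hs : RelaxState n E u r s) :
    relaxRound.Wp I (fun s' => RelaxState n E u (r + 1) s' ∧
      s'.time ≤ s.time + 300 * (E.length + 1)) s := by
  have hB := h.bound
  have hL := h.len
  unfold relaxRound
  simp only [Cmd.wp_seq, Cmd.wp_set]
  refine ⟨by simp; omega, ?_⟩
  refine Cmd.wp_rep (fun j s' => s'.var 1 = n ∧ s'.var 2 = E.length ∧ s'.var 4 = 2 + 2 * j ∧
    Labels E u (s'.arr 10) ∧ (∀ b, s.arr 10 b ≤ s'.arr 10 b) ∧
    (∀ e ∈ E.take j, s.arr 10 e.1 - 1 ≤ s'.arr 10 e.2 ∧ s.arr 10 e.2 - 1 ≤ s'.arr 10 e.1) ∧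
    s'.time ≤ s.time + 50 + 300 * j) E.length (by simp) (by simp [hs.size]) ?_ ?_ ?_
  · simp [hs.order, hs.size, hs.labels]
  · rintro j hj s' ⟨h1, h2, h3, h4, h5, h6, h7⟩
    have hf := h.fst j hj
    have hg := h.snd j hj
    have hne := h.ne _ (List.getElem_mem hj)
    have hgj : I.inp (2 + 2 * j + 1) = E[j].2 := by
      rw [← hg]
      congr 1
      omega
    obtain ⟨a, ha⟩ : ∃ a, a = E[j].1 := ⟨_, rfl⟩
    obtain ⟨b, hb⟩ : ∃ b, b = E[j].2 := ⟨_, rfl⟩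
    rw [← ha] at hf hne
    rw [← hb] at hgj hne
    have hab : (a, b) ∈ E := by
      rw [ha, hb]
      exact List.getElem_mem hj
    have l1 := h4.relax (x := a) (y := b) ((mem_adjLists E a b).2 (Or.inl hab))
    have l2 := l1.relax (x := b) (y := a) ((mem_adjLists E b a).2 (Or.inr hab))
    have v1 := l1.le b
    have v2 := l2.le a
    have m1 := le_relax (s'.arr 10) a b
    have m2 := le_relax (relax (s'.arr 10) a b) b a
    have c1 := sub_one_le_relax (s'.arr 10) a b
    have c2 := sub_one_le_relax (relax (s'.arr 10) a b) b a
    have m5a := h5 a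
    have m5b := h5 b
    have m1b := m1 b
    have m2b := m2 b
    simp only [Cmd.wp_seq, Cmd.wp_set, Cmd.wp_put]
    simp [h3, hf, hgj]
    have e2 : Function.update (Function.update (s'.arr 10) b (s'.arr 10 b +
        (s'.arr 10 a - 1 - s'.arr 10 b))) a (Function.update (s'.arr 10) b (s'.arr 10 b +
        (s'.arr 10 a - 1 - s'.arr 10 b)) a + (s'.arr 10 b + (s'.arr 10 a - 1 - s'.arr 10 b) - 1 -
        Function.update (s'.arr 10) b (s'.arr 10 b + (s'.arr 10 a - 1 - s'.arr 10 b)) a)) =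
        relax (relax (s'.arr 10) a b) b a := by
      simp [relax]
    have e3 : s'.arr 10 b + (s'.arr 10 a - 1 - s'.arr 10 b) = relax (s'.arr 10) a b b := by
      simp [relax]
    have e4 := congrFun e2 a
    rw [Function.update_self] at e4
    rw [e2, e4, e3]
    refine ⟨by omega, ⟨by omega, by omega⟩, by omega, by omega, by omega, h1, h2, by omega, l2,
      fun c => (h5 c).trans ((m1 c).trans (m2 c)), fun e f hef => ?_, by omega⟩
    rw [List.take_add_one, List.getElem?_eq_getElem hj, List.mem_append] at hef
    rcases hef with hef | hef
    · obtain ⟨k1, k2⟩ := h6 _ hef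
      simp only at k1 k2
      have := m1 f
      have := m2 f
      have := m1 e
      have := m2 e
      omega
    · simp only [Option.toList_some, List.mem_singleton] at hef
      rw [← Prod.eta E[j], ← ha, ← hb, Prod.mk.injEq] at hef
      obtain ⟨rfl, rfl⟩ := hef
      omega
  · rintro s' ⟨h1, h2, h3, h4, h5, h6, h7⟩
    rw [List.take_length] at h6
    refine ⟨⟨h1, h2, h4, ?_⟩, by simp; omega⟩
    rintro b (hb | ⟨a, ha, hab⟩)
    · have := hs.complete b hb
      have := h5 b
      simp only [Store.tick_arr]
      omega
    · have := hs.complete a ha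
      simp only [Store.tick_arr]
      rw [mem_adjLists] at hab
      rcases hab with hab | hab
      · have := (h6 _ hab).1
        simp only at this
        omega
      · have := (h6 _ hab).2
        simp only at this
        omega

/-- Let variable `0` be `1` if some vertex is at distance at least `4` from the last vertex of
LexBFS, and `0` otherwise. -/
def diamFour : Cmd :=
  buildLists ;; lexBFS ;; .put 10 (.arr 4 (.sub (.var 1) (.lit 1))) (.lit 4) ;;
  relaxRound ;; relaxRound ;; relaxRound ;; .set 0 (.lit 0) ;; .set 7 (.lit 0) ;;
  .rep (.var 1) (.ite (.arr 10 (.var 7)) .skip (.set 0 (.lit 1)) ;;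
    .set 7 (.add (.var 7) (.lit 1)))

theorem diamFour_wp {I : Env} {n : ℕ} {E : List (ℕ × ℕ)} (h : EdgeInput I n E) (hn : 0 < n)
    (hE : (E.map fun e => s(e.1, e.2)).Nodup) (s : Store) (hs : ∀ a i, s.arr a i = 0) :
    diamFour.Wp I (fun s' => (∃ ord pos cls start mark K,
      Partitioned (fun x y => y ∈ adjLists E x) n n ord pos cls start mark K ∧
      (s'.var 0 ≠ 0 ↔ ∃ b < n, ¬ Near E (ord (n - 1)) 3 b)) ∧
      s'.time ≤ s.time + 5000 * (n + E.length)) s := by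
  have hB := h.bound
  have hlt : ∀ x, ∀ y ∈ adjLists E x, y < n := by
    intro x y hy
    rw [mem_adjLists] at hy
    rcases hy with hy | hy
    exacts [(h.lt _ hy).2, (h.lt _ hy).1]
  unfold diamFour
  simp only [Cmd.wp_seq]
  refine Cmd.Wp.mono (buildLists_wp h s hs) ?_
  rintro s₁ ⟨g1, g2, g3⟩
  rw [Cmd.wp_seq]
  refine Cmd.Wp.mono (lexBFS_wp (I := I) g1 hlt (nodup_adjLists E h.ne hE) (by omega) g2) ?_
  rintro s₂ ⟨f1, f2, f3⟩
  obtain ⟨u, hu⟩ : ∃ u, u = s₂.arr 4 (n - 1) := ⟨_, rfl⟩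
  simp only [Cmd.wp_seq, Cmd.wp_put]
  simp [f1.lists.order, ← hu]
  refine ⟨by omega, ?_⟩
  have hr0 : RelaxState n E u 0 (Store.tick 22 (s₂.setArr 10 u 4)) := by
    refine ⟨f1.lists.order, f1.lists.size, fun b => ?_, fun b hb => ?_⟩
    · by_cases hb : b = u
      · simp [hb, Near]
      · simp [hb, f2 10 (le_refl _)]
    · rw [show b = u from hb]
      simp
  refine Cmd.Wp.mono (relaxRound_wp h hr0) ?_
  rintro s₃ ⟨hr1, t1⟩
  rw [Cmd.wp_seq]
  refine Cmd.Wp.mono (relaxRound_wp h hr1) ?_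
  rintro s₄ ⟨hr2, t2⟩
  rw [Cmd.wp_seq]
  refine Cmd.Wp.mono (relaxRound_wp h hr2) ?_
  rintro s₅ ⟨hr3, t3⟩
  simp only [Store.tick_time, Store.setArr_time] at t1
  -- After three rounds every vertex within three steps has a label of at least `4 - 3 = 1`, while a
  -- positive label certifies that at most three steps suffice.
  have hlab : ∀ b, s₅.arr 10 b = 0 ↔ ¬ Near E u 3 b := by
    intro b
    constructor
    · intro h0 hb
      have := hr3.complete b hb
      omega
    · intro hb
      by_contra h0
      obtain ⟨k1, k2⟩ := hr3.labels b (Nat.pos_of_ne_zero h0)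
      apply hb
      have hmono : ∀ r, Near E u r b → Near E u (r + 1) b := fun r hr => Or.inl hr
      obtain h5 | h5 | h5 | h5 : s₅.arr 10 b = 1 ∨ s₅.arr 10 b = 2 ∨ s₅.arr 10 b = 3 ∨
        s₅.arr 10 b = 4 := by omega
      all_goals
        rw [h5] at k2
        first
        | exact k2
        | exact hmono _ k2
        | exact hmono _ (hmono _ k2)
        | exact hmono _ (hmono _ (hmono _ k2))
  simp only [Cmd.wp_seq, Cmd.wp_set]
  refine ⟨by simp; omega, by simp; omega, ?_⟩
  refine Cmd.wp_rep (fun j s' => s'.var 7 = j ∧ s'.arr 10 = s₅.arr 10 ∧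
    (s'.var 0 ≠ 0 ↔ ∃ b < j, s₅.arr 10 b = 0) ∧ s'.time ≤ s₅.time + 20 + 50 * j) n (by simp)
    (by simp [hr3.order]) ?_ ?_ ?_
  · simp
  · rintro j hj s' ⟨h1, h2, h3, h4⟩
    simp only [Cmd.wp_seq, Cmd.wp_ite, Cmd.wp_set, Cmd.wp_skip]
    have key : ∀ P : Prop, (P ↔ ((∃ b < j, s₅.arr 10 b = 0) ∨ s₅.arr 10 j = 0)) →
        (P ↔ ∃ b < j + 1, s₅.arr 10 b = 0) := by
      intro P hP
      rw [hP]
      constructor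
      · rintro (⟨b, hb, h0⟩ | h0)
        exacts [⟨b, by omega, h0⟩, ⟨j, by omega, h0⟩]
      · rintro ⟨b, hb, h0⟩
        rcases Nat.lt_succ_iff_lt_or_eq.1 hb with hb | rfl
        exacts [Or.inl ⟨b, hb, h0⟩, Or.inr h0]
    refine ⟨by simp, fun h0 => ⟨by simp; omega, by simp [h1]; omega, by simp [h1], by simp [h2], ?_, ?_⟩,
      fun h0 => ⟨by simp [h1]; omega, by simp [h1], by simp [h2], ?_, ?_⟩⟩
    · apply key
      simp [h1, h2] at h0
      simp [h0]
    · simp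
      omega
    · apply key
      simp [h1, h2] at h0
      simp only [Store.tick_var, Store.setVar_var]
      simp [h0]
      exact not_iff_not.1 (by simpa using not_congr h3)
    · simp
      omega
  · rintro s' ⟨h1, h2, h3, h4⟩
    refine ⟨⟨_, ⟨_, _, _, _, _, f1.part⟩, ?_⟩, ?_⟩
    · rw [← hu]
      rw [← ne_eq, Store.tick_var, h3]
      simp only [hlab]
    · simp only [Store.tick_time]
      omega


/-! ### Deciding whether the diameter is at least four -/

theorem decidesWithin_compile {q : ℕ} {c : Cmd} {x : List ℕ} {I : Env} {w : ℕ} {T : ℝ} {b : Prop}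
    (hinp : I.inp = fun i => x.getD i 0) (hlen : I.len = 2 + q * x.getD 1 0)
    (hx : x.length ≤ I.len) (hW : I.len + 32 * I.bound + 32 ≤ 2 ^ w)
    (h : c.Wp I (fun s => (s.var 0 ≠ 0 ↔ b) ∧ (s.time : ℝ) ≤ T) (initStore q)) :
    DecidesWithin (c.compile q) x w T b := by
  obtain ⟨σ, h1, h2, h3⟩ := leads_compile q c [] x I hinp hlen hx hW h.1
  rw [List.append_nil] at h1
  refine ⟨_, h.2.2, ?_, ?_, fun s hs i => ⟨(h1.bounded s hs).1 i, (h1.bounded s hs).2 i⟩⟩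
  · rw [run, h1.iterate, h2]
  · rw [run, h1.iterate]
    have := h3.var 0
    rw [Nat.mul_zero] at this
    rw [this]
    exact h.2.1

/-- The edges of the input as pairs of numbers. -/
def GraphInput.pairs (I : GraphInput) : List (ℕ × ℕ) := I.edges.map fun e => (e.1.val, e.2.val)

theorem GraphInput.length_pairs (I : GraphInput) : I.pairs.length = I.edges.length :=
  List.length_map _

theorem GraphInput.code_eq (I : GraphInput) :
    I.code = I.order :: I.pairs.length :: I.pairs.flatMap fun e => [e.1, e.2] := by
  simp [code, pairs, List.flatMap_map]

theorem getD_flatMap_pair (l : List (ℕ × ℕ)) (i : ℕ) (hi : i < l.length) :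
    (l.flatMap fun e => [e.1, e.2]).getD (2 * i) 0 = l[i].1 ∧
      (l.flatMap fun e => [e.1, e.2]).getD (2 * i + 1) 0 = l[i].2 := by
  induction l generalizing i with
  | nil => simp at hi
  | cons e l ih =>
    cases i with
    | zero => simp
    | succ i =>
      have := ih i (by simpa using hi)
      simpa [Nat.mul_add] using this

theorem GraphInput.getD_code_lt (I : GraphInput) (i : ℕ) : I.code.getD i 0 ≤ I.size := by
  by_cases hi : i < I.code.length
  · rw [List.getD_eq_getElem _ _ hi]
    have hmem := List.getElem_mem hi
    generalize I.code[i] = v at hmem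
    simp only [code, List.mem_cons, List.mem_flatMap, List.not_mem_nil, or_false] at hmem
    unfold size
    rcases hmem with rfl | rfl | ⟨e, -, rfl | rfl⟩
    · omega
    · omega
    · have := e.1.isLt
      omega
    · have := e.2.isLt
      omega
  · rw [List.getD_eq_default _ _ (not_lt.1 hi)]
    omega

/-- The environment of a program that is run on a graph. -/
def GraphInput.env (I : GraphInput) : Env where
  inp i := I.code.getD i 0
  len := 2 + 2 * I.edges.length
  bound := 8 * I.size + 17
  inp_lt i := by
    have := I.getD_code_lt i
    omega

theorem GraphInput.edgeInput (I : GraphInput) : EdgeInput I.env I.order I.pairs where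
  order := rfl
  size := by simp [env, code, pairs]
  fst i hi := by
    have := (getD_flatMap_pair _ i hi).1
    simp only [env, code_eq]
    rw [show 2 + 2 * i = 2 * i + 1 + 1 by omega]
    simpa using this
  snd i hi := by
    have := (getD_flatMap_pair _ i hi).2
    simp only [env, code_eq]
    rw [show 3 + 2 * i = 2 * i + 1 + 1 + 1 by omega]
    simpa using this
  lt e he := by
    obtain ⟨e, -, rfl⟩ := List.mem_map.1 he
    exact ⟨e.1.isLt, e.2.isLt⟩
  ne e he := by
    obtain ⟨e, h, rfl⟩ := List.mem_map.1 he
    exact fun h' => I.loopless e h (Fin.ext h')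
  len := by simp [env, pairs]
  bound := by
    simp only [env, pairs, List.length_map, size]
    omega

theorem GraphInput.nodup_pairs (I : GraphInput) :
    (I.pairs.map fun e => s(e.1, e.2)).Nodup := by
  have : (I.pairs.map fun e => s(e.1, e.2)) =
      (I.edges.map fun e => s(e.1, e.2)).map (Sym2.map Fin.val) := by
    simp [pairs, Function.comp_def]
  rw [this]
  exact I.nodup.map (Sym2.map.injective Fin.val_injective)

theorem GraphInput.mem_adjLists_pairs (I : GraphInput) (x y : Fin I.order) :
    y.val ∈ adjLists I.pairs x.val ↔ I.graph.Adj x y := by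
  rw [mem_adjLists]
  simp only [pairs, List.mem_map, Prod.mk.injEq, Prod.exists, Fin.val_inj]
  constructor
  · rintro (⟨a, b, h, rfl, rfl⟩ | ⟨a, b, h, rfl, rfl⟩)
    exacts [Or.inl h, Or.inr h]
  · rintro (h | h)
    exacts [Or.inl ⟨_, _, h, rfl, rfl⟩, Or.inr ⟨_, _, h, rfl, rfl⟩]

theorem GraphInput.near_iff (I : GraphInput) (hconn : I.graph.Connected) (u : Fin I.order) (r : ℕ)
    (b : Fin I.order) : Near I.pairs u r b ↔ I.graph.dist u b ≤ r := by
  induction r generalizing b with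
  | zero =>
    rw [Near, Fin.val_inj, Nat.le_zero, hconn.dist_eq_zero_iff, eq_comm]
  | succ r ih =>
    rw [Near, ih]
    constructor
    · rintro (h | ⟨a, h, hab⟩)
      · omega
      · have ha : a < I.order := by
          rw [mem_adjLists] at hab
          rcases hab with hab | hab
          exacts [(I.edgeInput.lt _ hab).1, (I.edgeInput.lt _ hab).2]
        have h1 := (ih ⟨a, ha⟩).1 h
        have h2 := (I.mem_adjLists_pairs ⟨a, ha⟩ b).1 hab
        have h3 := hconn.dist_triangle (u := u) (v := ⟨a, ha⟩) (w := b)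
        rw [SimpleGraph.dist_eq_one_iff_adj.2 h2] at h3
        omega
    · intro h
      rcases h.lt_or_eq with h | h
      · exact Or.inl (by omega)
      · obtain ⟨p, hp⟩ := hconn.exists_walk_length_eq_dist b u
        right
        cases p with
        | nil => simp at h
        | cons hba p =>
          rename_i a
          refine ⟨a, (ih a).2 ?_, (I.mem_adjLists_pairs a b).2 hba.symm⟩
          rw [SimpleGraph.Walk.length_cons, SimpleGraph.dist_comm, h] at hp
          have := SimpleGraph.dist_le p
          rw [SimpleGraph.dist_comm]
          omega

/-- When `b` was visited, its label was at least that of the later vertex `a`; the position of `c`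
is where `a` would win, so some `d` decides earlier in favour of `b`. -/
theorem Partitioned.isLexOrder {I : GraphInput} {ord pos cls start mark : ℕ → ℕ} {K : ℕ}
    (h : Partitioned (fun x y => y ∈ adjLists I.pairs x) I.order I.order ord pos cls start mark K) :
    IsLexOrder I.graph fun x => pos x := by
  intro a b c hcb hba hca hncb
  simp only at hcb hba
  have hpa := h.order.pos_lt a a.isLt
  have hob := h.order.ord_pos b b.isLt
  have hoc := h.order.ord_pos c c.isLt
  obtain ⟨d, hd, h1, h2⟩ := h.done (pos b) (by omega) a a.isLt hba (pos c) hcb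
    (by rwa [hoc, I.mem_adjLists_pairs]) (by rwa [hoc, hob, I.mem_adjLists_pairs])
  have hdn := h.order.ord_lt d (by omega)
  rw [hob] at h1
  exact ⟨⟨ord d, hdn⟩, by simpa [h.order.pos_ord d (by omega)] using hd,
    (I.mem_adjLists_pairs ⟨ord d, hdn⟩ b).1 h1,
    fun h3 => h2 ((I.mem_adjLists_pairs ⟨ord d, hdn⟩ a).2 h3)⟩

/-- If the last vertex `u` has eccentricity at most `3`, the odd power `3 = 2 * 1 + 1` bounds all
distances by `3`. Otherwise some distance from `u` is already at least `4`. -/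
theorem Partitioned.four_le_diam_iff {I : GraphInput} (hconn : I.graph.Connected)
    (hG : IsChordal I.graph) {ord pos cls start mark : ℕ → ℕ} {K : ℕ}
    (h : Partitioned (fun x y => y ∈ adjLists I.pairs x) I.order I.order ord pos cls start mark K) :
    4 ≤ I.graph.diam ↔ ∃ b < I.order, ¬ Near I.pairs (ord (I.order - 1)) 3 b := by
  have hn : 0 < I.order := (Nat.zero_le _).trans_lt hconn.nonempty.some.isLt
  obtain ⟨u, hu⟩ : ∃ u : Fin I.order, u.val = ord (I.order - 1) :=
    ⟨⟨_, h.order.ord_lt _ (by omega)⟩, rfl⟩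
  have hup : pos u = I.order - 1 := by rw [hu, h.order.pos_ord _ (by omega)]
  have hle : ∀ x : Fin I.order, pos x ≤ pos u := fun x => by
    have := h.order.pos_lt x x.isLt
    omega
  have hfin : I.graph.ediam ≠ ⊤ := by
    have := hconn.nonempty
    exact SimpleGraph.connected_iff_ediam_ne_top.1 hconn
  rw [← hu]
  constructor
  · intro hd
    by_contra hcon
    push Not at hcon
    have hdu : ∀ x, I.graph.dist u x ≤ 3 := fun x => (I.near_iff hconn u 3 x).1 (hcon x x.isLt)
    have hinj : Function.Injective fun x : Fin I.order => pos x := by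
      intro x y hxy
      apply Fin.ext
      rw [← h.order.ord_pos x x.isLt, ← h.order.ord_pos y y.isLt]
      exact congrArg ord hxy
    have := diam_le_of_dist_le hconn fun x y =>
      h.isLexOrder.dist_le_of_earlier hconn hG hinj 1 u x y (hle x) (hle y) (hdu x) (hdu y)
    have h2 := ENat.toNat_le_toNat this (ENat.natCast_ne_top _)
    rw [ENat.toNat_natCast] at h2
    have h3 : I.graph.diam ≤ 3 := h2
    omega
  · rintro ⟨b, hb, hnear⟩
    have h1 := mt (I.near_iff hconn u 3 ⟨b, hb⟩).2 hnear
    have h2 := SimpleGraph.dist_le_diam hfin (u := u) (v := ⟨b, hb⟩)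
    omega

theorem GraphInput.le_two_pow_wordLength (I : GraphInput) (c : ℕ) :
    (I.size + 1) * 2 ^ c ≤ 2 ^ I.wordLength (c + 1) := by
  have h1 : I.size + 1 ≤ 2 ^ (Nat.log 2 I.size + 1) := Nat.lt_pow_succ_log_self (by omega) _
  have h2 : 2 ^ c ≤ 2 ^ (c * (Nat.log 2 I.size + 1)) :=
    Nat.pow_le_pow_right (by omega) (Nat.le_mul_of_pos_right _ (by omega))
  calc (I.size + 1) * 2 ^ c
      ≤ 2 ^ (Nat.log 2 I.size + 1) * 2 ^ (c * (Nat.log 2 I.size + 1)) := Nat.mul_le_mul h1 h2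
    _ = 2 ^ I.wordLength (c + 1) := by
      rw [wordLength, ← pow_add]
      congr 1
      ring

theorem linearTimeDecidable_four_le_diam :
    LinearTimeDecidable (fun I => I.graph.Connected ∧ IsChordal I.graph ∧
      HasDominatingShortestPath I.graph) (fun I => 4 ≤ I.graph.diam) := by
  -- The words stay below `1024 * (n + m + 1)`, which costs the factor `2 ^ 10` beyond one
  -- logarithm. The `5` beyond `5000` pays for the prologue, as `n + m ≥ 1`.
  refine ⟨diamFour.compile 2, 11, 5005, fun I ⟨hconn, hG, _⟩ => ?_⟩
  have hn : 0 < I.order := (Nat.zero_le _).trans_lt hconn.nonempty.some.isLt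
  refine decidesWithin_compile (I := I.env) rfl ?_ ?_ ?_ ?_
  · simp [GraphInput.env, GraphInput.code]
  · simp [GraphInput.env, GraphInput.code]
    omega
  · refine le_trans ?_ (I.le_two_pow_wordLength 10)
    simp only [GraphInput.env]
    have : I.edges.length ≤ I.size := Nat.le_add_left _ _
    omega
  · refine Cmd.Wp.mono (diamFour_wp I.edgeInput hn I.nodup_pairs (initStore 2)
      fun _ _ => rfl) ?_
    rintro s ⟨⟨ord, pos, cls, start, mark, K, h, h0⟩, ht⟩
    refine ⟨h0.trans (h.four_le_diam_iff hconn hG).symm, ?_⟩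
    have : s.time ≤ 5005 * I.size := by
      rw [I.length_pairs] at ht
      simp only [initStore] at ht
      unfold GraphInput.size
      omega
    exact_mod_cast this


/-! ### Running a program on an input that is stored in an array

Register `r` of the simulated program is register `4 r + 3`, and its memory is the array `g`. Each
instruction becomes a block of ten instructions. -/

/-- The instruction number `i` of a program with `n` instructions, as a block of the simulating
program, whose code starts at `o`. -/
def Instr.block (o n g i : ℕ) : Instr → List Instr
  | .const d v => [.const (4 * d + 3) v, .jz 5 (o + 10 * (i + 1))] ++ List.replicate 8 (.const 9 0)
  | .add d a b => [.add (4 * d + 3) (4 * a + 3) (4 * b + 3), .jz 5 (o + 10 * (i + 1))] ++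
      List.replicate 8 (.const 9 0)
  | .sub d a b => [.sub (4 * d + 3) (4 * a + 3) (4 * b + 3), .jz 5 (o + 10 * (i + 1))] ++
      List.replicate 8 (.const 9 0)
  | .load d a => .add 9 (4 * a + 3) 5 :: (addressCode g 0 ++ [.load (4 * d + 3) 9])
  | .store d a => .add 9 (4 * d + 3) 5 :: (addressCode g 0 ++ [.store 9 (4 * a + 3)])
  | .jz a l => [.jz (4 * a + 3) (o + 10 * min l n), .jz 5 (o + 10 * (i + 1))] ++
      List.replicate 8 (.const 9 0)

theorem Instr.length_block (o n g i : ℕ) (a : Instr) : (a.block o n g i).length = 10 := by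
  cases a <;> simp [block, addressCode]

/-- The blocks of the instructions of `P`, the first of which has number `i`. -/
def simulation (o n g : ℕ) : ℕ → Program → Program
  | _, [] => []
  | i, a :: P => a.block o n g i ++ simulation o n g (i + 1) P

theorem length_simulation (o n g i : ℕ) (P : Program) :
    (simulation o n g i P).length = 10 * P.length := by
  induction P generalizing i with
  | nil => rfl
  | cons a P ih =>
    simp only [simulation, List.length_append, Instr.length_block, ih, List.length_cons]
    omega

theorem CodeAt.simulation {Q : Program} {o n g : ℕ} {P : Program} : ∀ {i : ℕ},
    CodeAt Q (o + 10 * i) (simulation o n g i P) → ∀ {j : ℕ} {a : Instr}, P[j]? = some a →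
      CodeAt Q (o + 10 * (i + j)) (a.block o n g (i + j)) := by
  induction P with
  | nil => simp
  | cons b P ih =>
    intro i h j a hj
    cases j with
    | zero =>
      obtain rfl : b = a := by simpa using hj
      exact h.left
    | succ j =>
      have h2 := h.right
      rw [Instr.length_block, show o + 10 * i + 10 = o + 10 * (i + 1) by omega] at h2
      have := ih h2 (j := j) (a := a) (by simpa using hj)
      rwa [show i + 1 + j = i + (j + 1) by omega] at this

/-- The state `σ` of the simulating program represents the state `s` of the simulated one. -/
structure Simulates (o n g len : ℕ) (s σ : State) : Prop where
  pc : σ.pc = o + 10 * min s.pc n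
  reg : ∀ r, σ.reg (4 * r + 3) = s.reg r
  mem : ∀ x, σ.mem (len + 32 * x + g) = s.mem x
  len : σ.reg 1 = len
  zero : σ.reg 5 = 0

section

variable {Q : Program} {o n g len U W i : ℕ} {s σ : State}

/-- Instructions without memory access need one step and a jump over the padding; register `5` is
`0`, so the jump is always taken. -/
theorem leads_block_short (hb : σ.Bounded W) (h : Simulates o n g len s σ) (hi : s.pc = i)
    (hin : i < n) {a : Instr} {l : List Instr} {d v : ℕ}
    (hQ : CodeAt Q (o + 10 * i) ([a, .jz 5 (o + 10 * (i + 1))] ++ l))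
    (ha : a.exec σ = ⟨σ.pc + 1, Function.update σ.reg (4 * d + 3) v, σ.mem⟩) (hv : v < W) :
    ∃ t ≤ 10, ∃ σ', Leads Q W σ t σ' ∧
      Simulates o n g len ⟨s.pc + 1, Function.update s.reg d v, s.mem⟩ σ' := by
  have hpc : σ.pc = o + 10 * i := by rw [h.pc, hi, min_eq_left hin.le]
  have hQ' := hQ.left
  rw [← hpc] at hQ'
  have l1 := Leads.single hQ'.head ha hb (hb.update_reg hv _)
  have l2 := Leads.single (σ' := ⟨o + 10 * (i + 1), Function.update σ.reg (4 * d + 3) v, σ.mem⟩)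
    hQ'.tail.head (by
      simp only [Instr.exec]
      rw [Function.update_of_ne (by omega), h.zero, if_pos rfl]) l1.right
    (l1.right.update_reg (r := 4 * d + 3) (v := v) hv _ |> fun h => by simpa using h)
  refine ⟨2, by omega, _, l1.trans l2, ?_, fun r => ?_, h.mem, ?_, ?_⟩
  · simp only [hi]
    rw [min_eq_left (by omega)]
  · by_cases hr : r = d
    · simp [hr]
    · simp only [Function.update_of_ne hr]
      rw [Function.update_of_ne (by omega), h.reg]
  · simp only
    rw [Function.update_of_ne (by omega), h.len]
  · simp only
    rw [Function.update_of_ne (by omega), h.zero]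

/-- One copy and eight steps of address computation; the tenth instruction of the block is the
memory access `b` itself. -/
theorem leads_block_address (hW : len + 32 * U + 32 ≤ W) (hg : g < 32) (hb : σ.Bounded W)
    (h : Simulates o n g len s σ) {a : ℕ} {b : Instr} {l : List Instr} (ha : s.reg a < U)
    (hQ : CodeAt Q σ.pc (.add 9 (4 * a + 3) 5 :: (addressCode g 0 ++ (b :: l)))) :
    ∃ σ', Leads Q W σ 9 σ' ∧ σ'.pc = σ.pc + 9 ∧ Q[σ'.pc]? = some b ∧
      σ'.reg 9 = len + 32 * s.reg a + g ∧ σ'.mem = σ.mem ∧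
      ∀ r, r ≠ 9 → r ≠ 13 → σ'.reg r = σ.reg r := by
  have hval : σ.reg (4 * a + 3) + σ.reg 5 = s.reg a := by rw [h.reg, h.zero]; rfl
  have l1 := Leads.single (W := W) hQ.head (by rw [Instr.exec, hval]) hb
    (hb.update_reg (by omega) _)
  obtain ⟨σ', l2, p2, v2, m2, r2⟩ := leads_address (Q := Q) (t := 0) (a := g) (i := s.reg a) l1.right
    hQ.tail.left (by omega) (by simp) (by
      simp only
      rw [Function.update_of_ne (by omega), h.len]
      omega)
  refine ⟨σ', l1.trans l2, p2, ?_, ?_, m2, fun r h1 h2 => ?_⟩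
  · rw [p2]
    exact hQ.tail.right.head
  · rw [v2]
    simp only
    rw [Function.update_of_ne (by omega), h.len]
  · rw [r2 r (by omega) (by omega)]
    exact Function.update_of_ne h1 _ _

theorem leads_block (hW : len + 32 * U + 32 ≤ W) (hg : g < 32) (hb : σ.Bounded W)
    (h : Simulates o n g len s σ) (hi : s.pc = i) (hin : i < n) {a : Instr}
    (hQ : CodeAt Q (o + 10 * i) (a.block o n g i)) (hs : s.Bounded U)
    (hs' : (a.exec s).Bounded U) :
    ∃ t ≤ 10, ∃ σ', Leads Q W σ t σ' ∧ Simulates o n g len (a.exec s) σ' := by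
  have hpc : σ.pc = o + 10 * i := by rw [h.pc, hi, min_eq_left hin.le]
  cases a with
  | const d v =>
    have hv : v < U := by simpa [Instr.exec] using hs'.1 d
    exact leads_block_short hb h hi hin hQ rfl (by omega)
  | add d a b =>
    have hv : s.reg a + s.reg b < U := by simpa [Instr.exec] using hs'.1 d
    exact leads_block_short hb h hi hin hQ (by rw [Instr.exec, h.reg, h.reg]) (by omega)
  | sub d a b =>
    have hv : s.reg a - s.reg b < U := by simpa [Instr.exec] using hs'.1 d
    exact leads_block_short hb h hi hin hQ (by rw [Instr.exec, h.reg, h.reg]) (by omega)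
  | load d a =>
    rw [← hpc] at hQ
    obtain ⟨σ₁, l1, p1, q1, v1, m1, r1⟩ := leads_block_address hW hg hb h (hs.1 a) hQ
    have hm := hs.2 (s.reg a)
    have hval : σ₁.mem (σ₁.reg 9) = s.mem (s.reg a) := by rw [v1, m1, h.mem]
    refine ⟨10, le_rfl, _, l1.trans (Leads.single (W := W) q1 (by rw [Instr.exec, hval]) l1.right
      (l1.right.update_reg (by omega) _)), ?_, fun r => ?_, fun x => ?_, ?_, ?_⟩
    · simp only [p1, hpc, Instr.exec, hi]
      rw [min_eq_left (by omega)]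
      omega
    · by_cases hr : r = d
      · simp [hr, Instr.exec]
      · simp only [Instr.exec, Function.update_of_ne hr]
        rw [Function.update_of_ne (by omega), r1 _ (by omega) (by omega), h.reg]
    · simp only [m1, Instr.exec, h.mem]
    · simp only
      rw [Function.update_of_ne (by omega), r1 _ (by omega) (by omega), h.len]
    · simp only
      rw [Function.update_of_ne (by omega), r1 _ (by omega) (by omega), h.zero]
  | store d a =>
    rw [← hpc] at hQ
    obtain ⟨σ₁, l1, p1, q1, v1, m1, r1⟩ := leads_block_address hW hg hb h (hs.1 d) hQ
    have hm := hs.1 a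
    have hval : σ₁.reg (4 * a + 3) = s.reg a := by rw [r1 _ (by omega) (by omega), h.reg]
    refine ⟨10, le_rfl, _, l1.trans (Leads.single (W := W) q1 (by rw [Instr.exec, hval, v1]) l1.right
      (l1.right.update_mem (by omega) _)), ?_, fun r => ?_, fun x => ?_, ?_, ?_⟩
    · simp only [p1, hpc, Instr.exec, hi]
      rw [min_eq_left (by omega)]
      omega
    · simp only [Instr.exec]
      rw [r1 _ (by omega) (by omega), h.reg]
    · by_cases hx : x = s.reg d
      · simp [hx, Instr.exec]
      · simp only [Instr.exec, Function.update_of_ne hx]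
        rw [Function.update_of_ne (by omega), m1, h.mem]
    · simp only
      rw [r1 _ (by omega) (by omega), h.len]
    · simp only
      rw [r1 _ (by omega) (by omega), h.zero]
  | jz a l =>
    have hQ' := hQ.left
    rw [← hpc] at hQ'
    by_cases h0 : s.reg a = 0
    · refine ⟨1, by omega, ⟨o + 10 * min l n, σ.reg, σ.mem⟩, Leads.single hQ'.head (by
        rw [Instr.exec, h.reg, if_pos h0]) hb hb, ?_, h.reg, h.mem, h.len, h.zero⟩
      simp [Instr.exec, h0]
    · have l1 := Leads.single (σ' := ⟨σ.pc + 1, σ.reg, σ.mem⟩) hQ'.head (by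
        rw [Instr.exec, h.reg, if_neg h0]) hb hb
      have l2 := Leads.single (i := .jz 5 (o + 10 * (i + 1)))
        (σ := ⟨σ.pc + 1, σ.reg, σ.mem⟩) (σ' := ⟨o + 10 * (i + 1), σ.reg, σ.mem⟩) hQ'.tail.head (by
        rw [Instr.exec, h.zero, if_pos rfl]) hb hb
      refine ⟨2, by omega, _, l1.trans l2, ?_, h.reg, h.mem, h.len, h.zero⟩
      simp only [Instr.exec, h0, if_false, hi]
      rw [min_eq_left (by omega)]

/-- Every step of the simulated program costs at most ten. The bound `U` on its words bounds the
addresses that it can reach and so the words of the simulation. -/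
theorem leads_simulation {P : Program} (hW : len + 32 * U + 32 ≤ W) (hg : g < 32)
    (hQ : CodeAt Q o (simulation o P.length g 0 P)) (hb : σ.Bounded W)
    (h : Simulates o P.length g len s σ) (t : ℕ)
    (hs : ∀ j ≤ t, State.Bounded U ((step P)^[j] s)) :
    ∃ t' ≤ 10 * t, ∃ σ', Leads Q W σ t' σ' ∧ Simulates o P.length g len ((step P)^[t] s) σ' := by
  induction t with
  | zero => exact ⟨0, by omega, σ, Leads.refl hb, h⟩
  | succ t ih =>
    obtain ⟨t₁, ht₁, σ₁, l1, h1⟩ := ih fun j hj => hs j (by omega)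
    have hst := hs (t + 1) le_rfl
    rw [Function.iterate_succ_apply'] at hst ⊢
    generalize hs₁ : (step P)^[t] s = s₁ at h1 hst ⊢
    rcases hP : P[s₁.pc]? with _ | a
    -- The simulated program has halted; the simulation waits right after its last block.
    · have : step P s₁ = s₁ := by simp [step, hP]
      rw [this]
      exact ⟨t₁, by omega, σ₁, l1, h1⟩
    · have hstep : step P s₁ = a.exec s₁ := by simp [step, hP]
      rw [hstep] at hst ⊢
      obtain ⟨hlt, -⟩ := List.getElem?_eq_some_iff.1 hP
      have hcode := CodeAt.simulation (i := 0) (by simpa using hQ) hP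
      rw [Nat.zero_add] at hcode
      obtain ⟨t₂, ht₂, σ₂, l2, h2⟩ := leads_block hW hg l1.right h1 rfl hlt hcode
        (hs₁ ▸ hs t (by omega)) hst
      exact ⟨t₁ + t₂, by omega, σ₂, l1.trans l2, h2⟩

end

/-- Execute `c`, and then run `P` on the content of the array `g`. -/
def Cmd.followedBy (q : ℕ) (c : Cmd) (g : ℕ) (P : Program) : Program :=
  c.compile q ++ (simulation (c.compile q).length P.length g 0 P ++ [.add 0 3 5])

/-- After the compiled command, the array `g` and the untouched zero registers are precisely an
initial state with input `y`. The final addition copies the simulated register `0`, kept in register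
`3`, to register `0`. -/
theorem decidesWithin_followedBy {q : ℕ} {c : Cmd} {g : Fin 32} {P : Program} {x : List ℕ} {I : Env}
    {w w' : ℕ} {T T' : ℝ} {b : Prop} {y : List ℕ}
    (hinp : I.inp = fun i => x.getD i 0) (hlen : I.len = 2 + q * x.getD 1 0)
    (hx : x.length ≤ I.len) (hW : I.len + 32 * I.bound + 32 ≤ 2 ^ w)
    (hW' : I.len + 32 * 2 ^ w' + 32 ≤ 2 ^ w)
    (h : c.Wp I (fun s => s.arr g = (fun i => y.getD i 0) ∧ (s.time : ℝ) ≤ T) (initStore q))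
    (hP : DecidesWithin P y w' T' b) :
    DecidesWithin (c.followedBy q g P) x w (T + 10 * T' + 1) b := by
  set R := simulation (c.compile q).length P.length g 0 P ++ [Instr.add 0 3 5] with hR
  obtain ⟨σ, h1, h2, h3⟩ := leads_compile q c R x I hinp hlen hx hW h.1
  obtain ⟨t, ht, hhalt, hans, hbd⟩ := hP
  have hQ1 : CodeAt (c.compile q ++ R) (c.compile q).length
      (simulation (c.compile q).length P.length g 0 P) := CodeAt.mid _ _ _
  have hQ2 : CodeAt (c.compile q ++ R) ((c.compile q).length + 10 * P.length)
      [Instr.add 0 3 5] := by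
    have := CodeAt.mid (c.compile q ++ simulation (c.compile q).length P.length g 0 P)
      [Instr.add 0 3 5] []
    rwa [List.append_nil, List.append_assoc, ← hR, List.length_append, length_simulation] at this
  have hsim : Simulates (c.compile q).length P.length g I.len (initState y) σ := by
    refine ⟨by simp [h2, initState], fun r => h3.rest r, fun i => ?_, h3.len, h3.zero⟩
    rw [h3.arr, h.2.1]
    rfl
  obtain ⟨t', ht', σ', l2, h4⟩ := leads_simulation hW' g.isLt hQ1 h1.right hsim t
    fun j hj => ⟨fun i => (hbd j hj i).1, fun i => (hbd j hj i).2⟩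
  change Simulates _ _ _ _ (run P y t) σ' at h4
  have hpc := h4.pc
  rw [min_eq_right hhalt] at hpc
  rw [← hpc] at hQ2
  have hval : σ'.reg 3 + σ'.reg 5 = (run P y t).reg 0 := by
    rw [h4.zero]
    exact h4.reg 0
  have hlt := (hbd t le_rfl 0).1
  have l3 := Leads.single (W := 2 ^ w) hQ2.head (by rw [Instr.exec, hval]) l2.right
    (l2.right.update_reg (by omega) _)
  have l4 := (h1.trans l2).trans l3
  refine ⟨_, ?_, ?_, ?_, fun s hs i => ⟨(l4.bounded s hs).1 i, (l4.bounded s hs).2 i⟩⟩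
  · have e1 : ((t' : ℕ) : ℝ) ≤ 10 * t := by exact_mod_cast ht'
    have e2 := h.2.2
    push_cast
    linarith
  · rw [run, Cmd.followedBy, ← hR, l4.iterate]
    simp only [hpc, hR, List.length_append, length_simulation, List.length_singleton]
    omega
  · rw [run, Cmd.followedBy, ← hR, l4.iterate]
    simpa using hans


/-! ### Split graphs of diameter two or three -/

/-- Every vertex is in the clique or hangs on `a` or on `b`, so only a pair from `A` and `B` can be
more than two apart, and `a`, `b` give a walk of length three. Such pairs are never equal or
adjacent, so their distance is `2` exactly if they have a common neighbour. -/
theorem diam_of_clique_cover {V : Type*} {G : SimpleGraph V} {K A B : Set V} {a b : V}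
    (hK : G.IsClique K) (ha : a ∈ K) (hb : b ∈ K) (hab : a ≠ b) (hA : ∀ x ∈ A, G.Adj x a)
    (hB : ∀ x ∈ B, G.Adj x b) (hcover : ∀ v, v ∈ K ∨ v ∈ A ∨ v ∈ B) (hAne : A.Nonempty)
    (hBne : B.Nonempty) (hAB : ∀ x ∈ A, ∀ y ∈ B, x ≠ y ∧ ¬ G.Adj x y) :
    G.Connected ∧ HasDominatingEdge G ∧ (G.diam = 2 ∨ G.diam = 3) ∧
      (G.diam = 3 ↔ ∃ x ∈ A, ∃ y ∈ B, ∀ z, G.Adj x z → ¬ G.Adj z y) := by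
  have hadj : G.Adj a b := hK ha hb hab
  have hreach : ∀ v, G.Reachable v a := by
    intro v
    rcases hcover v with hv | hv | hv
    · by_cases hva : v = a
      · rw [hva]
      · exact (hK hv ha hva).reachable
    · exact (hA v hv).reachable
    · exact (hB v hv).reachable.trans hadj.symm.reachable
  have hconn : G.Connected := by
    have : Nonempty V := ⟨a⟩
    exact ⟨fun u v => (hreach u).trans (hreach v).symm⟩
  have one : ∀ {x y}, G.Adj x y → G.dist x y = 1 := fun h => SimpleGraph.dist_eq_one_iff_adj.2 h
  have two : ∀ {x y z}, G.dist x z ≤ 1 → G.dist z y ≤ 1 → G.dist x y ≤ 2 := by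
    intro x y z h1 h2
    have := hconn.dist_triangle (u := x) (v := z) (w := y)
    omega
  have hKd : ∀ {x y}, x ∈ K → y ∈ K → G.dist x y ≤ 1 := by
    intro x y hx hy
    by_cases hxy : x = y
    · rw [hxy, SimpleGraph.dist_self]
      omega
    · exact (one (hK hx hy hxy)).le
  have hAd : ∀ {x}, x ∈ A → G.dist x a ≤ 1 := fun h => (one (hA _ h)).le
  have hBd : ∀ {x}, x ∈ B → G.dist x b ≤ 1 := fun h => (one (hB _ h)).le
  have sym : ∀ {x y k}, G.dist x y ≤ k → G.dist y x ≤ k := fun h => by rwa [SimpleGraph.dist_comm]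
  have hcases : ∀ x y, G.dist x y ≤ 2 ∨ (x ∈ A ∧ y ∈ B) ∨ (y ∈ A ∧ x ∈ B) := by
    intro x y
    rcases hcover x with hx | hx | hx <;> rcases hcover y with hy | hy | hy
    · exact Or.inl ((hKd hx hy).trans (by omega))
    · exact Or.inl (two (hKd hx ha) (sym (hAd hy)))
    · exact Or.inl (two (hKd hx hb) (sym (hBd hy)))
    · exact Or.inl (two (hAd hx) (hKd ha hy))
    · exact Or.inl (two (hAd hx) (sym (hAd hy)))
    · exact Or.inr (Or.inl ⟨hx, hy⟩)
    · exact Or.inl (two (hBd hx) (hKd hb hy))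
    · exact Or.inr (Or.inr ⟨hy, hx⟩)
    · exact Or.inl (two (hBd hx) (sym (hBd hy)))
  have hthree : ∀ {x y}, x ∈ A → y ∈ B → G.dist x y ≤ 3 := by
    intro x y hx hy
    have h1 := hconn.dist_triangle (u := x) (v := a) (w := y)
    have h2 := two (hKd ha hb) (sym (hBd hy))
    have h3 := hAd hx
    omega
  have hle : G.ediam ≤ 3 := diam_le_of_dist_le (d := 3) hconn fun x y => by
    rcases hcases x y with h | ⟨h1, h2⟩ | ⟨h1, h2⟩
    exacts [h.trans (by omega), hthree h1 h2, sym (hthree h1 h2)]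
  have hfin : G.ediam ≠ ⊤ := ne_top_of_le_ne_top (ENat.natCast_ne_top 3) hle
  have toNat : ∀ d : ℕ, G.ediam ≤ d → G.diam ≤ d := fun d h => by
    have := ENat.toNat_le_toNat h (ENat.natCast_ne_top d)
    rwa [ENat.toNat_natCast] at this
  have hdle := toNat 3 hle
  have hlow : ∀ {x y}, x ∈ A → y ∈ B → 2 ≤ G.dist x y := by
    intro x y hx hy
    obtain ⟨h1, h2⟩ := hAB x hx y hy
    have h3 : G.dist x y ≠ 0 := fun h => h1 (hconn.dist_eq_zero_iff.1 h)
    have h4 : G.dist x y ≠ 1 := fun h => h2 (SimpleGraph.dist_eq_one_iff_adj.1 h)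
    omega
  obtain ⟨x₀, hx₀⟩ := hAne
  obtain ⟨y₀, hy₀⟩ := hBne
  have hdge : 2 ≤ G.diam := (hlow hx₀ hy₀).trans (SimpleGraph.dist_le_diam hfin)
  refine ⟨hconn, ⟨a, b, hadj, fun z => ?_⟩, by omega, ?_, ?_⟩
  · rcases hcover z with hz | hz | hz
    · by_cases hza : z = a
      · exact Or.inl hza
      · exact Or.inr (Or.inr (Or.inl (hK hz ha hza)))
    · exact Or.inr (Or.inr (Or.inl (hA z hz)))
    · exact Or.inr (Or.inr (Or.inr (hB z hz)))
  · intro hd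
    by_contra hcon
    push Not at hcon
    have hall : ∀ {x y}, x ∈ A → y ∈ B → G.dist x y ≤ 2 := by
      intro x y hx hy
      obtain ⟨z, h1, h2⟩ := hcon x hx y hy
      exact two (one h1).le (one h2).le
    have := toNat 2 (diam_le_of_dist_le (d := 2) hconn fun x y => by
      rcases hcases x y with h | ⟨h1, h2⟩ | ⟨h1, h2⟩
      exacts [h, hall h1 h2, sym (hall h1 h2)])
    omega
  · rintro ⟨x, hx, y, hy, hz⟩
    have hd : 3 ≤ G.dist x y := by
      by_contra hcon
      have h2 : G.dist x y = 2 := by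
        have := hlow hx hy
        omega
      obtain ⟨p, hp⟩ := hconn.exists_walk_length_eq_dist x y
      rw [h2] at hp
      match p, hp with
      | .cons h1 (.cons h2 .nil), _ => exact hz _ h1 h2
    have := hd.trans (SimpleGraph.dist_le_diam hfin)
    omega

/-! ### The reduction from satisfiability -/

/-- The graph with the given edges, each of which is listed with the smaller vertex first. -/
def GraphInput.ofPairs (n : ℕ) (E : List (ℕ × ℕ)) (hE : ∀ e ∈ E, e.1 < e.2 ∧ e.2 < n)
    (hnd : E.Nodup) : GraphInput where
  order := n
  edges := E.pmap (fun e he => (⟨e.1, he.1.trans he.2⟩, ⟨e.2, he.2⟩)) hE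
  loopless e he := by
    obtain ⟨e, h, rfl⟩ := List.mem_pmap.1 he
    exact fun h' => (hE e h).1.ne (Fin.mk.inj h')
  nodup := by
    rw [List.map_pmap]
    refine hnd.pmap ?_
    rintro ⟨a, b⟩ h1 ⟨c, d⟩ h2 h
    simp only at h1 h2
    simp only [Sym2.eq_iff, Fin.mk.injEq] at h
    rcases h with ⟨rfl, rfl⟩ | ⟨rfl, rfl⟩
    · rfl
    · omega

theorem GraphInput.pairs_ofPairs {n : ℕ} {E : List (ℕ × ℕ)} (hE : ∀ e ∈ E, e.1 < e.2 ∧ e.2 < n)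
    (hnd : E.Nodup) : (ofPairs n E hE hnd).pairs = E := by
  simp [pairs, ofPairs, List.map_pmap]

theorem GraphInput.adj_ofPairs {n : ℕ} {E : List (ℕ × ℕ)} (hE : ∀ e ∈ E, e.1 < e.2 ∧ e.2 < n)
    (hnd : E.Nodup) (x y : Fin n) :
    (ofPairs n E hE hnd).graph.Adj x y ↔ (x.val, y.val) ∈ E ∨ (y.val, x.val) ∈ E := by
  have := (ofPairs n E hE hnd).mem_adjLists_pairs x y
  rw [← this, mem_adjLists, pairs_ofPairs]

/-- The value of the literal `ℓ`, where `2 v + 1` is the variable `v` and `2 v` its negation, if the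
variable `v₀ + i` has the value of the bit `i` of `a`, for `i < k`. The value is `0` if the variable
of `ℓ` is not among these. -/
def litVal (v₀ k a ℓ : ℕ) : ℕ :=
  if v₀ ≤ ℓ / 2 ∧ ℓ / 2 < v₀ + k ∧ a / 2 ^ (ℓ / 2 - v₀) % 2 = ℓ % 2 then 1 else 0

/-- The number of literals of a clause that are true under a partial assignment. -/
def clauseVal (v₀ k a : ℕ) (cl : List ℕ) : ℕ := (cl.map (litVal v₀ k a)).sum

/-- The edges of the complete graph. -/
def cliqueEdges (k : ℕ) : List (ℕ × ℕ) :=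
  (List.range k).flatMap fun y => (List.range y).map fun x => (x, y)

/-- The edges from the vertex `y`, which stands for a partial assignment, to `t` and to the clauses
that it does not satisfy. -/
def sideEdges (C : List (List ℕ)) (f : List ℕ → ℕ) (t y : ℕ) : List (ℕ × ℕ) :=
  (t, y) :: ((List.range C.length).filter fun j => f (C.getD j []) = 0).map fun j => (2 + j, y)

/-- The edges of the graph of a formula with `n` variables and the clauses `C`. -/
def reductionEdges (n : ℕ) (C : List (List ℕ)) : List (ℕ × ℕ) :=
  cliqueEdges (C.length + 2) ++
    ((List.range (2 ^ ((n + 1) / 2))).flatMap fun a =>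
      sideEdges C (clauseVal 0 ((n + 1) / 2) a) 0 (C.length + 2 + a)) ++
    ((List.range (2 ^ ((n + 1) / 2))).flatMap fun a =>
      sideEdges C (clauseVal ((n + 1) / 2) (n - (n + 1) / 2) a) 1
        (C.length + 2 + 2 ^ ((n + 1) / 2) + a))

theorem mem_cliqueEdges {k : ℕ} {e : ℕ × ℕ} : e ∈ cliqueEdges k ↔ e.1 < e.2 ∧ e.2 < k := by
  obtain ⟨x, y⟩ := e
  simp only [cliqueEdges, List.mem_flatMap, List.mem_range, List.mem_map, Prod.mk.injEq]
  constructor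
  · rintro ⟨_, h1, _, h2, rfl, rfl⟩
    exact ⟨h2, h1⟩
  · rintro ⟨h1, h2⟩
    exact ⟨y, h2, x, h1, rfl, rfl⟩

theorem mem_sideEdges {C : List (List ℕ)} {f : List ℕ → ℕ} {t y : ℕ} {e : ℕ × ℕ} :
    e ∈ sideEdges C f t y ↔ e.2 = y ∧
      (e.1 = t ∨ ∃ j < C.length, f (C.getD j []) = 0 ∧ e.1 = 2 + j) := by
  obtain ⟨x, z⟩ := e
  simp only [sideEdges, List.mem_cons, List.mem_map, List.mem_filter, List.mem_range, Prod.mk.injEq,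
    decide_eq_true_eq]
  constructor
  · rintro (⟨rfl, rfl⟩ | ⟨j, ⟨h1, h2⟩, rfl, rfl⟩)
    exacts [⟨rfl, Or.inl rfl⟩, ⟨rfl, Or.inr ⟨j, h1, h2, rfl⟩⟩]
  · rintro ⟨rfl, rfl | ⟨j, h1, h2, rfl⟩⟩
    exacts [Or.inl ⟨rfl, rfl⟩, Or.inr ⟨j, ⟨h1, h2⟩, rfl, rfl⟩]

theorem nodup_cliqueEdges (k : ℕ) : (cliqueEdges k).Nodup := by
  refine List.nodup_flatMap.2 ⟨fun y _ => List.nodup_range.map fun a b h => (Prod.mk.inj h).1, ?_⟩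
  refine List.nodup_range.imp fun {a b} hab => ?_
  rw [Function.onFun, List.disjoint_left]
  rintro e h1 h2
  obtain ⟨_, -, rfl⟩ := List.mem_map.1 h1
  obtain ⟨_, -, h⟩ := List.mem_map.1 h2
  exact hab (Prod.mk.inj h).2.symm

theorem nodup_sideEdges (C : List (List ℕ)) (f : List ℕ → ℕ) {t : ℕ} (ht : t < 2) (y : ℕ) :
    (sideEdges C f t y).Nodup := by
  refine List.nodup_cons.2 ⟨fun h => ?_, (List.nodup_range.filter _).map fun a b h => ?_⟩
  · obtain ⟨j, -, h⟩ := List.mem_map.1 h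
    have := (Prod.mk.inj h).1
    omega
  · have := (Prod.mk.inj h).1
    omega

theorem nodup_flatMap_sideEdges (C : List (List ℕ)) (f : ℕ → List ℕ → ℕ) {t : ℕ} (ht : t < 2)
    (k y : ℕ) : ((List.range k).flatMap fun a => sideEdges C (f a) t (y + a)).Nodup := by
  refine List.nodup_flatMap.2 ⟨fun a _ => nodup_sideEdges C _ ht _, ?_⟩
  refine List.nodup_range.imp fun {a b} hab => ?_
  rw [Function.onFun, List.disjoint_left]
  intro e h1 h2
  have e1 := (mem_sideEdges.1 h1).1
  have e2 := (mem_sideEdges.1 h2).1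
  omega

theorem mem_reductionEdges {n : ℕ} {C : List (List ℕ)} {e : ℕ × ℕ} :
    e ∈ reductionEdges n C ↔ (e.1 < e.2 ∧ e.2 < C.length + 2) ∨
      (∃ a < 2 ^ ((n + 1) / 2), e.2 = C.length + 2 + a ∧ (e.1 = 0 ∨ ∃ j < C.length,
        clauseVal 0 ((n + 1) / 2) a (C.getD j []) = 0 ∧ e.1 = 2 + j)) ∨
      (∃ a < 2 ^ ((n + 1) / 2), e.2 = C.length + 2 + 2 ^ ((n + 1) / 2) + a ∧
        (e.1 = 1 ∨ ∃ j < C.length,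
          clauseVal ((n + 1) / 2) (n - (n + 1) / 2) a (C.getD j []) = 0 ∧ e.1 = 2 + j)) := by
  simp only [reductionEdges, List.mem_append, mem_cliqueEdges, List.mem_flatMap, List.mem_range,
    mem_sideEdges, or_assoc]

theorem nodup_reductionEdges (n : ℕ) (C : List (List ℕ)) : (reductionEdges n C).Nodup := by
  refine ((nodup_cliqueEdges _).append (nodup_flatMap_sideEdges C _ (by omega) _ _) ?_).append
    (nodup_flatMap_sideEdges C _ (by omega) _ _) ?_
  · rw [List.disjoint_left]
    intro e h1 h2
    rw [mem_cliqueEdges] at h1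
    obtain ⟨a, -, h2⟩ := List.mem_flatMap.1 h2
    have := (mem_sideEdges.1 h2).1
    omega
  · rw [List.disjoint_left]
    intro e h1 h2
    obtain ⟨b, -, h2⟩ := List.mem_flatMap.1 h2
    have e2 := (mem_sideEdges.1 h2).1
    have hH : 0 < 2 ^ ((n + 1) / 2) := by positivity
    rcases List.mem_append.1 h1 with h1 | h1
    · rw [mem_cliqueEdges] at h1
      omega
    · obtain ⟨a, ha, h1⟩ := List.mem_flatMap.1 h1
      have e1 := (mem_sideEdges.1 h1).1
      rw [List.mem_range] at ha
      omega

theorem reductionEdges_lt (n : ℕ) (C : List (List ℕ)) :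
    ∀ e ∈ reductionEdges n C, e.1 < e.2 ∧ e.2 < C.length + 2 + 2 * 2 ^ ((n + 1) / 2) := by
  intro e he
  rw [mem_reductionEdges] at he
  rcases he with h | ⟨a, h1, h2, h3 | ⟨j, h3, -, h4⟩⟩ | ⟨a, h1, h2, h3 | ⟨j, h3, -, h4⟩⟩ <;> omega

/-- The graph of a formula with `n` variables and the clauses `C`. -/
def reductionGraph (n : ℕ) (C : List (List ℕ)) : GraphInput :=
  .ofPairs (C.length + 2 + 2 * 2 ^ ((n + 1) / 2)) (reductionEdges n C) (reductionEdges_lt n C)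
    (nodup_reductionEdges n C)

/-- The vertices `0` and `1` are the hubs of the two halves, `2 + j` is clause `j`, and two blocks
of `H` assignments follow. A common neighbour of assignments of different halves is a clause that
neither satisfies. -/
theorem reduction_spec (n : ℕ) (C : List (List ℕ)) {M H : ℕ} (hM : M = C.length)
    (hH : H = 2 ^ ((n + 1) / 2)) (G : SimpleGraph (Fin (M + 2 + 2 * H)))
    (hadj : ∀ x y, G.Adj x y ↔ (x.val, y.val) ∈ reductionEdges n C ∨
      (y.val, x.val) ∈ reductionEdges n C) :
    G.Connected ∧ IsSplit G ∧
    HasDominatingEdge G ∧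
    (G.diam = 2 ∨ G.diam = 3) ∧
    (G.diam = 3 ↔
      ∃ a < H, ∃ b < H, ∀ j < M,
        clauseVal 0 ((n + 1) / 2) a (C.getD j []) ≠ 0 ∨
        clauseVal ((n + 1) / 2) (n - (n + 1) / 2) b (C.getD j []) ≠ 0) := by
  have hH0 : 0 < H := hH ▸ by positivity
  let K : Set (Fin (M + 2 + 2 * H)) := {x | x.val < M + 2}
  have hK : G.IsClique K := by
    intro x hx y hy hxy
    rw [hadj, mem_reductionEdges, mem_reductionEdges]
    have hxy' : x.val ≠ y.val := fun h => hxy (Fin.ext h)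
    have hx' : x.val < M + 2 := hx
    have hy' : y.val < M + 2 := hy
    rcases Nat.lt_or_gt_of_ne hxy' with h | h
    · exact Or.inl (Or.inl ⟨h, hM ▸ hy'⟩)
    · exact Or.inr (Or.inl ⟨h, hM ▸ hx'⟩)
  have hstable : ∀ x y : Fin (M + 2 + 2 * H), M + 2 ≤ x.val → M + 2 ≤ y.val → ¬ G.Adj x y := by
    intro x y hx hy
    rw [hadj, mem_reductionEdges, mem_reductionEdges]
    rintro (h | h) <;>
      rcases h with h | ⟨a, h1, h2, h3 | ⟨j, h3, -, h4⟩⟩ | ⟨a, h1, h2, h3 | ⟨j, h3, -, h4⟩⟩ <;>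
      simp only at * <;> omega
  have key := diam_of_clique_cover (G := G) (K := K)
    (A := {x : Fin (M + 2 + 2 * H) | M + 2 ≤ x.val ∧ x.val < M + 2 + H})
    (B := {x : Fin (M + 2 + 2 * H) | M + 2 + H ≤ x.val})
    (a := (⟨0, by omega⟩ : Fin (M + 2 + 2 * H))) (b := (⟨1, by omega⟩ : Fin (M + 2 + 2 * H)))
    hK (show 0 < M + 2 by omega) (show 1 < M + 2 by omega) (fun h => by simpa using Fin.mk.inj h)
    (fun x hx => (hadj _ _).2 (Or.inr (mem_reductionEdges.2 (Or.inr (Or.inl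
      ⟨x.val - (M + 2), by have := hx.2; omega, by have := hx.1; simp only; omega, Or.inl rfl⟩)))))
    (fun x hx => (hadj _ _).2 (Or.inr (mem_reductionEdges.2 (Or.inr (Or.inr
      ⟨x.val - (M + 2 + H), by have := x.isLt; omega, by
        have : M + 2 + H ≤ x.val := hx
        simp only; omega, Or.inl rfl⟩)))))
    (fun x => by
      rcases Nat.lt_or_ge x.val (M + 2) with h | h
      · exact Or.inl h
      · rcases Nat.lt_or_ge x.val (M + 2 + H) with h' | h'
        exacts [Or.inr (Or.inl ⟨h, h'⟩), Or.inr (Or.inr h')])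
    ⟨⟨M + 2, by omega⟩, by simp only [Set.mem_ofPred_eq]; omega⟩
    ⟨⟨M + 2 + H, by omega⟩, le_refl (M + 2 + H)⟩
    (fun x hx y hy => by
      have hy' : M + 2 + H ≤ y.val := hy
      refine ⟨fun h => ?_, hstable x y hx.1 (by omega)⟩
      have := hx.2
      rw [h] at this
      omega)
  obtain ⟨h1, h2, h3, h4⟩ := key
  refine ⟨h1, ⟨K, hK, ?_⟩, h2, h3, h4.trans ⟨?_, ?_⟩⟩
  · intro x hx y hy _
    exact hstable x y (not_lt.1 hx) (not_lt.1 hy)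
  · rintro ⟨x, hx, y, hy, hz⟩
    have hx1 := hx.1
    have hx2 := hx.2
    have hy1 : M + 2 + H ≤ y.val := hy
    have hy2 := y.isLt
    refine ⟨x.val - (M + 2), by omega, y.val - (M + 2 + H), by omega, fun j hj => ?_⟩
    by_contra hcon
    push Not at hcon
    refine hz (⟨2 + j, by omega⟩ : Fin (M + 2 + 2 * H)) ?_ ?_
    · rw [hadj]
      exact Or.inr (mem_reductionEdges.2 (Or.inr (Or.inl ⟨_, by omega, by simp only; omega,
        Or.inr ⟨j, hM ▸ hj, hcon.1, rfl⟩⟩)))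
    · rw [hadj]
      exact Or.inl (mem_reductionEdges.2 (Or.inr (Or.inr ⟨_, by omega, by simp only; omega,
        Or.inr ⟨j, hM ▸ hj, hcon.2, rfl⟩⟩)))
  · rintro ⟨a, ha, b, hb, hall⟩
    refine ⟨(⟨M + 2 + a, by omega⟩ : Fin (M + 2 + 2 * H)), ⟨by simp only; omega, by simp only; omega⟩,
      (⟨M + 2 + H + b, by omega⟩ : Fin (M + 2 + 2 * H)),
      show M + 2 + H ≤ M + 2 + H + b by omega, fun z hxz hzy => ?_⟩
    have hzlt : z.val < M + 2 := by
      by_contra hge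
      exact hstable _ _ (by simp only; omega) (not_lt.1 hge) hxz
    rw [hadj, mem_reductionEdges, mem_reductionEdges] at hxz hzy
    simp only at hxz hzy
    -- From its adjacency to the first half, `z` is the hub `0` or a clause missed by `a`; from the
    -- second half, the hub `1` or a clause missed by `b`. The hubs differ, so `z` is a clause.
    have e1 : z.val = 0 ∨ ∃ j < M, clauseVal 0 ((n + 1) / 2) a (C.getD j []) = 0 ∧ z.val = 2 + j := by
      rcases hxz with h | h
      · omega
      · rcases h with h | ⟨a', h1, h2, h3⟩ | ⟨a', h1, h2, -⟩
        · omega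
        · obtain rfl : a = a' := by omega
          exact hM ▸ h3
        · omega
    have e2 : z.val = 1 ∨ ∃ j < M, clauseVal ((n + 1) / 2) (n - (n + 1) / 2) b (C.getD j []) = 0 ∧
        z.val = 2 + j := by
      rcases hzy with h | h
      · rcases h with h | ⟨a', h1, h2, -⟩ | ⟨a', h1, h2, h3⟩
        · omega
        · omega
        · obtain rfl : b = a' := by omega
          exact hM ▸ h3
      · rcases h with h | ⟨_, _, h, -⟩ | ⟨_, _, h, -⟩ <;> omega
    rcases e1 with e1 | ⟨j, hj, e1, e1'⟩ <;> rcases e2 with e2 | ⟨j', hj', e2, e2'⟩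
    · omega
    · omega
    · omega
    · obtain rfl : j = j' := by omega
      rcases hall j hj with h | h
      exacts [h e1, h e2]

theorem reductionGraph_spec (n : ℕ) (C : List (List ℕ)) :
    (reductionGraph n C).graph.Connected ∧ IsSplit (reductionGraph n C).graph ∧
    HasDominatingEdge (reductionGraph n C).graph ∧
    ((reductionGraph n C).graph.diam = 2 ∨ (reductionGraph n C).graph.diam = 3) ∧
    ((reductionGraph n C).graph.diam = 3 ↔
      ∃ a < 2 ^ ((n + 1) / 2), ∃ b < 2 ^ ((n + 1) / 2), ∀ j < C.length,
        clauseVal 0 ((n + 1) / 2) a (C.getD j []) ≠ 0 ∨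
        clauseVal ((n + 1) / 2) (n - (n + 1) / 2) b (C.getD j []) ≠ 0) :=
  reduction_spec n C rfl rfl _ (GraphInput.adj_ofPairs _ _)


/-- The clauses of a formula as lists of numbers. -/
def KCNF.lists {k : ℕ} (φ : KCNF k) : List (List ℕ) :=
  φ.clauses.map fun cl => cl.map fun l => 2 * l.1.val + l.2.toNat

theorem clauseVal_ne_zero {v₀ k a : ℕ} {cl : List ℕ} :
    clauseVal v₀ k a cl ≠ 0 ↔ ∃ ℓ ∈ cl, litVal v₀ k a ℓ ≠ 0 := by
  simp [clauseVal, List.sum_eq_zero_iff]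

theorem litVal_code_ne_zero {v₀ k a v : ℕ} {b : Bool} :
    litVal v₀ k a (2 * v + b.toNat) ≠ 0 ↔ v₀ ≤ v ∧ v < v₀ + k ∧ a.testBit (v - v₀) = b := by
  have hb := Bool.toNat_lt b
  have h1 : (2 * v + b.toNat) / 2 = v := by omega
  have h2 : (2 * v + b.toNat) % 2 = b.toNat := by omega
  rw [litVal, h1, h2, Nat.testBit_eq_decide_div_mod_eq]
  have h3 : a / 2 ^ (v - v₀) % 2 = b.toNat ↔ decide (a / 2 ^ (v - v₀) % 2 = 1) = b := by
    cases b <;> simp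
  rw [← h3]
  simp

/-- An assignment is a pair of bit strings, one for the first `h` variables and one for the rest.
The second half may have fewer than `h` variables; its superfluous bits are never read. -/
theorem KCNF.satisfiable_iff {k : ℕ} (φ : KCNF k) {h : ℕ} (hh : h ≤ φ.vars) (hh' : φ.vars - h ≤ h) :
    φ.Satisfiable ↔ ∃ a < 2 ^ h, ∃ b < 2 ^ h, ∀ j < φ.lists.length,
      clauseVal 0 h a (φ.lists.getD j []) ≠ 0 ∨
      clauseVal h (φ.vars - h) b (φ.lists.getD j []) ≠ 0 := by
  have hall : ∀ Q : List ℕ → Prop, (∀ j < φ.lists.length, Q (φ.lists.getD j [])) ↔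
      ∀ cl ∈ φ.clauses, Q (cl.map fun l => 2 * l.1.val + l.2.toNat) := by
    intro Q
    have : (∀ cl ∈ φ.clauses, Q (cl.map fun l => 2 * l.1.val + l.2.toNat)) ↔
        ∀ cl ∈ φ.lists, Q cl := by simp [lists]
    rw [this]
    constructor
    · intro hQ cl hcl
      obtain ⟨j, hj, rfl⟩ := List.mem_iff_getElem.1 hcl
      have := hQ j hj
      rwa [List.getD_eq_getElem _ _ hj] at this
    · intro hQ j hj
      rw [List.getD_eq_getElem _ _ hj]
      exact hQ _ (List.getElem_mem hj)
  have hclause : ∀ a b : ℕ, ∀ cl : List (Fin φ.vars × Bool),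
      (clauseVal 0 h a (cl.map fun l => 2 * l.1.val + l.2.toNat) ≠ 0 ∨
        clauseVal h (φ.vars - h) b (cl.map fun l => 2 * l.1.val + l.2.toNat) ≠ 0) ↔
      ∃ l ∈ cl, (if l.1.val < h then a.testBit l.1 else b.testBit (l.1 - h)) = l.2 := by
    intro a b cl
    rw [clauseVal_ne_zero, clauseVal_ne_zero]
    simp only [List.mem_map, exists_exists_and_eq_and, litVal_code_ne_zero]
    rw [← exists_or]
    refine exists_congr fun l => ?_
    rw [← and_or_left]
    refine and_congr_right fun _ => ?_
    have hl := l.1.isLt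
    by_cases hlt : l.1.val < h
    · simp [hlt]
    · simp [hlt, not_lt.1 hlt]
      omega
  refine Iff.trans ?_ (exists_congr fun a => and_congr_right fun _ => exists_congr fun b =>
    and_congr_right fun _ => (hall fun cl => clauseVal 0 h a cl ≠ 0 ∨
      clauseVal h (φ.vars - h) b cl ≠ 0).trans (forall₂_congr fun cl _ => hclause a b cl)).symm
  constructor
  · rintro ⟨τ, hτ⟩
    -- The value beyond the last variable only fills superfluous bits.
    let f : ℕ → Bool := fun v => if hv : v < φ.vars then τ ⟨v, hv⟩ else false
    refine ⟨Nat.ofBits fun i : Fin h => f i, Nat.ofBits_lt_two_pow _,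
      Nat.ofBits fun i : Fin h => f (h + i), Nat.ofBits_lt_two_pow _, fun cl hcl => ?_⟩
    obtain ⟨l, hl, hl'⟩ := hτ cl hcl
    refine ⟨l, hl, ?_⟩
    have hlv := l.1.isLt
    by_cases hlt : l.1.val < h
    · rw [if_pos hlt, Nat.testBit_ofBits_lt _ _ hlt, ← hl']
      simp [f]
    · rw [if_neg hlt, Nat.testBit_ofBits_lt _ _ (by omega), ← hl']
      simp only [f]
      rw [dif_pos (by omega)]
      exact congrArg τ (Fin.ext (by simp only; omega))
  · rintro ⟨a, -, b, -, hab⟩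
    exact ⟨fun v => if v.val < h then a.testBit v else b.testBit (v - h), hab⟩

theorem KCNF.reductionGraph_diam_eq_three_iff {k : ℕ} (φ : KCNF k) :
    (reductionGraph φ.vars φ.lists).graph.diam = 3 ↔ φ.Satisfiable :=
  (reductionGraph_spec φ.vars φ.lists).2.2.2.2.trans
    (φ.satisfiable_iff (by omega) (by omega)).symm


/-! ### The reduction as a program -/

/-- The array `3` contains the edges of the list `E` from cell `2` on. Variable `20` is the first
free cell, and variable `21` the number of edges. -/
structure Emitted (E : List (ℕ × ℕ)) (s : Store) : Prop where
  out : s.arr 3 = fun i => (0 :: 0 :: E.flatMap fun e => [e.1, e.2]).getD i 0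
  ptr : s.var 20 = 2 + 2 * E.length
  count : s.var 21 = E.length

theorem Emitted.congr {E : List (ℕ × ℕ)} {s s' : Store} (h : Emitted E s)
    (h3 : s'.arr 3 = s.arr 3) (h20 : s'.var 20 = s.var 20) (h21 : s'.var 21 = s.var 21) :
    Emitted E s' :=
  ⟨h3.trans h.out, h20.trans h.ptr, h21.trans h.count⟩

theorem update_getD_length (l : List ℕ) (v : ℕ) :
    Function.update (fun i => l.getD i 0) l.length v = fun i => (l ++ [v]).getD i 0 := by
  ext i
  rcases lt_trichotomy i l.length with h | rfl | h
  · rw [Function.update_of_ne h.ne, List.getD_append _ _ _ _ h]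
  · simp
  · rw [Function.update_of_ne h.ne', List.getD_eq_default _ _ h.le,
      List.getD_eq_default _ _ (by simp; omega)]

theorem length_flatMap_pair (E : List (ℕ × ℕ)) :
    (E.flatMap fun e => [e.1, e.2]).length = 2 * E.length := by
  induction E with
  | nil => rfl
  | cons e E ih =>
    simp only [List.flatMap_cons, List.length_append, ih, List.length_cons, List.length_nil]
    omega

/-- Append the edge from the vertex in variable `22` to the one in variable `7`. -/
def emit : Cmd :=
  .put 3 (.var 20) (.var 22) ;; .put 3 (.add (.var 20) (.lit 1)) (.var 7) ;;
  .set 20 (.add (.var 20) (.lit 2)) ;; .set 21 (.add (.var 21) (.lit 1))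

/-- The store `s'` differs from `s` at most in the variables from `c` on and in the arrays that
satisfy `A`. -/
structure Frame (c : ℕ) (A : Fin 32 → Prop) (s s' : Store) : Prop where
  var : ∀ v < c, s'.var v = s.var v
  arr : ∀ a, ¬ A a → s'.arr a = s.arr a

theorem emit_wp {I : Env} {E : List (ℕ × ℕ)} {s : Store} (h : Emitted E s)
    (hB : 2 * E.length + 5 ≤ I.bound) :
    emit.Wp I (fun s' => Emitted (E ++ [(s.var 22, s.var 7)]) s' ∧ Frame 20 (· = 3) s s' ∧
      s'.var 22 = s.var 22 ∧ s'.time = s.time + 32) s := by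
  have hlen := length_flatMap_pair E
  unfold emit
  simp only [Cmd.wp_seq, Cmd.wp_set, Cmd.wp_put]
  simp [h.ptr, h.count]
  refine ⟨by omega, by omega, by omega, ⟨?_, by simp; omega, by simp⟩, ?_, ?_⟩
  · have e1 := update_getD_length (0 :: 0 :: E.flatMap fun e => [e.1, e.2]) (s.var 22)
    have e2 := update_getD_length ((0 :: 0 :: E.flatMap fun e => [e.1, e.2]) ++ [s.var 22])
      (s.var 7)
    rw [← e1] at e2
    have l1 : (0 :: 0 :: E.flatMap fun e => [e.1, e.2]).length = 2 + 2 * E.length := by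
      simp only [List.length_cons]
      omega
    have l2 : ((0 :: 0 :: E.flatMap fun e => [e.1, e.2]) ++ [s.var 22]).length =
        2 + 2 * E.length + 1 := by
      rw [List.length_append, l1]
      rfl
    rw [l1, l2, ← h.out] at e2
    simp [e2]
  · intro v hv
    simp [show v ≠ 20 by omega, show v ≠ 21 by omega]
  · intro a ha
    simp [ha]

/-- The clauses `C` in the input, the one with number `j` starting at cell `2 + pos j`. There is
space for `K` edges and for two tables with `2 ^ h` entries. -/
structure ClauseInput (I : Env) (n k K H : ℕ) (C : List (List ℕ)) (pos : ℕ → ℕ) : Prop where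
  vars : I.inp 0 = n
  count : I.inp 1 = C.length
  pos_zero : pos 0 = 0
  pos_succ : ∀ j (h : j < C.length), pos (j + 1) = pos j + 1 + C[j].length
  length_eq : ∀ j (h : j < C.length), I.inp (2 + pos j) = C[j].length
  lit_eq : ∀ j (h : j < C.length) i (hi : i < C[j].length), I.inp (2 + pos j + 1 + i) = C[j][i]
  width : ∀ cl ∈ C, cl.length ≤ k
  lit_lt : ∀ cl ∈ C, ∀ ℓ ∈ cl, ℓ < 2 * n
  pos_le : ∀ j ≤ C.length, 2 + pos j ≤ I.len
  len : I.len < I.bound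
  bound : 2 * K + 2 * C.length + 8 * H + 4 * n + 2 * k + 32 ≤ I.bound

/-- Add up the entries of the array `L` that belong to the literals of the clause that starts at
the cell in variable `12`, in variable `14`. -/
def sumClause (L : Fin 32) : Cmd :=
  .set 15 (.inp (.var 12)) ;; .set 12 (.add (.var 12) (.lit 1)) ;; .set 14 (.lit 0) ;;
  .rep (.var 15) (.set 14 (.add (.var 14) (.arr L (.inp (.var 12)))) ;;
    .set 12 (.add (.var 12) (.lit 1)))

theorem sumClause_wp {I : Env} {n k K H : ℕ} {C : List (List ℕ)} {pos : ℕ → ℕ}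
    (h : ClauseInput I n k K H C pos) {L : Fin 32} {g : ℕ → ℕ} (hg : ∀ ℓ, g ℓ ≤ 1) {s : Store}
    (hL : ∀ ℓ < 2 * n, s.arr L ℓ = g ℓ) {j : ℕ} (hj : j < C.length) (h12 : s.var 12 = 2 + pos j) :
    (sumClause L).Wp I (fun s' => s'.var 14 = (C[j].map g).sum ∧ s'.var 12 = 2 + pos (j + 1) ∧
      (∀ v, v < 12 ∨ 20 ≤ v → s'.var v = s.var v) ∧ s'.arr = s.arr ∧
      s'.time ≤ s.time + 30 * (k + 1)) s := by
  have hB := h.bound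
  have hlen := h.len
  have hsucc := h.pos_succ j hj
  have hpos := h.pos_le (j + 1) hj
  have hw := h.width _ (List.getElem_mem hj)
  have hle := h.length_eq j hj
  unfold sumClause
  simp only [Cmd.wp_seq, Cmd.wp_set]
  simp [h12, hle]
  refine ⟨by omega, ⟨by omega, by omega⟩, by omega, ?_⟩
  have hsum : ∀ l : List ℕ, (l.map g).sum ≤ l.length := by
    intro l
    induction l with
    | nil => simp
    | cons a l ih =>
      have := hg a
      simp only [List.map_cons, List.sum_cons, List.length_cons]
      omega
  refine Cmd.wp_rep (fun i s' => s'.var 14 = ((C[j].take i).map g).sum ∧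
    s'.var 12 = 2 + pos j + 1 + i ∧ (∀ v, v < 12 ∨ 20 ≤ v → s'.var v = s.var v) ∧
    s'.arr = s.arr ∧ s'.time ≤ s.time + 20 + 25 * i) C[j].length (by simp) (by simp) ?_ ?_ ?_
  · simp
    intro v hv
    simp [show v ≠ 12 by omega, show v ≠ 14 by omega, show v ≠ 15 by omega]
  · rintro i hi s' ⟨h1, h2, h3, h4, h5⟩
    have hlit := h.lit_eq j hj i hi
    have hlt := h.lit_lt _ (List.getElem_mem hj) _ (List.getElem_mem hi)
    have hs1 := hsum (C[j].take (i + 1))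
    rw [List.take_add_one, List.getElem?_eq_getElem hi, List.map_append, List.sum_append] at hs1 ⊢
    simp only [List.length_append, List.length_take] at hs1
    simp only [Cmd.wp_seq, Cmd.wp_set]
    simp [h1, h2, h4, hlit, hL _ hlt] at hs1 ⊢
    refine ⟨⟨by omega, by omega⟩, ⟨by omega, by omega⟩, by omega, fun v hv => ?_, by omega⟩
    rw [← h3 v hv]
    simp [show v ≠ 12 by omega, show v ≠ 14 by omega]
  · rintro s' ⟨h1, h2, h3, h4, h5⟩
    rw [List.take_length] at h1
    refine ⟨h1, ?_, h3, h4, ?_⟩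
    · simp only [Store.tick_var]
      omega
    · simp only [Store.tick_time]
      omega

/-- Emit edges from the vertex in variable `7` to all clauses for which `sumClause` gives `0`. -/
def clauseLoop (L : Fin 32) : Cmd :=
  .set 12 (.lit 2) ;; .set 22 (.lit 2) ;;
  .rep (.var 2) (sumClause L ;; .ite (.var 14) .skip emit ;; .set 22 (.add (.var 22) (.lit 1)))

/-- The edges from `y` to those of the first `j` clauses that have no true literal. -/
def clauseEdges (C : List (List ℕ)) (g : ℕ → ℕ) (y j : ℕ) : List (ℕ × ℕ) :=
  ((List.range j).filter fun j => ((C.getD j []).map g).sum = 0).map fun j => (2 + j, y)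

theorem clauseEdges_succ (C : List (List ℕ)) (g : ℕ → ℕ) (y : ℕ) {j : ℕ} (hj : j < C.length) :
    clauseEdges C g y (j + 1) =
      clauseEdges C g y j ++ if (C[j].map g).sum = 0 then [(2 + j, y)] else [] := by
  have hget : C.getD j [] = C[j] := List.getD_eq_getElem _ _ hj
  rw [clauseEdges, List.range_succ, List.filter_append, List.map_append, List.filter_singleton, hget]
  by_cases h : (C[j].map g).sum = 0 <;> simp only [h] <;> rfl

theorem length_clauseEdges_le (C : List (List ℕ)) (g : ℕ → ℕ) (y j : ℕ) :
    (clauseEdges C g y j).length ≤ j := by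
  rw [clauseEdges, List.length_map]
  exact (List.length_filter_le _ _).trans List.length_range.le

theorem clauseLoop_wp {I : Env} {n k K H : ℕ} {C : List (List ℕ)} {pos : ℕ → ℕ}
    (h : ClauseInput I n k K H C pos) {L : Fin 32} (hL3 : L ≠ 3) {g : ℕ → ℕ} (hg : ∀ ℓ, g ℓ ≤ 1)
    {s : Store} (hL : ∀ ℓ < 2 * n, s.arr L ℓ = g ℓ) {E : List (ℕ × ℕ)} (hE : Emitted E s)
    (h2 : s.var 2 = C.length) (hK : E.length + C.length ≤ K) :
    (clauseLoop L).Wp I (fun s' => Emitted (E ++ clauseEdges C g (s.var 7) C.length) s' ∧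
      Frame 12 (· = 3) s s' ∧ s'.time ≤ s.time + 100 * ((k + 1) * C.length) + 10) s := by
  have hB := h.bound
  unfold clauseLoop
  simp only [Cmd.wp_seq, Cmd.wp_set]
  refine ⟨by simp; omega, by simp; omega, ?_⟩
  refine Cmd.wp_rep (fun j s' => Emitted (E ++ clauseEdges C g (s.var 7) j) s' ∧
    Frame 12 (· = 3) s s' ∧ s'.var 12 = 2 + pos j ∧ s'.var 22 = 2 + j ∧
      s'.time ≤ s.time + 9 + 100 * ((k + 1) * j)) C.length (by simp) (by simp [h2]) ?_ ?_ ?_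
  · refine ⟨?_, ⟨fun v hv => ?_, fun a _ => rfl⟩, by simp [h.pos_zero], by simp, by simp⟩
    · rw [show clauseEdges C g (s.var 7) 0 = [] from rfl, List.append_nil]
      exact hE.congr (by simp) (by simp) (by simp)
    · simp [show v ≠ 12 by omega, show v ≠ 22 by omega]
  · rintro j hj s' ⟨h1, h2, h3, h4, h5⟩
    rw [Cmd.wp_seq]
    have hLne : s'.arr L = s.arr L := h2.arr L hL3
    refine Cmd.Wp.mono (sumClause_wp h hg (s := s') (by rwa [hLne]) hj h3) ?_
    rintro s₁ ⟨f1, f2, f3, f4, f5⟩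
    have hlen := length_clauseEdges_le C g (s.var 7) j
    have hfr : Frame 12 (· = 3) s s₁ := ⟨fun v hv => by rw [f3 v (Or.inl hv), h2.var v hv],
      fun a ha => by rw [f4, h2.arr a ha]⟩
    have h22 : s₁.var 22 = 2 + j := by rw [f3 22 (by omega), h4]
    have hmul : (k + 1) * (j + 1) = (k + 1) * j + (k + 1) := Nat.mul_succ _ _
    rw [Cmd.wp_seq, Cmd.wp_ite]
    simp only [Expr.Safe, Expr.eval, Expr.cost, true_and]
    rw [clauseEdges_succ C g _ hj, ← f1, ← List.append_assoc]
    generalize clauseEdges C g (s.var 7) j = F at h1 hlen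
    have hem : Emitted (E ++ F) s₁ :=
      h1.congr (by rw [f4]) (f3 20 (by omega)) (f3 21 (by omega))
    refine ⟨fun h0 => ?_, fun h0 => ?_⟩
    · refine Cmd.Wp.mono (emit_wp (E := E ++ F) (hem.congr rfl rfl rfl) (by
        rw [List.length_append]
        omega)) ?_
      rintro s₂ ⟨g1, g2, g3, g4⟩
      simp only [Store.tick_var, Store.tick_time] at g1 g3 g4
      rw [Cmd.wp_set]
      simp only [Expr.Safe, Expr.eval, Expr.cost, true_and, g3, h22]
      refine ⟨⟨by omega, by omega⟩, ?_, ⟨fun v hv => ?_, fun a ha => ?_⟩, ?_, by simp; omega, ?_⟩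
      · have e7 : s₁.var 7 = s.var 7 := hfr.var 7 (by omega)
        rw [h22, e7] at g1
        rw [if_pos h0]
        exact g1.congr (by simp) (by simp) (by simp)
      · simp [show v ≠ 22 by omega]
        rw [g2.var v (by omega)]
        exact hfr.var v hv
      · simp
        rw [g2.arr a ha]
        exact hfr.arr a ha
      · simp
        rw [g2.var 12 (by omega)]
        exact f2
      · simp
        omega
    · rw [Cmd.wp_skip, Cmd.wp_set]
      simp only [Expr.Safe, Expr.eval, Expr.cost, true_and, Store.tick_var, h22]
      refine ⟨⟨by omega, by omega⟩, ?_, ⟨fun v hv => ?_, fun a ha => ?_⟩, ?_, by simp; omega, ?_⟩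
      · rw [if_neg h0, List.append_nil]
        exact hem.congr (by simp) (by simp) (by simp)
      · simp [show v ≠ 22 by omega]
        exact hfr.var v hv
      · simp
        exact hfr.arr a ha
      · simp [f2]
      · simp
        omega
  · rintro s' ⟨h1, h2, h3, h4, h5⟩
    exact ⟨h1.congr rfl rfl rfl, ⟨h2.var, h2.arr⟩, by simp; omega⟩


/-- Array `0` contains halves, and the variables `1`, `2` and `4` the sizes. -/
structure Params (n M H : ℕ) (s : Store) : Prop where
  vars : s.var 1 = n
  count : s.var 2 = M
  side : s.var 4 = H
  half : ∀ x < 2 * H, s.arr 0 x = x / 2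

theorem Params.congr {n M H : ℕ} {s s' : Store} (h : Params n M H s) (h1 : s'.var 1 = s.var 1)
    (h2 : s'.var 2 = s.var 2) (h4 : s'.var 4 = s.var 4) (h0 : s'.arr 0 = s.arr 0) :
    Params n M H s' :=
  ⟨h1.trans h.vars, h2.trans h.count, h4.trans h.side, fun x hx => by rw [h0, h.half x hx]⟩

theorem litVal_le_one (v₀ k a ℓ : ℕ) : litVal v₀ k a ℓ ≤ 1 := by
  unfold litVal
  split_ifs <;> omega

theorem litVal_of_outside {v₀ k a ℓ : ℕ} (h : ℓ / 2 < v₀ ∨ v₀ + k ≤ ℓ / 2) :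
    litVal v₀ k a ℓ = 0 := if_neg (by omega)

/-- Store the values of the literals in the array `L`. The bits of the number in variable `8` are
the values of the variables that start with the one in variable `9`, and there are as many of
them as variable `10` says. -/
def setLiterals (L : Fin 32) : Cmd :=
  .set 13 (.var 8) ;; .set 14 (.var 9) ;;
  .rep (.var 10) (
    .set 15 (.sub (.var 13) (.add (.arr 0 (.var 13)) (.arr 0 (.var 13)))) ;;
    .put L (.add (.add (.var 14) (.var 14)) (.var 15)) (.lit 1) ;;
    .put L (.sub (.add (.add (.var 14) (.var 14)) (.lit 1)) (.var 15)) (.lit 0) ;;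
    .set 13 (.arr 0 (.var 13)) ;; .set 14 (.add (.var 14) (.lit 1)))

/-- Entries of variables outside of the half are assumed to be `0` and stay so, while both literals
of every variable of the half are rewritten. Hence the table can be reused for the next assignment.
-/
theorem setLiterals_wp {I : Env} {L : Fin 32} (hL0 : L ≠ 0) {n M H v₀ m a : ℕ} {s : Store}
    (hp : Params n M H s) (ha : a < H) (h8 : s.var 8 = a) (h9 : s.var 9 = v₀) (h10 : s.var 10 = m)
    (hB : 8 * H + 4 * n + 8 ≤ I.bound) (hm : v₀ + m ≤ n)
    (h0 : ∀ ℓ, ℓ / 2 < v₀ ∨ v₀ + m ≤ ℓ / 2 → s.arr L ℓ = 0) :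
    (setLiterals L).Wp I (fun s' => (∀ ℓ, s'.arr L ℓ = litVal v₀ m a ℓ) ∧
      Frame 12 (· = L) s s' ∧ (∀ v, 20 ≤ v → s'.var v = s.var v) ∧
      s'.time ≤ s.time + 100 * n + 10) s := by
  unfold setLiterals
  simp only [Cmd.wp_seq, Cmd.wp_set]
  refine ⟨trivial, trivial, ?_⟩
  refine Cmd.wp_rep (fun i s' => s'.var 13 = a / 2 ^ i ∧ s'.var 14 = v₀ + i ∧
    (∀ ℓ, ℓ / 2 < v₀ + i → s'.arr L ℓ = litVal v₀ m a ℓ) ∧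
    (∀ ℓ, v₀ + m ≤ ℓ / 2 → s'.arr L ℓ = 0) ∧ Frame 12 (· = L) s s' ∧
    (∀ v, 20 ≤ v → s'.var v = s.var v) ∧ s'.time ≤ s.time + 9 + 100 * i) m (by simp)
    (by simp [h10]) ?_ ?_ ?_
  · refine ⟨by simp [h8], by simp [h9], fun ℓ hℓ => ?_, fun ℓ hℓ => h0 ℓ (Or.inr hℓ),
      ⟨fun v hv => ?_, fun _ _ => rfl⟩, fun v hv => ?_, by simp⟩
    · rw [Nat.add_zero] at hℓ
      rw [litVal_of_outside (Or.inl hℓ)]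
      exact h0 ℓ (Or.inl hℓ)
    · simp [show v ≠ 13 by omega, show v ≠ 14 by omega]
    · simp [show v ≠ 13 by omega, show v ≠ 14 by omega]
  · rintro i hi s' ⟨h1, h2, h3, h4, h5, h6, h7⟩
    have hdiv : a / 2 ^ i ≤ a := Nat.div_le_self _ _
    have hhalf : s'.arr 0 (a / 2 ^ i) = a / 2 ^ i / 2 := by
      rw [h5.arr 0 (fun h => hL0 h.symm)]
      exact hp.half _ (by omega)
    have hnext : a / 2 ^ (i + 1) = a / 2 ^ i / 2 := by
      rw [pow_succ, Nat.div_div_eq_div_mul]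
    -- The lowest bit is the number minus twice its half. Of the two literals `2 v + b` and `2 v + 1
    -- - b`, the first becomes true and the second false.
    obtain ⟨b, hb⟩ : ∃ b, b = a / 2 ^ i - (a / 2 ^ i / 2 + a / 2 ^ i / 2) := ⟨_, rfl⟩
    have hb' : b = a / 2 ^ i % 2 := by omega
    simp only [Cmd.wp_seq, Cmd.wp_set, Cmd.wp_put]
    simp [h1, h2, hhalf, ← hb, hnext, hL0.symm]
    refine ⟨by omega, by omega, by omega, by omega, by omega, fun ℓ hℓ => ?_, fun ℓ hℓ => ?_,
      ⟨fun v hv => ?_, fun c hc => ?_⟩, fun v hv => ?_, by omega⟩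
    · by_cases hlt : ℓ / 2 < v₀ + i
      · rw [Function.update_of_ne (by omega), Function.update_of_ne (by omega), h3 ℓ hlt]
      · have hval : litVal v₀ m a ℓ = if b = ℓ % 2 then 1 else 0 := by
          unfold litVal
          rw [show ℓ / 2 - v₀ = i by omega, ← hb']
          by_cases hbl : b = ℓ % 2
          · rw [if_pos ⟨by omega, by omega, hbl⟩, if_pos hbl]
          · rw [if_neg fun h => hbl h.2.2, if_neg hbl]
        rw [hval]
        by_cases hbl : b = ℓ % 2
        · rw [if_pos hbl, Function.update_of_ne (by omega),
            show ℓ = v₀ + i + (v₀ + i) + b by omega, Function.update_self]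
        · rw [if_neg hbl, show ℓ = v₀ + i + (v₀ + i) + 1 - b by omega, Function.update_self]
    · rw [Function.update_of_ne (by omega), Function.update_of_ne (by omega), h4 ℓ hℓ]
    · simp [show v ≠ 13 by omega, show v ≠ 14 by omega, show v ≠ 15 by omega, h5.var v hv]
    · simp [hc, h5.arr c hc]
    · simp [show v ≠ 13 by omega, show v ≠ 14 by omega, show v ≠ 15 by omega, h6 v hv]
  · rintro s' ⟨h1, h2, h3, h4, h5, h6, h7⟩
    refine ⟨fun ℓ => ?_, ⟨h5.var, h5.arr⟩, h6, by simp only [Store.tick_time]; omega⟩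
    rcases Nat.lt_or_ge (ℓ / 2) (v₀ + m) with h | h
    · exact h3 ℓ h
    · rw [litVal_of_outside (Or.inr h)]
      exact h4 ℓ h

/-- Emit the edges of all partial assignments of one half of the variables; `t` is the vertex to
which they are joined. -/
def sideLoop (L : Fin 32) (t : ℕ) : Cmd :=
  .set 8 (.lit 0) ;;
  .rep (.var 4) (setLiterals L ;; .set 22 (.lit t) ;; emit ;; clauseLoop L ;;
    .set 7 (.add (.var 7) (.lit 1)) ;; .set 8 (.add (.var 8) (.lit 1)))

theorem length_sideEdges_le (C : List (List ℕ)) (f : List ℕ → ℕ) (t y : ℕ) :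
    (sideEdges C f t y).length ≤ C.length + 1 := by
  rw [sideEdges, List.length_cons, List.length_map]
  have := List.length_filter_le (fun j => decide (f (C.getD j []) = 0)) (List.range C.length)
  rw [List.length_range] at this
  omega

theorem length_flatMap_sideEdges_le (C : List (List ℕ)) (f : ℕ → List ℕ → ℕ) (t y i : ℕ) :
    ((List.range i).flatMap fun a => sideEdges C (f a) t (y + a)).length ≤ i * (C.length + 1) := by
  induction i with
  | zero => simp
  | succ i ih =>
    rw [List.range_succ, List.flatMap_append, List.length_append, Nat.succ_mul]
    have := length_sideEdges_le C (f i) t (y + i)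
    simp only [List.flatMap_cons, List.flatMap_nil, List.append_nil]
    omega

/-- Variable `8` runs through the assignments and variable `7` through their vertices. The literal
table must vanish outside of the half at the start, which each round preserves. -/
theorem sideLoop_wp {I : Env} {n k K H : ℕ} {C : List (List ℕ)} {pos : ℕ → ℕ}
    (h : ClauseInput I n k K H C pos) {L : Fin 32} (hL0 : L ≠ 0) (hL3 : L ≠ 3) {t v₀ m y : ℕ}
    (ht : t < 2) {s : Store} (hp : Params n C.length H s) {E : List (ℕ × ℕ)} (hE : Emitted E s)
    (h7 : s.var 7 = y) (h9 : s.var 9 = v₀) (h10 : s.var 10 = m) (hm : v₀ + m ≤ n)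
    (h0 : ∀ ℓ, ℓ / 2 < v₀ ∨ v₀ + m ≤ ℓ / 2 → s.arr L ℓ = 0) (hy : y ≤ C.length + 2 + H)
    (hK : E.length + H * (C.length + 1) ≤ K) :
    (sideLoop L t).Wp I (fun s' => Params n C.length H s' ∧
      Emitted (E ++ (List.range H).flatMap fun a => sideEdges C (clauseVal v₀ m a) t (y + a)) s' ∧
      s'.var 7 = y + H ∧ Frame 7 (fun a => a = L ∨ a = 3) s s' ∧
      s'.time ≤ s.time + (100 * n + 100 * ((k + 1) * C.length) + 100) * H + 10) s := by
  have hB := h.bound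
  unfold sideLoop
  simp only [Cmd.wp_seq, Cmd.wp_set]
  refine ⟨by simp; omega, ?_⟩
  refine Cmd.wp_rep (fun i s' =>
    Emitted (E ++ (List.range i).flatMap fun a => sideEdges C (clauseVal v₀ m a) t (y + a)) s' ∧
    s'.var 7 = y + i ∧ s'.var 8 = i ∧ s'.var 9 = v₀ ∧ s'.var 10 = m ∧
    (∀ ℓ, ℓ / 2 < v₀ ∨ v₀ + m ≤ ℓ / 2 → s'.arr L ℓ = 0) ∧
    Frame 7 (fun a => a = L ∨ a = 3) s s' ∧
    s'.time ≤ s.time + 9 + (100 * n + 100 * ((k + 1) * C.length) + 100) * i) H (by simp)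
    (by simp [hp.side]) ?_ ?_ ?_
  · refine ⟨?_, by simp [h7], by simp, by simp [h9], by simp [h10], h0,
      ⟨fun v hv => ?_, fun _ _ => rfl⟩, by simp⟩
    · rw [List.range_zero, List.flatMap_nil, List.append_nil]
      exact hE.congr (by simp) (by simp) (by simp)
    · simp [show v ≠ 8 by omega]
  · rintro i hi s₁ ⟨f1, f2, f3, f4, f5, f6, f7, f8⟩
    have hp1 : Params n C.length H s₁ := hp.congr (f7.var 1 (by omega)) (f7.var 2 (by omega))
      (f7.var 4 (by omega)) (f7.arr 0 (by rintro (h | h); exacts [hL0 h.symm, by simp at h]))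
    rw [Cmd.wp_seq]
    refine Cmd.Wp.mono (setLiterals_wp (I := I) hL0 hp1 hi f3 f4 f5 (by omega) hm f6) ?_
    rintro s₂ ⟨g1, g2, g3, g4⟩
    have hlen := length_flatMap_sideEdges_le C (clauseVal v₀ m) t y i
    have hmul : i * (C.length + 1) + (C.length + 1) ≤ H * (C.length + 1) := by
      rw [← Nat.succ_mul]
      exact Nat.mul_le_mul_right _ hi
    rw [List.range_succ, List.flatMap_append, ← List.append_assoc, List.flatMap_singleton]
    have hside : sideEdges C (clauseVal v₀ m i) t (y + i) =
        [(t, y + i)] ++ clauseEdges C (litVal v₀ m i) (y + i) C.length := rfl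
    rw [hside, ← List.append_assoc]
    generalize ((List.range i).flatMap fun a => sideEdges C (clauseVal v₀ m a) t (y + a)) = F
      at f1 hlen
    rw [Cmd.wp_seq, Cmd.wp_set, Cmd.wp_seq]
    refine ⟨by simp only [Expr.Safe]; omega, ?_⟩
    have hem : Emitted (E ++ F) s₂ :=
      f1.congr (g2.arr 3 fun h => hL3 h.symm) (g3 20 (by omega)) (g3 21 (by omega))
    refine Cmd.Wp.mono (emit_wp (E := E ++ F) (hem.congr (by simp) (by simp) (by simp)) (by
      rw [List.length_append]
      omega)) ?_
    rintro s₃ ⟨k1, k2, k3, k4⟩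
    have e7 : s₂.var 7 = y + i := by rw [g2.var 7 (by omega), f2]
    simp [e7] at k1 k3 k4
    rw [Cmd.wp_seq]
    have k7 : s₃.var 7 = y + i := by
      rw [k2.var 7 (by omega)]
      simp [e7]
    have kL : s₃.arr L = s₂.arr L := by
      rw [k2.arr L hL3]
      simp
    refine Cmd.Wp.mono (clauseLoop_wp h hL3 (g := litVal v₀ m i) (litVal_le_one _ _ _) (s := s₃)
      (fun ℓ _ => by rw [kL, g1]) (E := E ++ F ++ [(t, y + i)]) (by simpa using k1) ?_ ?_) ?_
    · rw [k2.var 2 (by omega)]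
      simp
      rw [g2.var 2 (by omega)]
      exact hp1.count
    · simp only [List.length_append, List.length_singleton]
      omega
    rintro s₄ ⟨m1, m2, m3⟩
    rw [k7] at m1
    have v7 : s₄.var 7 = y + i := by rw [m2.var 7 (by omega), k7]
    have hvar : ∀ v < 12, s₄.var v = s₁.var v := by
      intro v hv
      rw [m2.var v hv, k2.var v (by omega)]
      simp [show v ≠ 22 by omega]
      exact g2.var v hv
    have harr : ∀ a, ¬ (a = L ∨ a = 3) → s₄.arr a = s₁.arr a := by
      intro a ha
      push Not at ha
      rw [m2.arr a ha.2, k2.arr a ha.2]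
      simp
      exact g2.arr a ha.1
    simp only [Cmd.wp_seq, Cmd.wp_set]
    simp [v7, hvar 8, f3, hvar 9, f4, hvar 10, f5]
    refine ⟨by omega, by omega, ?_, by omega, fun ℓ hℓ => ?_, ⟨fun v hv => ?_, fun a ha => ?_⟩, ?_⟩
    · refine Emitted.congr (s := s₄) ?_ (by simp) (by simp) (by simp)
      simpa using m1
    · rw [m2.arr L hL3, kL, g1, litVal_of_outside hℓ]
    · simp [show v ≠ 7 by omega, show v ≠ 8 by omega]
      rw [hvar v (by omega), f7.var v hv]
    · simp
      rw [harr a ha, f7.arr a ha]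
    · rw [Nat.mul_succ]
      omega
  · rintro s' ⟨f1, f2, f3, f4, f5, f6, f7, f8⟩
    exact ⟨hp.congr (f7.var 1 (by omega)) (f7.var 2 (by omega)) (f7.var 4 (by omega))
      (f7.arr 0 (by rintro (h | h); exacts [hL0 h.symm, by simp at h])), f1.congr rfl rfl rfl, f2,
      ⟨f7.var, f7.arr⟩, by simp only [Store.tick_time]; omega⟩


/-- Emit the edges of the clique. -/
def cliqueLoop : Cmd :=
  .set 7 (.lit 0) ;;
  .rep (.add (.var 2) (.lit 2)) (.set 22 (.lit 0) ;;
    .rep (.var 7) (emit ;; .set 22 (.add (.var 22) (.lit 1))) ;; .set 7 (.add (.var 7) (.lit 1)))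

theorem cliqueEdges_succ (k : ℕ) :
    cliqueEdges (k + 1) = cliqueEdges k ++ (List.range k).map fun x => (x, k) := by
  rw [cliqueEdges, List.range_succ, List.flatMap_append, List.flatMap_singleton]
  rfl

theorem length_cliqueEdges_le (k : ℕ) : (cliqueEdges k).length ≤ k * k := by
  induction k with
  | zero => simp [cliqueEdges]
  | succ k ih =>
    rw [cliqueEdges_succ, List.length_append, List.length_map, List.length_range]
    have : (k + 1) * (k + 1) = k * k + 2 * k + 1 := by ring
    omega

theorem cliqueLoop_wp {I : Env} {M K : ℕ} {s : Store} (hE : Emitted [] s) (h2 : s.var 2 = M)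
    (hK : (M + 2) * (M + 2) ≤ K) (hB : 2 * K + M + 8 ≤ I.bound) :
    cliqueLoop.Wp I (fun s' => Emitted (cliqueEdges (M + 2)) s' ∧ s'.var 7 = M + 2 ∧
      Frame 7 (· = 3) s s' ∧ s'.time ≤ s.time + (40 * (M + 2) + 40) * (M + 2) + 10) s := by
  unfold cliqueLoop
  simp only [Cmd.wp_seq, Cmd.wp_set]
  refine ⟨by simp; omega, ?_⟩
  refine Cmd.wp_rep (fun y s' => Emitted (cliqueEdges y) s' ∧ s'.var 7 = y ∧ Frame 7 (· = 3) s s' ∧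
    s'.time ≤ s.time + 9 + (40 * (M + 2) + 40) * y) (M + 2) (by simp [h2]; omega) (by simp [h2])
    ?_ ?_ ?_
  · refine ⟨hE.congr (by simp) (by simp) (by simp), by simp, ⟨fun v hv => ?_, fun _ _ => rfl⟩,
      by simp⟩
    simp [show v ≠ 7 by omega]
  · rintro y hy s₁ ⟨f1, f2, f3, f4⟩
    have hlen := length_cliqueEdges_le y
    have hle : y * (y + 1) ≤ (M + 2) * (M + 2) := Nat.mul_le_mul (by omega) (by omega)
    rw [Nat.mul_succ] at hle
    simp only [Cmd.wp_seq, Cmd.wp_set]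
    refine ⟨by simp; omega, ?_⟩
    refine Cmd.wp_rep (fun x s' => Emitted (cliqueEdges y ++ (List.range x).map fun x => (x, y)) s' ∧
      s'.var 22 = x ∧ s'.var 7 = y ∧ Frame 7 (· = 3) s s' ∧
      s'.time ≤ s₁.time + 5 + 40 * x) y (by simp) (by simp [f2]) ?_ ?_ ?_
    · refine ⟨?_, by simp, by simp [f2], ⟨fun v hv => ?_, f3.arr⟩, by simp⟩
      · rw [List.range_zero, List.map_nil, List.append_nil]
        exact f1.congr (by simp) (by simp) (by simp)
      · simp [show v ≠ 22 by omega, f3.var v hv]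
    · rintro x hx s₂ ⟨g1, g2, g3, g4, g5⟩
      rw [Cmd.wp_seq]
      refine Cmd.Wp.mono (emit_wp g1 (by
        rw [List.length_append, List.length_map, List.length_range]
        omega)) ?_
      rintro s₃ ⟨k1, k2, k3, k4⟩
      rw [g2, g3] at k1
      rw [g2] at k3
      have k7 := k2.var 7 (by omega)
      rw [Cmd.wp_set]
      simp [k3]
      refine ⟨by omega, ?_, by rw [k7, g3], ⟨fun v hv => ?_, fun a ha => ?_⟩, by omega⟩
      · rw [List.range_succ, List.map_append, ← List.append_assoc]
        exact k1.congr (by simp) (by simp) (by simp)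
      · simp [show v ≠ 22 by omega]
        rw [k2.var v (by omega), g4.var v hv]
      · simp
        rw [k2.arr a ha, g4.arr a ha]
    · rintro s₂ ⟨g1, g2, g3, g4, g5⟩
      simp [g3]
      refine ⟨⟨by omega, by omega⟩, ?_, ⟨fun v hv => ?_, fun a ha => ?_⟩, ?_⟩
      · rw [cliqueEdges_succ]
        exact g1.congr (by simp) (by simp) (by simp)
      · simp [show v ≠ 7 by omega, g4.var v hv]
      · simp
        exact g4.arr a ha
      · rw [Nat.mul_succ]
        omega
  · rintro s' ⟨f1, f2, f3, f4⟩
    exact ⟨f1.congr rfl rfl rfl, f2, ⟨f3.var, f3.arr⟩, by simp only [Store.tick_time]; omega⟩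

/-- Read the sizes, compute `(n + 1) / 2` and `2 ^ ((n + 1) / 2)` in the variables `3` and `4`, and
store halves in the array `0`. -/
def setup : Cmd :=
  .set 1 (.inp (.lit 0)) ;; .set 2 (.inp (.lit 1)) ;; .set 3 (.lit 0) ;; .set 4 (.lit 1) ;;
  .set 5 (.lit 0) ;; .set 6 (.lit 0) ;; .set 20 (.lit 2) ;; .set 21 (.lit 0) ;;
  .rep (.var 1) (.ite (.var 5) (.set 5 (.lit 0))
    (.set 5 (.lit 1) ;; .set 3 (.add (.var 3) (.lit 1)) ;; .set 4 (.add (.var 4) (.var 4)))) ;;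
  .rep (.var 4) (.put 0 (.add (.var 6) (.var 6)) (.var 6) ;;
    .put 0 (.add (.add (.var 6) (.var 6)) (.lit 1)) (.var 6) ;; .set 6 (.add (.var 6) (.lit 1)))

/-- Variable `5` is the parity of the number of rounds; every other round, starting with the first
one, increases the exponent and doubles the power. This gives `(n + 1) / 2` without a division.
Halving is tabulated for the same reason. -/
theorem setup_wp {I : Env} {n k K : ℕ} {C : List (List ℕ)} {pos : ℕ → ℕ}
    (h : ClauseInput I n k K (2 ^ ((n + 1) / 2)) C pos) {s : Store} (hs : ∀ a i, s.arr a i = 0) :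
    setup.Wp I (fun s' => Params n C.length (2 ^ ((n + 1) / 2)) s' ∧ s'.var 3 = (n + 1) / 2 ∧
      Emitted [] s' ∧ (∀ a, a ≠ 0 → ∀ i, s'.arr a i = 0) ∧
      s'.time ≤ s.time + 100 * n + 100 * 2 ^ ((n + 1) / 2) + 50) s := by
  have hB := h.bound
  have hpos := h.pos_le 0 (by omega)
  unfold setup
  simp only [Cmd.wp_seq, Cmd.wp_set]
  simp [h.vars, h.count]
  refine ⟨⟨by omega, by omega⟩, ⟨by omega, by omega⟩, by omega, by omega, by omega, by omega,
    by omega, ?_⟩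
  refine Cmd.wp_rep (fun j s' => s'.var 1 = n ∧ s'.var 2 = C.length ∧ s'.var 3 = (j + 1) / 2 ∧
    s'.var 4 = 2 ^ ((j + 1) / 2) ∧ s'.var 5 = j % 2 ∧ s'.var 6 = 0 ∧ s'.var 20 = 2 ∧ s'.var 21 = 0 ∧
    s'.arr = s.arr ∧ s'.time ≤ s.time + 40 + 50 * j) n (by simp) (by simp) ?_ ?_ ?_
  · simp
  · rintro j hj s' ⟨h1, h2, h3, h4, h5, h6, h7, h8, h9, h10⟩
    rw [Cmd.wp_ite]
    refine ⟨trivial, fun h0 => ?_, fun h0 => ?_⟩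
    · simp only [Expr.eval, h5] at h0
      have e1 : (j + 1 + 1) / 2 = (j + 1) / 2 + 1 := by omega
      have hpow : 2 ^ ((j + 1) / 2 + 1) ≤ 2 ^ ((n + 1) / 2) :=
        Nat.pow_le_pow_right (by omega) (by omega)
      rw [pow_succ] at hpow
      simp only [Cmd.wp_seq, Cmd.wp_set]
      simp [h1, h2, h3, h4, h6, h7, h8, h9, e1, pow_succ]
      refine ⟨by omega, by omega, by omega, by omega, by omega, by omega⟩
    · simp only [Expr.eval, h5] at h0
      have e1 : (j + 1 + 1) / 2 = (j + 1) / 2 := by omega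
      simp only [Cmd.wp_set]
      simp [h1, h2, h3, h4, h6, h7, h8, h9, e1]
      refine ⟨by omega, by omega, by omega⟩
  · rintro s₁ ⟨h1, h2, h3, h4, h5, h6, h7, h8, h9, h10⟩
    generalize hH : 2 ^ ((n + 1) / 2) = H at h4 hB ⊢
    refine Cmd.wp_rep (fun j s' => (∀ v, v ≠ 6 → s'.var v = s₁.var v) ∧ s'.var 6 = j ∧
      (∀ x < 2 * j, s'.arr 0 x = x / 2) ∧ (∀ a, a ≠ 0 → s'.arr a = s.arr a) ∧
      s'.time ≤ s₁.time + 5 + 50 * j) H (by simp) (by simp [h4]) ?_ ?_ ?_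
    · simp [h6, h9]
    · rintro j hj s' ⟨g1, g2, g3, g4, g5⟩
      simp only [Cmd.wp_seq, Cmd.wp_set, Cmd.wp_put]
      simp [g2]
      refine ⟨by omega, ⟨by omega, by omega, by omega⟩, by omega, fun v hv => ?_, fun x hx => ?_,
        fun a ha => ?_, by omega⟩
      · simp [hv, g1 v hv]
      · by_cases e1 : x = j + j + 1
        · rw [e1, Function.update_self]
          omega
        · rw [Function.update_of_ne e1]
          by_cases e2 : x = j + j
          · rw [e2, Function.update_self]
            omega
          · rw [Function.update_of_ne e2]
            exact g3 x (by omega)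
      · simp [ha, g4 a ha]
    · rintro s' ⟨g1, g2, g3, g4, g5⟩
      refine ⟨⟨?_, ?_, ?_, g3⟩, ?_, ⟨?_, ?_, ?_⟩, fun a ha i => ?_, ?_⟩
      · simp [g1 1, h1]
      · simp [g1 2, h2]
      · simp [g1 4, h4]
      · simp [g1 3, h3]
      · simp only [Store.tick_arr]
        rw [g4 3 (by decide)]
        ext i
        rw [hs]
        rcases i with _ | _ | i <;> simp
      · simp [g1 20, h7]
      · simp [g1 21, h8]
      · simp only [Store.tick_arr]
        rw [g4 a ha, hs]
      · simp only [Store.tick_time]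
        omega

/-- Write the graph of the formula in the input to the array `3`. -/
def reduce : Cmd :=
  setup ;; cliqueLoop ;; .set 9 (.lit 0) ;; .set 10 (.var 3) ;; sideLoop 1 0 ;;
  .set 9 (.var 3) ;; .set 10 (.sub (.var 1) (.var 3)) ;; sideLoop 2 1 ;;
  .put 3 (.lit 0) (.var 7) ;; .put 3 (.lit 1) (.var 21)

theorem reduce_wp {I : Env} {n k K : ℕ} {C : List (List ℕ)} {pos : ℕ → ℕ}
    (h : ClauseInput I n k K (2 ^ ((n + 1) / 2)) C pos)
    (hK : (C.length + 2) * (C.length + 2) + 2 * (2 ^ ((n + 1) / 2) * (C.length + 1)) ≤ K)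
    {s : Store} (hs : ∀ a i, s.arr a i = 0) :
    reduce.Wp I (fun s' => s'.arr 3 = (fun i => (reductionGraph n C).code.getD i 0) ∧
      s'.time ≤ s.time + 100 * n + 100 * 2 ^ ((n + 1) / 2) +
        (40 * (C.length + 2) + 40) * (C.length + 2) +
        2 * ((100 * n + 100 * ((k + 1) * C.length) + 100) * 2 ^ ((n + 1) / 2)) + 200) s := by
  have hB := h.bound
  have hcode : (reductionGraph n C).code = (C.length + 2 + 2 * 2 ^ ((n + 1) / 2)) ::
      (reductionEdges n C).length :: (reductionEdges n C).flatMap fun e => [e.1, e.2] := by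
    rw [GraphInput.code_eq, reductionGraph, GraphInput.pairs_ofPairs]
    rfl
  have hedges : reductionEdges n C = cliqueEdges (C.length + 2) ++
    ((List.range (2 ^ ((n + 1) / 2))).flatMap fun a =>
      sideEdges C (clauseVal 0 ((n + 1) / 2) a) 0 (C.length + 2 + a)) ++
    ((List.range (2 ^ ((n + 1) / 2))).flatMap fun a =>
      sideEdges C (clauseVal ((n + 1) / 2) (n - (n + 1) / 2) a) 1
        (C.length + 2 + 2 ^ ((n + 1) / 2) + a)) := rfl
  rw [hcode, hedges]
  have e1 := length_cliqueEdges_le (C.length + 2)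
  have e2 := length_flatMap_sideEdges_le C (clauseVal 0 ((n + 1) / 2)) 0 (C.length + 2)
    (2 ^ ((n + 1) / 2))
  unfold reduce
  rw [Cmd.wp_seq]
  refine Cmd.Wp.mono (setup_wp h hs) ?_
  clear hcode hedges
  rintro s₁ ⟨f1, f2, f3, f4, f5⟩
  generalize 2 ^ ((n + 1) / 2) = H at *
  rw [Cmd.wp_seq]
  refine Cmd.Wp.mono (cliqueLoop_wp f3 f1.count (K := K) (by omega) (by omega)) ?_
  rintro s₂ ⟨g1, g2, g3, g4⟩
  have hp2 : Params n C.length H s₂ := f1.congr (g3.var 1 (by omega)) (g3.var 2 (by omega))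
    (g3.var 4 (by omega)) (g3.arr 0 (by decide))
  have g33 : s₂.var 3 = (n + 1) / 2 := by rw [g3.var 3 (by omega), f2]
  simp only [Cmd.wp_seq, Cmd.wp_set]
  refine ⟨by simp only [Expr.Safe]; omega, trivial, ?_⟩
  refine Cmd.Wp.mono (sideLoop_wp h (L := 1) (by decide) (by decide) (t := 0) (v₀ := 0)
    (m := (n + 1) / 2) (y := C.length + 2) (by omega) (hp2.congr (by simp) (by simp) (by simp) (by simp))
    (E := cliqueEdges (C.length + 2)) (g1.congr (by simp) (by simp) (by simp)) (by simp [g2]) (by simp)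
    (by simp [g33]) (by omega) (fun ℓ _ => ?_) (by omega) (by omega)) ?_
  · simp
    rw [g3.arr 1 (by decide), f4 1 (by decide)]
  rintro s₃ ⟨k1, k2, k3, k4, k5⟩
  have k33 : s₃.var 3 = (n + 1) / 2 := by
    rw [k4.var 3 (by omega)]
    simp [g33]
  simp only [Cmd.wp_seq, Cmd.wp_set]
  refine ⟨trivial, ⟨trivial, trivial⟩, ?_⟩
  -- The second half uses a fresh table, which is still zero; the first table contains values of the
  -- last assignment of the first half.
  refine Cmd.Wp.mono (sideLoop_wp h (L := 2) (by decide) (by decide) (t := 1) (v₀ := (n + 1) / 2)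
    (m := n - (n + 1) / 2) (y := C.length + 2 + H) (by omega)
    (k1.congr (by simp) (by simp) (by simp) (by simp))
    (E := cliqueEdges (C.length + 2) ++ _) (k2.congr (by simp) (by simp) (by simp)) (by simp [k3])
    (by simp [k33]) (by simp [k33, k1.vars]) (by omega) (fun ℓ _ => ?_) (by omega) ?_) ?_
  · simp
    rw [k4.arr 2 (by decide)]
    simp
    rw [g3.arr 2 (by decide), f4 2 (by decide)]
  · rw [List.length_append]
    omega
  rintro s₄ ⟨m1, m2, m3, m4, m5⟩
  simp only [Cmd.wp_put, Cmd.wp_seq]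
  simp [m3]
  refine ⟨by omega, by omega, ?_, ?_⟩
  · rw [m2.out, m2.count]
    ext i
    rcases i with _ | _ | i
    · simp
      omega
    · simp
    · simp
  · simp at k5 m5
    omega


/-! ### The encoding of formulas and estimates of size and time. -/

theorem getD_flatMap_append {α : Type*} (f : α → List ℕ) (L : List α) {j : ℕ} (hj : j < L.length)
    {i : ℕ} (hi : i < (f L[j]).length) :
    (L.flatMap f).getD (((L.take j).flatMap f).length + i) 0 = (f L[j])[i] := by
  have h : L.flatMap f = (L.take j).flatMap f ++ (f L[j] ++ (L.drop (j + 1)).flatMap f) := by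
    conv_lhs => rw [← List.take_append_drop j L, List.drop_eq_getElem_cons hj]
    rw [List.flatMap_append, List.flatMap_cons]
  rw [h, List.getD_append_right _ _ _ _ (Nat.le_add_right _ _), Nat.add_sub_cancel_left,
    List.getD_append _ _ _ _ hi, List.getD_eq_getElem _ _ hi]

/-- The position of the clause `j` in the encoding of the clauses. -/
def clausePos (C : List (List ℕ)) (j : ℕ) : ℕ :=
  ((C.take j).flatMap fun cl => cl.length :: cl).length

theorem KCNF.code_eq {k : ℕ} (φ : KCNF k) :
    φ.code = φ.vars :: φ.lists.length :: φ.lists.flatMap fun cl => cl.length :: cl := by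
  simp [code, lists, List.flatMap_map]

theorem KCNF.length_lists {k : ℕ} (φ : KCNF k) : φ.lists.length = φ.clauses.length :=
  List.length_map _

/-- A clause of width at most `k` is determined by its `k` entries, each of which is one of `2 n`
literals or missing. As clauses are not repeated, their number is polynomial in `n` for fixed `k`.
-/
theorem KCNF.length_lists_le {k : ℕ} (φ : KCNF k) : φ.lists.length ≤ (2 * φ.vars + 1) ^ k := by
  rw [φ.length_lists, ← List.toFinset_card_of_nodup φ.nodup]
  have hinj : Set.InjOn (fun (cl : List (Fin φ.vars × Bool)) (i : Fin k) => cl[i.val]?)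
      (φ.clauses.toFinset : Set _) := by
    intro a ha b hb hab
    have ha' := φ.width a (by simpa using ha)
    have hb' := φ.width b (by simpa using hb)
    refine List.ext_getElem? fun i => ?_
    rcases Nat.lt_or_ge i k with hi | hi
    · exact congrFun hab ⟨i, hi⟩
    · rw [List.getElem?_eq_none (ha'.trans hi), List.getElem?_eq_none (hb'.trans hi)]
  have := Finset.card_le_card_of_injOn _ (fun a _ => Finset.mem_coe.2 (Finset.mem_univ _)) hinj
  rwa [Finset.card_univ, Fintype.card_fun, Fintype.card_option, Fintype.card_prod, Fintype.card_fin,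
    Fintype.card_fin, Fintype.card_bool, Nat.mul_comm] at this

theorem KCNF.length_le_of_mem_lists {k : ℕ} (φ : KCNF k) : ∀ cl ∈ φ.lists, cl.length ≤ k := by
  intro cl hcl
  obtain ⟨c, hc, rfl⟩ := List.mem_map.1 hcl
  rw [List.length_map]
  exact φ.width c hc

theorem KCNF.lt_of_mem_lists {k : ℕ} (φ : KCNF k) : ∀ cl ∈ φ.lists, ∀ ℓ ∈ cl, ℓ < 2 * φ.vars := by
  intro cl hcl ℓ hℓ
  obtain ⟨c, -, rfl⟩ := List.mem_map.1 hcl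
  obtain ⟨l, -, rfl⟩ := List.mem_map.1 hℓ
  have := l.1.isLt
  have := Bool.toNat_lt l.2
  omega

theorem length_flatMap_cons_le {k : ℕ} (C : List (List ℕ)) (h : ∀ cl ∈ C, cl.length ≤ k) :
    (C.flatMap fun cl => cl.length :: cl).length ≤ (k + 1) * C.length := by
  rw [List.length_flatMap, Nat.mul_comm, ← List.length_map (as := C) fun cl => (cl.length :: cl).length,
    ← smul_eq_mul]
  refine List.sum_le_card_nsmul _ _ fun x hx => ?_
  obtain ⟨cl, hcl, rfl⟩ := List.mem_map.1 hx
  simpa using h cl hcl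

/-- An upper bound for the number of edges of the graph of a formula. -/
def KCNF.edgeBound {k : ℕ} (φ : KCNF k) : ℕ :=
  (φ.lists.length + 2) * (φ.lists.length + 2) +
    2 * (2 ^ ((φ.vars + 1) / 2) * (φ.lists.length + 1))

theorem KCNF.length_reductionEdges_le {k : ℕ} (φ : KCNF k) :
    (reductionEdges φ.vars φ.lists).length ≤ φ.edgeBound := by
  have e1 := length_cliqueEdges_le (φ.lists.length + 2)
  have e2 := fun v₀ m t y => length_flatMap_sideEdges_le φ.lists (clauseVal v₀ m) t y
    (2 ^ ((φ.vars + 1) / 2))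
  rw [reductionEdges, List.length_append, List.length_append, edgeBound]
  have e3 := e2 0 ((φ.vars + 1) / 2) 0 (φ.lists.length + 2)
  have e4 := e2 ((φ.vars + 1) / 2) (φ.vars - (φ.vars + 1) / 2) 1
    (φ.lists.length + 2 + 2 ^ ((φ.vars + 1) / 2))
  omega

/-- The bound on the entries of the store in the reduction. -/
def KCNF.wordBound {k : ℕ} (φ : KCNF k) : ℕ :=
  2 * φ.edgeBound + (k + 3) * φ.lists.length + 8 * 2 ^ ((φ.vars + 1) / 2) + 4 * φ.vars + 2 * k + 32

theorem KCNF.getD_code_lt {k : ℕ} (φ : KCNF k) (i : ℕ) : φ.code.getD i 0 < φ.wordBound := by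
  have hM : φ.lists.length ≤ (k + 3) * φ.lists.length := Nat.le_mul_of_pos_left _ (by omega)
  by_cases hi : i < φ.code.length
  · rw [List.getD_eq_getElem _ _ hi]
    have hmem := List.getElem_mem hi
    generalize φ.code[i] = v at hmem ⊢
    rw [φ.code_eq] at hmem
    unfold wordBound
    simp only [List.mem_cons, List.mem_flatMap] at hmem
    rcases hmem with rfl | rfl | ⟨cl, hcl, rfl | hv⟩
    · omega
    · omega
    · have := φ.length_le_of_mem_lists cl hcl
      omega
    · have := φ.lt_of_mem_lists cl hcl v hv
      omega
  · rw [List.getD_eq_default _ _ (by omega)]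
    unfold wordBound
    omega

def KCNF.env {k : ℕ} (φ : KCNF k) : Env where
  inp i := φ.code.getD i 0
  len := 2 + (k + 1) * φ.lists.length
  bound := φ.wordBound
  inp_lt := φ.getD_code_lt

theorem KCNF.clauseInput {k : ℕ} (φ : KCNF k) :
    ClauseInput φ.env φ.vars k φ.edgeBound (2 ^ ((φ.vars + 1) / 2)) φ.lists
      (clausePos φ.lists) where
  vars := by simp [env, φ.code_eq]
  count := by simp [env, φ.code_eq]
  pos_zero := rfl
  pos_succ j h := by
    rw [clausePos, clausePos, List.take_succ_eq_append_getElem h, List.flatMap_append,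
      List.length_append]
    simp
    omega
  length_eq j h := by
    have := getD_flatMap_append (fun cl : List ℕ => cl.length :: cl) φ.lists h (i := 0) (by simp)
    simp only [env, φ.code_eq, Nat.add_comm 2, List.getD_cons_succ]
    exact this
  lit_eq j h i hi := by
    have := getD_flatMap_append (fun cl : List ℕ => cl.length :: cl) φ.lists h (i := i + 1)
      (by simpa using hi)
    rw [show 2 + clausePos φ.lists j + 1 + i = clausePos φ.lists j + (i + 1) + 1 + 1 by omega]
    simp only [env, φ.code_eq, List.getD_cons_succ]
    exact this
  width := φ.length_le_of_mem_lists
  lit_lt := φ.lt_of_mem_lists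
  pos_le j hj := by
    have := length_flatMap_cons_le (φ.lists.take j)
      fun cl hcl => φ.length_le_of_mem_lists cl (List.mem_of_mem_take hcl)
    rw [List.length_take, Nat.min_eq_left hj] at this
    have h2 := Nat.mul_le_mul_left (k + 1) hj
    unfold clausePos
    simp only [env]
    omega
  len := by
    simp only [env, wordBound]
    have : (k + 3) * φ.lists.length = (k + 1) * φ.lists.length + 2 * φ.lists.length := by ring
    omega
  bound := by
    simp only [env, wordBound]
    have : (k + 3) * φ.lists.length = (k + 1) * φ.lists.length + 2 * φ.lists.length := by ring
    omega

theorem KCNF.length_code_le {k : ℕ} (φ : KCNF k) : φ.code.length ≤ φ.env.len := by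
  have := length_flatMap_cons_le φ.lists φ.length_le_of_mem_lists
  simp only [φ.code_eq, env, List.length_cons]
  omega

/-- A common upper bound, up to a constant factor, for the running time of the reduction, the
size of the graph and the lengths of the words. -/
def sizeBound (k n : ℕ) : ℕ :=
  10000 * (k + 1) * 4 ^ k * (n + 1) ^ (2 * k + 1) * 2 ^ ((n + 1) / 2)

/-- The quantity that is squared, `2 ^ k * (n + 1) ^ k`, is the bound on the number of clauses. -/
theorem sizeBound_eq (k n : ℕ) : sizeBound k n =
    10000 * ((k + 1) * ((n + 1) * (2 ^ k * (n + 1) ^ k) ^ 2 * 2 ^ ((n + 1) / 2))) := by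
  rw [sizeBound, show (4 : ℕ) = 2 ^ 2 by norm_num, ← pow_mul, pow_succ (n + 1), pow_mul' (n + 1),
    pow_mul 2 2 k, mul_pow, ← pow_mul 2 k, pow_mul' 2 k 2]
  ring


theorem KCNF.bounds {k : ℕ} (φ : KCNF k) :
    (reductionGraph φ.vars φ.lists).size ≤ sizeBound k φ.vars ∧
    φ.env.len + 32 * φ.env.bound + 32 ≤ sizeBound k φ.vars ∧
    3 + (k + 1) + 100 * φ.vars + 100 * 2 ^ ((φ.vars + 1) / 2) +
      (40 * (φ.lists.length + 2) + 40) * (φ.lists.length + 2) +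
      2 * ((100 * φ.vars + 100 * ((k + 1) * φ.lists.length) + 100) * 2 ^ ((φ.vars + 1) / 2)) +
      200 ≤ sizeBound k φ.vars := by
  have hedges := φ.length_reductionEdges_le
  have hsize : (reductionGraph φ.vars φ.lists).size =
      φ.lists.length + 2 + 2 * 2 ^ ((φ.vars + 1) / 2) + (reductionEdges φ.vars φ.lists).length := by
    simp [GraphInput.size, reductionGraph, GraphInput.ofPairs]
  have hM : φ.lists.length ≤ 2 ^ k * (φ.vars + 1) ^ k := by
    rw [← mul_pow]
    exact φ.length_lists_le.trans (Nat.pow_le_pow_left (by omega) _)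
  rw [hsize, sizeBound_eq]
  simp only [env, wordBound]
  unfold edgeBound at *
  have hp : 0 < 2 ^ k * (φ.vars + 1) ^ k := by positivity
  have hH : 0 < 2 ^ ((φ.vars + 1) / 2) := by positivity
  generalize 2 ^ k * (φ.vars + 1) ^ k = p at *
  generalize 2 ^ ((φ.vars + 1) / 2) = H at *
  generalize (reductionEdges φ.vars φ.lists).length = E at *
  generalize φ.lists.length = M at *
  generalize φ.vars = n at *
  obtain ⟨Y, hY⟩ : ∃ Y, Y = (k + 1) * ((n + 1) * p ^ 2 * H) := ⟨_, rfl⟩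
  -- After expansion, the size, the words and the time are sums of monomials in `k + 1`, `n`, `M`
  -- and `H` of degree at most two in `M` and one in the others. All of them are at most `Y`, and
  -- `10000` covers the sum of the coefficients.
  have key : ∀ a b c d, a ≤ k + 1 → b ≤ n + 1 → c ≤ p ^ 2 → d ≤ H → a * (b * c * d) ≤ Y := by
    intro a b c d ha hb hc hd
    rw [hY]
    gcongr
  have hpp : p ≤ p ^ 2 := Nat.le_self_pow (by omega) p
  have h1 : 1 ≤ Y := by simpa using key 1 1 1 1 (by omega) (by omega) (by omega) (by omega)
  have hk : k + 1 ≤ Y := by simpa using key (k + 1) 1 1 1 le_rfl (by omega) (by omega) (by omega)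
  have hn : n + 1 ≤ Y := by simpa using key 1 (n + 1) 1 1 (by omega) le_rfl (by omega) (by omega)
  have hH1 : H ≤ Y := by simpa using key 1 1 1 H (by omega) (by omega) (by omega) le_rfl
  have hMY : M ≤ Y := by simpa using key 1 1 M 1 (by omega) (by omega) (by omega) (by omega)
  have hMM : M * M ≤ Y := by
    simpa using key 1 1 (M * M) 1 (by omega) (by omega)
      (by rw [pow_two]; exact Nat.mul_le_mul hM hM) (by omega)
  have hMH : M * H ≤ Y := by simpa using key 1 1 M H (by omega) (by omega) (by omega) le_rfl
  have hkM : (k + 1) * M ≤ Y := by simpa using key (k + 1) 1 M 1 le_rfl (by omega) (by omega) hH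
  have hnH : n * H ≤ Y := by simpa using key 1 n 1 H (by omega) (by omega) (by omega) le_rfl
  have hkMH : (k + 1) * M * H ≤ Y := by
    simpa [mul_assoc] using key (k + 1) 1 M H le_rfl (by omega) (by omega) le_rfl
  rw [← hY]
  have e1 : (M + 2) * (M + 2) = M * M + 4 * M + 4 := by ring
  have e2 : H * (M + 1) = M * H + H := by ring
  have e3 : (k + 3) * M = (k + 1) * M + 2 * M := by ring
  have e4 : (40 * (M + 2) + 40) * (M + 2) = 40 * (M * M) + 200 * M + 240 := by ring
  have e5 : (100 * n + 100 * ((k + 1) * M) + 100) * H =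
    100 * (n * H) + 100 * ((k + 1) * M * H) + 100 * H := by ring
  rw [e1, e2] at hedges
  rw [e1, e2, e3, e4, e5]
  refine ⟨by omega, by omega, by omega⟩

/-- Words of `O(n)` bits suffice for everything that the reduction and the simulation handle. -/
theorem exists_sizeBound_le_two_pow (k : ℕ) : ∃ a, ∀ n, sizeBound k n ≤ 2 ^ (a * (n + 1)) := by
  refine ⟨10000 * (k + 1) * 4 ^ k + (2 * k + 1) + 1, fun n => ?_⟩
  rw [add_mul, add_mul, pow_add, pow_add, sizeBound]
  generalize 10000 * (k + 1) * 4 ^ k = c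
  have h1 : c ≤ 2 ^ (c * (n + 1)) :=
    Nat.lt_two_pow_self.le.trans (Nat.pow_le_pow_right (by omega) (Nat.le_mul_of_pos_right _ (by omega)))
  have h2 : (n + 1) ^ (2 * k + 1) ≤ 2 ^ ((2 * k + 1) * (n + 1)) := by
    rw [pow_mul']
    exact Nat.pow_le_pow_left Nat.lt_two_pow_self.le _
  have h3 : 2 ^ ((n + 1) / 2) ≤ 2 ^ (1 * (n + 1)) := Nat.pow_le_pow_right (by omega) (by omega)
  gcongr

/-- The polynomial factor is absorbed by `2 ^ (δ * n)`. It is estimated at `n + 1` instead of `n`,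
whence the constant `2 ^ δ`; rounding up in `(n + 1) / 2` costs a factor of at most `2`. -/
theorem exists_sizeBound_le_rpow (k : ℕ) {δ : ℝ} (hδ : 0 < δ) :
    ∃ C : ℝ, 0 < C ∧ ∀ n : ℕ, (sizeBound k n : ℝ) ≤ C * 2 ^ ((1 / 2 + δ) * n) := by
  have hβ : (1 : ℝ) < 2 ^ δ := Real.one_lt_rpow (by norm_num) hδ
  have hβ0 : (0 : ℝ) < 2 ^ δ := by positivity
  obtain ⟨C, hC, hle⟩ := Asymptotics.bound_of_isBigO_nat_atTop
    (isLittleO_pow_const_const_pow_of_one_lt (R := ℝ) (2 * k + 1) hβ).isBigO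
  refine ⟨(10000 * (k + 1) * 4 ^ k : ℕ) * (C * 2 ^ δ) * 2, by positivity, fun n => ?_⟩
  have h1 : ((n : ℝ) + 1) ^ (2 * k + 1) ≤ C * 2 ^ δ * 2 ^ (δ * n) := by
    have := hle (x := n + 1) (by positivity)
    rw [Real.norm_of_nonneg (by positivity), Real.norm_of_nonneg (by positivity)] at this
    rw [Real.rpow_mul (by norm_num), Real.rpow_natCast]
    push_cast at this
    rw [pow_succ _ n] at this
    linarith
  have h2 : (2 : ℝ) ^ ((n + 1) / 2) ≤ 2 * 2 ^ (1 / 2 * (n : ℝ)) := by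
    rw [← Real.rpow_natCast]
    calc (2 : ℝ) ^ (((n + 1) / 2 : ℕ) : ℝ) ≤ 2 ^ (1 + 1 / 2 * (n : ℝ)) := by
          refine Real.rpow_le_rpow_of_exponent_le (by norm_num) ?_
          have : (((n + 1) / 2 : ℕ) : ℝ) ≤ ((n + 1 : ℕ) : ℝ) / 2 := Nat.cast_div_le
          push_cast at this ⊢
          linarith
      _ = 2 * 2 ^ (1 / 2 * (n : ℝ)) := by rw [Real.rpow_add (by norm_num), Real.rpow_one]
  rw [add_mul, Real.rpow_add (by norm_num)]
  unfold sizeBound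
  rw [Nat.cast_mul, Nat.cast_mul _ ((n + 1) ^ _)]
  push_cast
  calc _ ≤ (10000 * ((k : ℝ) + 1) * 4 ^ k) * (C * 2 ^ δ * 2 ^ (δ * n)) * (2 * 2 ^ (1 / 2 * (n : ℝ))) := by
        gcongr
    _ = _ := by ring

theorem not_trulySubquadraticDecidable_of_seth (hS : SETH) :
    ¬ TrulySubquadraticDecidable
      (fun I => I.graph.Connected ∧ IsSplit I.graph ∧ HasDominatingEdge I.graph ∧
        (I.graph.diam = 2 ∨ I.graph.diam = 3)) (fun I => I.graph.diam = 3) := by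
  rintro ⟨P, c, C, ε, hε, hP⟩
  -- With `η ≤ 1` the exponent `2 - η` is at least `1`, so the time of the reduction itself is
  -- absorbed as well.
  obtain ⟨η, hη0, hη1, hηε⟩ : ∃ η : ℝ, 0 < η ∧ η ≤ 1 ∧ η ≤ ε :=
    ⟨min ε 1, lt_min hε one_pos, min_le_right _ _, min_le_left _ _⟩
  have hb1 : (1 : ℝ) < 2 ^ (1 - η / 4) := Real.one_lt_rpow (by norm_num) (by linarith)
  have hb2 : (2 : ℝ) ^ (1 - η / 4) < 2 := by
    conv_rhs => rw [← Real.rpow_one 2]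
    exact Real.rpow_lt_rpow_of_exponent_lt (by norm_num) (by linarith)
  -- SETH is refuted for the base `2 ^ (1 - η / 4)`, which lies strictly between `1` and `2`.
  obtain ⟨k, hk⟩ := hS (2 - 2 ^ (1 - η / 4)) (by linarith) (by linarith)
  obtain ⟨a, ha⟩ := exists_sizeBound_le_two_pow k
  obtain ⟨D, hD0, hD⟩ := exists_sizeBound_le_rpow k (δ := η / 8) (by linarith)
  -- In the word length, `(c + 1) * (a + 1)` covers the simulated words and the values of the
  -- reduction, and the additional `8` covers the factor `32` of the addresses. The constant `2 + 10
  -- * |C|` pays for the reduction, the final copy and the tenfold slowdown; `C` need not be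
  -- nonnegative.
  refine hk ⟨reduce.followedBy (k + 1) 3 P, (c + 1) * (a + 1) + 8,
    (2 + 10 * |C|) * D ^ (2 - η), fun φ => ?_⟩
  obtain ⟨h1, h2, h3, h4, -⟩ := reductionGraph_spec φ.vars φ.lists
  have hdec := hP (reductionGraph φ.vars φ.lists) ⟨h1, h2, h3, h4⟩
  obtain ⟨b1, b2, b3⟩ := φ.bounds
  have ha := ha φ.vars
  have hpos : 1 ≤ (reductionGraph φ.vars φ.lists).size := by
    have : (reductionGraph φ.vars φ.lists).order ≤ (reductionGraph φ.vars φ.lists).size :=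
      Nat.le_add_right _ _
    have : (reductionGraph φ.vars φ.lists).order =
      φ.lists.length + 2 + 2 * 2 ^ ((φ.vars + 1) / 2) := rfl
    omega
  obtain ⟨E, hE⟩ : ∃ E, E = (c + 1) * (a + 1) * (φ.vars + 1) := ⟨_, rfl⟩
  have hE1 : a * (φ.vars + 1) ≤ E := by
    rw [hE]
    exact Nat.mul_le_mul_right _ (by nlinarith)
  have hE2 : (reductionGraph φ.vars φ.lists).wordLength c ≤ E := by
    have : Nat.log 2 (reductionGraph φ.vars φ.lists).size ≤ a * (φ.vars + 1) := by
      rw [← Nat.log_pow (b := 2) (by omega) (a * (φ.vars + 1))]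
      exact Nat.log_mono_right (b1.trans ha)
    rw [hE, mul_assoc, GraphInput.wordLength]
    exact Nat.mul_le_mul (by omega) (by rw [add_mul]; omega)
  have hW : 2 ^ E * 128 ≤ 2 ^ (((c + 1) * (a + 1) + 8) * (φ.vars + 1)) := by
    rw [show 128 = 2 ^ 7 by norm_num, ← pow_add]
    refine Nat.pow_le_pow_right (by omega) ?_
    rw [add_mul, ← hE]
    omega
  have hS1 : sizeBound k φ.vars ≤ 2 ^ E := ha.trans (Nat.pow_le_pow_right (by omega) hE1)
  have hS2 := Nat.pow_le_pow_right (n := 2) (by omega) hE2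
  have hrun := decidesWithin_followedBy (T := sizeBound k φ.vars) (I := φ.env) (g := 3)
    (q := k + 1) (c := reduce)
    (w := ((c + 1) * (a + 1) + 8) * (φ.vars + 1))
    (w' := (reductionGraph φ.vars φ.lists).wordLength c) rfl (by simp [KCNF.env, φ.code_eq]) φ.length_code_le
    (by omega) (by omega) ?_ hdec
  · obtain ⟨t, ht, hhalt, hans, hlt⟩ := hrun
    refine ⟨t, ht.trans ?_, hhalt, hans.trans φ.reductionGraph_diam_eq_three_iff, hlt⟩
    rw [sub_sub_cancel]
    have hs1 : (1 : ℝ) ≤ sizeBound k φ.vars := by exact_mod_cast hpos.trans b1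
    have hs2 : ((reductionGraph φ.vars φ.lists).size : ℝ) ^ (2 - ε) ≤
        (sizeBound k φ.vars : ℝ) ^ (2 - η) := by
      refine (Real.rpow_le_rpow_of_exponent_le (by exact_mod_cast hpos)
        (by linarith : 2 - ε ≤ 2 - η)).trans ?_
      exact Real.rpow_le_rpow (by positivity) (by exact_mod_cast b1) (by linarith)
    have hs3 : (sizeBound k φ.vars : ℝ) ≤ (sizeBound k φ.vars : ℝ) ^ (2 - η) :=
      Real.self_le_rpow_of_one_le hs1 (by linarith)
    have hs4 : (sizeBound k φ.vars : ℝ) ^ (2 - η) ≤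
        D ^ (2 - η) * (2 ^ (1 - η / 4)) ^ φ.vars := by
      refine (Real.rpow_le_rpow (by positivity) (hD φ.vars) (by linarith)).trans ?_
      rw [Real.mul_rpow hD0.le (by positivity)]
      gcongr
      rw [← Real.rpow_mul (by norm_num), ← Real.rpow_natCast, ← Real.rpow_mul (by norm_num)]
      refine Real.rpow_le_rpow_of_exponent_le (by norm_num) ?_
      have : (0 : ℝ) ≤ φ.vars := by positivity
      -- With `δ = η / 8` the product equals `1 - η / 4 - η ^ 2 / 8`.
      have h5 : (1 / 2 + η / 8) * (2 - η) ≤ 1 - η / 4 := by nlinarith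
      nlinarith
    have hC : C * ((reductionGraph φ.vars φ.lists).size : ℝ) ^ (2 - ε) ≤
        |C| * (sizeBound k φ.vars : ℝ) ^ (2 - η) :=
      mul_le_mul (le_abs_self C) hs2 (by positivity) (abs_nonneg C)
    calc _ ≤ (2 + 10 * |C|) * (sizeBound k φ.vars : ℝ) ^ (2 - η) := by linarith
      _ ≤ (2 + 10 * |C|) * (D ^ (2 - η) * (2 ^ (1 - η / 4)) ^ φ.vars) := by gcongr
      _ = _ := by ring
  · refine Cmd.Wp.mono (reduce_wp φ.clauseInput le_rfl fun _ _ => rfl) ?_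
    rintro s ⟨f1, f2⟩
    refine ⟨f1, ?_⟩
    exact_mod_cast f2.trans b3

end Dicho

theorem mainTheorem2 :
    (∀ (V : Type*) (G : SimpleGraph V), G.Connected → Dicho.IsChordal G →
      Dicho.HasDominatingShortestPath G →
      ∀ (n : ℕ) (σ₁ σ₂ σ₃ : Fin (n + 1) ≃ V), Dicho.IsThreeSweep G σ₁ σ₂ σ₃ →
      ∀ w : V, w = σ₂ (Fin.last n) ∨ w = σ₃ (Fin.last n) →
      ∀ d : ℕ, 3 ≤ d → G.eccent w = d → G.diam = d) ∧
    Dicho.LinearTimeDecidable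
      (fun I => I.graph.Connected ∧ Dicho.IsChordal I.graph ∧
        Dicho.HasDominatingShortestPath I.graph)
      (fun I => 4 ≤ I.graph.diam) ∧
    (Dicho.SETH →
      ¬ Dicho.TrulySubquadraticDecidable
        (fun I => I.graph.Connected ∧ Dicho.IsSplit I.graph ∧
          Dicho.HasDominatingEdge I.graph ∧ (I.graph.diam = 2 ∨ I.graph.diam = 3))
        (fun I => I.graph.diam = 3)) :=
  ⟨fun _ _ hconn hG hdom _ _ _ _ h _ hw _ hd he =>
      Dicho.threeSweep_diam hconn hG hdom h hw hd he,
    Dicho.linearTimeDecidable_four_le_diam, Dicho.not_trulySubquadraticDecidable_of_seth⟩
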